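/- Let $\omega\ne 0$ and $\Phi_0$ be real constants and consider $u''+2u-2u^3=\varepsilon\cos(\omega t+\Phi_0)$ with small $\varepsilon>0$. The unperturbed equation has the separatrices $u=\pm\tanh t$, and $v_1=\cosh^{-2}t$, $v_2=\left(\tfrac{\sinh 4t}{32}+\tfrac{\sinh 2t}{4}+\tfrac{3t}{8}\right)\cosh^{-2}t$ are solutions of the linearized equation $v''+2v-6\tanh^2(t)\,v=0$. There is $\varepsilon_0>0$ such that for every $\varepsilon\in(0,\varepsilon_0)$ there are a real sequence $\{B_n^-\}_{n\ge1}$ (depending on $\varepsilon$), times $0=T_0,T_1,T_2,\dots$, a function $u(t,\varepsilon)$, and functions $U_n^k(t)$ ($k,n\ge0$) with the following properties. (1) For each $k$ the series $\sum_n\varepsilon^nU_n^k(t)$ solves, coefficient by coefficient in powers of $\varepsilon$, the equation $u''+2u-2u^3=\varepsilon\cos(\omega t+\Phi_0+\omega T_k)$, and $U_0^k=(-1)^k\tanh t$. Moreover $|U_n^k(t)|\le C_ne^{2n|t|}$. (2) As $t\to-\infty$, and for every $n\ge1$, $U_n^0$ has an expansion in terms $e^{-2\kappa t}t^l\cos(m\omega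 t)$, $e^{-2\kappa t}t^l\sin(m\omega t)$ ($\kappa\le n$) in which the pure exponential $e^{2t}$ has coefficient $4A_n^-=0$ and the pure exponential $e^{-2t}$ has coefficient $-B_n^- /16$. (3) For all $k\ge0$ denote by $B_1^+(k)/16$ the coefficient of $e^{2t}$ in $U_1^{2k}$ as $t\to+\infty$ (the $k$-th passage along the upper separatrix), by $-b_1^+(k)/16$ the coefficient of $e^{-2t}$ in $U_1^{2k+1}$ as $t\to-\infty$, and by $b_1^-(k)/16$ the coefficient of $e^{2t}$ in $U_1^{2k+1}$ as $t\to+\infty$ (the $k$-th passage along the lower separatrix). Then $B_1^+(k)<0$, $b_1^+(k)>0$ and $b_1^-(k)>0$ for all $k$. (4) $u$ is an asymptotic solution: there is $\delta>0$ such that for every $n$ its residual in the equation is $o(\varepsilon^n)$ as $\varepsilon\to0$, uniformly for all $t$ with $\varepsilon e^{-2t}\le\delta$. For every $n$ there are $C$ and $\delta>0$ independent of $\varepsilon$ and $k$ such that $$\Big|u(t,\varepsilon)-\sum_{j=0}^{n}\varepsilon^jU_j^k(t-T_k)\Big|\le C\big(\varepsilon e^{2|t-T_k|}\big)^{n+1}\quad\text{whenever}\quad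 \varepsilon e^{2|t-T_k|}\le\delta .$$ (5) The asymptotic solution oscillates near the separatrices for times $t=O(N\ln\varepsilon)$, for every $N\in\mathbb N$: there is a constant $C$ independent of $\varepsilon$ and $k$ with $|T_{k+1}-T_k+\tfrac12\ln\varepsilon|\le C$, and for every $\eta>0$, all sufficiently small $\varepsilon$, every $N$ and every $t\in[0,-N\ln\varepsilon]$ there is $k$ with $|t-T_k|\le-\tfrac14\ln\varepsilon+C$, $|u-(-1)^k\tanh(t-T_k)|\le\eta$ and $|u'-(-1)^k\cosh^{-2}(t-T_k)|\le\eta$. The constants $C_n$, $C$ and $\delta$ do not depend on $\varepsilon$ and $k$. -/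

import Mathlib

open Filter Topology Asymptotics Finset

/-- The residual left when `u` is substituted into `u'' + 2u - 2u³ = ε cos(ωt + Φ₀)`. -/
noncomputable def duffingResidual (ω Φ₀ ε : ℝ) (u : ℝ → ℝ) (t : ℝ) : ℝ :=
  deriv (deriv u) t + 2 * u t - 2 * (u t) ^ 3 - ε * Real.cos (ω * t + Φ₀)

/-- A family `u ε` of functions is an asymptotic solution for all times
`t ≥ (1/2) ln ε + const`: its residual is smaller than every power of `ε`,
uniformly in these times. -/
def IsAsymptoticSolution (ω Φ₀ : ℝ) (u : ℝ → ℝ → ℝ) : Prop :=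
  ∃ δ > 0, ∀ n : ℕ, ∃ ε₁ > 0, ∀ ε ∈ Set.Ioo 0 ε₁, ∀ t : ℝ, ε * Real.exp (-2 * t) ≤ δ →
    ContDiffAt ℝ 2 (u ε) t ∧ |duffingResidual ω Φ₀ ε (u ε) t| ≤ ε ^ n

/-- `∑ εⁿ Uₙ(t)` is a formal power series solution of `u'' + 2u - 2u³ = ε cos(ωt + Φ)`
whose leading term is the upper (`s = 1`) or the lower (`s = -1`) separatrix `s tanh t`.
The equation is the coefficient of `εⁿ`; isolating the terms that contain `Uₙ`, it reads
`Uₙ'' + 2Uₙ - 6U₀²Uₙ = fₙ` for `n ≥ 1`, with `f₁ = cos(ωt + Φ)`. -/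
structure IsSeparatrixSeries (ω Φ s : ℝ) (U : ℕ → ℝ → ℝ) : Prop where
  leading : ∀ t, U 0 t = s * Real.tanh t
  contDiff : ∀ n, ContDiff ℝ 2 (U n)
  equation : ∀ n t, deriv (deriv (U n)) t + 2 * U n t
      - 2 * ∑ p ∈ antidiagonal n, ∑ q ∈ antidiagonal p.2, U p.1 t * U q.1 t * U q.2 t
    = if n = 1 then Real.cos (ω * t + Φ) else 0

/-- As `t → +∞`, the `n`-th coefficient `V` is a finite sum of terms
`e^{2κt} t^l cos(mωt)` and `e^{2κt} t^l sin(mωt)`, with `-1 ≤ κ ≤ n`, up to `o(e^{-2t})`.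
The parameters `A` and `B` are read off the pure exponentials `4A e^{-2t}` and
`(B/16) e^{2t}` in it. For `ω ≠ 0` they are determined by `V`. -/
def HasParamsAtTop (ω : ℝ) (n : ℕ) (V : ℝ → ℝ) (A B : ℝ) : Prop :=
  ∃ (L : ℕ) (c d : ℤ → ℕ → ℕ → ℝ), c (-1) 0 0 = 4 * A ∧ c 1 0 0 = B / 16 ∧
    (fun t : ℝ => V t - ∑ κ ∈ Icc (-1 : ℤ) n, Real.exp (2 * κ * t) *
        ∑ l ∈ range (L + 1), t ^ l * ∑ m ∈ range (L + 1),
          (c κ l m * Real.cos (m * ω * t) + d κ l m * Real.sin (m * ω * t)))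
      =o[atTop] fun t : ℝ => Real.exp (-2 * t)

/-- The same as `t → -∞`: the pure exponentials are `4A e^{2t}` and `-(B/16) e^{-2t}`.
The minus sign makes `B` the coefficient of the growing solution
`v₂ = (sinh 4t / 32 + sinh 2t / 4 + 3t / 8) / cosh² t` of the linearized equation at both
ends (`v₂ ~ ± e^{± 2t} / 16` as `t → ± ∞`), so that for `n = 1` the value at the top minus the
value at the bottom is the Melnikov integral `∫ cos(ωt + Φ) / cosh² t dt`. -/
def HasParamsAtBot (ω : ℝ) (n : ℕ) (V : ℝ → ℝ) (A B : ℝ) : Prop :=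
  HasParamsAtTop ω n (fun t => V (-t)) A (-B)

/-- `u(t, ε) ~ ∑ εⁿ Uₙᵏ(t - T_k)` for `|t - T_k| ≪ -(1/2) ln ε`, that is as
`ε e^{2|t - T_k|} → 0`, for all passages `k`; here `U ε k n` is the coefficient `Uₙᵏ`,
which may depend on `ε` but is bounded by `Cₙ e^{2n|t|}`. -/
def HasSeparatrixExpansions (ε₀ : ℝ) (u : ℝ → ℝ → ℝ) (T : ℝ → ℕ → ℝ)
    (U : ℝ → ℕ → ℕ → ℝ → ℝ) : Prop :=
  (∀ n : ℕ, ∃ C : ℝ, ∀ ε ∈ Set.Ioo 0 ε₀, ∀ k t,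
    |U ε k n t| ≤ C * Real.exp (2 * n * |t|)) ∧
  ∀ n : ℕ, ∃ C : ℝ, ∃ δ > 0, ∀ ε ∈ Set.Ioo 0 ε₀, ∀ k t,
    ε * Real.exp (2 * |t - T ε k|) ≤ δ →
      |u ε t - ∑ j ∈ range (n + 1), ε ^ j * U ε k j (t - T ε k)|
        ≤ C * (ε * Real.exp (2 * |t - T ε k|)) ^ (n + 1)

/-- `u` oscillates near the separatrices: the passages, centred at the times `T_k`, follow each
other after times `-(1/2) ln ε + O(1)`, and for every `N`, at all times `0 ≤ t ≤ -N ln ε`, the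
point `(u, u')` is uniformly close, as `ε → 0`, to the point `(±tanh, ±1/cosh²)` of the upper
(`k` even) or lower (`k` odd) separatrix given by the passage `k` going on at that time. -/
def OscillatesNearSeparatrices (ε₀ : ℝ) (u : ℝ → ℝ → ℝ) (T : ℝ → ℕ → ℝ) : Prop :=
  ∃ C : ℝ,
    (∀ ε ∈ Set.Ioo 0 ε₀, ∀ k, |T ε (k + 1) - T ε k + Real.log ε / 2| ≤ C) ∧
    ∀ η > 0, ∃ ε₁ > 0, ∀ ε ∈ Set.Ioo 0 ε₁, ∀ N : ℕ, ∀ t ∈ Set.Icc 0 (-(N : ℝ) * Real.log ε),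
      ∃ k : ℕ, |t - T ε k| ≤ -Real.log ε / 4 + C ∧
        |u ε t - (-1) ^ k * Real.tanh (t - T ε k)| ≤ η ∧
        |deriv (u ε) t - (-1) ^ k * (1 / Real.cosh (t - T ε k) ^ 2)| ≤ η

/-! The solution constructed is an exact one, so its residual vanishes; the work lies in choosing
its initial data and in comparing it with formal series.

One passage. Let `deficit` be h = ((1-u²)² - u'²)/2, which vanishes on the separatrices and changes
only through the forcing: h' = -ε u' cos(ωt + Φ₀). A solution that crosses u = 0 at a time T within
O(ε) of the separatrix s tanh(t - T) stays within O(ε e^{2|t-T|}) of it (`exists_near_separatrix`),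
because the linearized equation v'' = (4 - 6 sech²) v grows at the rate e^{2|t|}. Hence over the
central part of the passage h/ε changes by about -s M cos(ωT + Φ₀), where M is the Melnikov integral
(`exists_deficit_change`). The substitution x = (1 + tanh t)/2 gives M = 2 |Γ(1 + iω/2)|² > 0
(`melnikov_pos`). If h = εH with H > 0 bounded below at the end of that part, the orbit turns near
the saddle inside the separatrices and has its next zero after the time (1/2) log(1/(εH)) + O(1)
(`exists_turn`, `exists_passage`).

Shooting. The free parameter is b = U₁'(0). While H runs through an interval [cl, ch] with ch/cl
large, the logarithm makes the time of the next zero sweep more than a full period of the forcing,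
so cos takes both values ±1 and the next H again sweeps over [cl, ch]. Nested parameter intervals
(`exists_shooting`) leave a b for which H stays in [cl, ch] at all passages. Positivity of H is what
gives the signs of the parameters B₁⁺, b₁⁺, b₁⁻, for these are U₁'(0) plus or minus a half-line
Melnikov integral.

Formal series. For k ≥ 1 the passage is centred at a zero of u, and the series with Uₙ(0) = 0 and
U₁'(0) = (u'(T_k) - (-1)^k)/ε reproduces the data exactly. For k = 0 the condition Aₙ⁻ = 0
prescribes Uₙ(0) as a polynomial in b; the initial value u(0) is then a function S(ε, b), continuous
in b, with the asymptotic series ∑ εⁿ Uₙ(0) (`exists_sum_of_formal`). Expansions at infinity come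
from an algebra of functions t^l e^{(2κ+imω)t} closed under products and primitives
(`HasExpansion`), and remainders are bounded by induction on the order (`exists_remainder_bound`).

All solutions are taken of an equation whose right-hand side is truncated outside |u|, |u'| ≤ 3.
This gives global existence and continuity in the data without a priori bounds, and the truncation
turns out never to act on the solution at the times considered. -/

/-! ### Hyperbolic functions and the linearised equation -/

/-- The square of the hyperbolic secant, the derivative of `tanh`. -/
noncomputable def sechSq (t : ℝ) : ℝ := 1 / Real.cosh t ^ 2

lemma sechSq_pos (t : ℝ) : 0 < sechSq t := by
  have := Real.cosh_pos t
  unfold sechSq; positivity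

lemma sechSq_le_one (t : ℝ) : sechSq t ≤ 1 := by
  unfold sechSq
  have := Real.one_le_cosh t
  rw [div_le_one (by positivity)]
  nlinarith

lemma sechSq_neg (t : ℝ) : sechSq (-t) = sechSq t := by simp [sechSq]

lemma sechSq_mul_cosh_sq (t : ℝ) : sechSq t * Real.cosh t ^ 2 = 1 := by
  have := Real.cosh_pos t
  unfold sechSq; field_simp

lemma tanh_sq_eq (t : ℝ) : Real.tanh t ^ 2 = 1 - sechSq t := by
  have := Real.cosh_pos t
  have h := Real.cosh_sq t
  rw [Real.tanh_eq_sinh_div_cosh, sechSq]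
  field_simp
  linarith

lemma sechSq_eq (t : ℝ) : sechSq t = 1 - Real.tanh t ^ 2 := by rw [tanh_sq_eq]; ring

lemma hasDerivAt_tanh (t : ℝ) : HasDerivAt Real.tanh (sechSq t) t := by
  have hc := Real.cosh_pos t
  have h := (Real.hasDerivAt_sinh t).div (Real.hasDerivAt_cosh t) hc.ne'
  have e : Real.tanh = fun x => Real.sinh x / Real.cosh x := by
    ext x; exact Real.tanh_eq_sinh_div_cosh x
  rw [e]
  refine h.congr_deriv ?_
  have := Real.cosh_sq t
  rw [sechSq]
  congr 1
  nlinarith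

lemma hasDerivAt_sechSq (t : ℝ) :
    HasDerivAt sechSq (-2 * Real.tanh t * sechSq t) t := by
  have h := ((hasDerivAt_tanh t).pow 2).const_sub 1
  refine (h.congr_deriv ?_).congr_of_eventuallyEq (Eventually.of_forall fun x => sechSq_eq x)
  push_cast; ring

lemma hasDerivAt_tanh_mul_sechSq (t : ℝ) :
    HasDerivAt (fun t => -2 * Real.tanh t * sechSq t)
      ((6 * Real.tanh t ^ 2 - 2) * sechSq t) t := by
  refine (((hasDerivAt_tanh t).const_mul (-2)).mul (hasDerivAt_sechSq t)).congr_deriv ?_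
  have := tanh_sq_eq t
  linear_combination (-2 * sechSq t) * this

lemma abs_tanh_le_one (t : ℝ) : |Real.tanh t| ≤ 1 := (Real.abs_tanh_lt_one t).le

lemma continuous_sechSq : Continuous sechSq :=
  continuous_iff_continuousAt.2 fun t => (hasDerivAt_sechSq t).continuousAt

lemma continuous_tanh' : Continuous Real.tanh :=
  continuous_iff_continuousAt.2 fun t => (hasDerivAt_tanh t).continuousAt

lemma contDiff_tanh' {n : WithTop ℕ∞} : ContDiff ℝ n Real.tanh := by
  have e : Real.tanh = fun x => Real.sinh x / Real.cosh x := by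
    ext x; exact Real.tanh_eq_sinh_div_cosh x
  rw [e]
  exact Real.contDiff_sinh.div Real.contDiff_cosh fun x => (Real.cosh_pos x).ne'

lemma sechSq_le_exp (t : ℝ) : sechSq t ≤ 4 * Real.exp (-2 * |t|) := by
  have h1 : Real.exp |t| ≤ 2 * Real.cosh t := by
    rw [← Real.cosh_abs, Real.cosh_eq]
    have := Real.exp_pos (-|t|)
    linarith
  have h2 : Real.exp (-2 * |t|) * Real.exp |t| ^ 2 = 1 := by
    rw [← Real.exp_nat_mul, ← Real.exp_add]; simp
  have h3 := sechSq_mul_cosh_sq t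
  have h4 := Real.exp_pos |t|
  have h5 := sechSq_pos t
  have h6 : Real.exp |t| ^ 2 ≤ 4 * Real.cosh t ^ 2 := by nlinarith
  have h7 : sechSq t * Real.exp |t| ^ 2 ≤ 4 := by nlinarith
  have h8 := Real.exp_pos (-2 * |t|)
  calc sechSq t = sechSq t * (Real.exp (-2 * |t|) * Real.exp |t| ^ 2) := by rw [h2, mul_one]
    _ = (sechSq t * Real.exp |t| ^ 2) * Real.exp (-2 * |t|) := by ring
    _ ≤ _ := by gcongr

lemma exp_le_sechSq (t : ℝ) : Real.exp (-2 * |t|) ≤ sechSq t := by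
  have h1 : Real.cosh t ≤ Real.exp |t| := by
    rw [← Real.cosh_abs, Real.cosh_eq]
    have : Real.exp (-|t|) ≤ Real.exp |t| := Real.exp_le_exp.2 (by linarith [abs_nonneg t])
    linarith
  have h2 : Real.exp (-2 * |t|) = 1 / Real.exp |t| ^ 2 := by
    rw [← Real.exp_nat_mul, one_div, ← Real.exp_neg]; congr 1; push_cast; ring
  have := Real.cosh_pos t
  rw [h2, sechSq]
  gcongr

/-- The growing solution of the linearised equation. -/
noncomputable def growing (t : ℝ) : ℝ :=
  (Real.sinh (4 * t) / 32 + Real.sinh (2 * t) / 4 + 3 * t / 8) * sechSq t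

/-- The derivative of `growing`. -/
noncomputable def growingDeriv (t : ℝ) : ℝ := Real.cosh t ^ 2 - 2 * Real.tanh t * growing t

/-- The bracket in `growing` is the integral of cosh⁴ from 0 to t, as reduction of order from the
decaying solution `sechSq` requires; its derivative times `sechSq` is therefore cosh². -/
lemma hasDerivAt_growing (t : ℝ) : HasDerivAt growing (growingDeriv t) t := by
  have h4 : HasDerivAt (fun t : ℝ => Real.sinh (4 * t)) (Real.cosh (4 * t) * (4 * 1)) t :=
    ((hasDerivAt_id t).const_mul 4).sinh
  have h2 : HasDerivAt (fun t : ℝ => Real.sinh (2 * t)) (Real.cosh (2 * t) * (2 * 1)) t :=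
    ((hasDerivAt_id t).const_mul 2).sinh
  have h := (((h4.div_const 32).add (h2.div_const 4)).add
    (((hasDerivAt_id t).const_mul 3).div_const 8)).mul (hasDerivAt_sechSq t)
  refine h.congr_deriv ?_
  have e2 : Real.cosh (2 * t) = 2 * Real.cosh t ^ 2 - 1 := by
    rw [Real.cosh_two_mul, Real.sinh_sq]; ring
  have e4 : Real.cosh (4 * t) = 2 * (2 * Real.cosh t ^ 2 - 1) ^ 2 - 1 := by
    rw [← e2, show 4 * t = 2 * (2 * t) by ring, Real.cosh_two_mul (2 * t), Real.sinh_sq]; ring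
  have hs := sechSq_mul_cosh_sq t
  simp only [growingDeriv, growing, Pi.add_apply, id]
  rw [e2, e4]
  linear_combination (Real.cosh t ^ 2) * hs

lemma hasDerivAt_growingDeriv (t : ℝ) :
    HasDerivAt growingDeriv ((6 * Real.tanh t ^ 2 - 2) * growing t) t := by
  have h := ((Real.hasDerivAt_cosh t).pow 2).sub
    (((hasDerivAt_tanh t).const_mul 2).mul (hasDerivAt_growing t))
  refine h.congr_deriv ?_
  have hs := tanh_sq_eq t
  have : Real.tanh t * Real.cosh t = Real.sinh t := by
    rw [Real.tanh_eq_sinh_div_cosh]; field_simp [(Real.cosh_pos t).ne']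
  simp only [growingDeriv]
  push_cast
  linear_combination (-2 * growing t) * hs - 2 * Real.cosh t * this

lemma growing_neg (t : ℝ) : growing (-t) = -growing t := by
  simp only [growing, sechSq_neg, mul_neg, Real.sinh_neg]; ring

lemma growing_zero : growing 0 = 0 := by simp [growing]

lemma sechSq_zero : sechSq 0 = 1 := by simp [sechSq]

lemma growingDeriv_zero : growingDeriv 0 = 1 := by simp [growingDeriv]

lemma continuous_growing : Continuous growing :=
  continuous_iff_continuousAt.2 fun t => (hasDerivAt_growing t).continuousAt

/-- A function with continuous second derivative, given explicitly, is `C²`. -/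
lemma contDiff_two_of_hasDerivAt {f f' f'' : ℝ → ℝ} (h1 : ∀ t, HasDerivAt f (f' t) t)
    (h2 : ∀ t, HasDerivAt f' (f'' t) t) (h3 : Continuous f'') : ContDiff ℝ 2 f := by
  have e1 : deriv f = f' := funext fun t => (h1 t).deriv
  have e2 : deriv f' = f'' := funext fun t => (h2 t).deriv
  rw [show (2 : WithTop ℕ∞) = 1 + 1 by norm_num, contDiff_succ_iff_deriv]
  refine ⟨fun t => (h1 t).differentiableAt, by simp, ?_⟩
  rw [e1, contDiff_one_iff_deriv, e2]
  exact ⟨fun t => (h2 t).differentiableAt, h3⟩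

lemma deriv_deriv_of_hasDerivAt {f f' f'' : ℝ → ℝ} (h1 : ∀ t, HasDerivAt f (f' t) t)
    (h2 : ∀ t, HasDerivAt f' (f'' t) t) (t : ℝ) : deriv (deriv f) t = f'' t := by
  have e1 : deriv f = f' := funext fun t => (h1 t).deriv
  rw [e1]; exact (h2 t).deriv

/-- The solution of `w'' + 2w - 6 tanh² w = g` with `w(0) = a`, `w'(0) = b`, by variation of
constants. -/
noncomputable def linSol (g : ℝ → ℝ) (a b t : ℝ) : ℝ :=
  growing t * (b + ∫ r in (0 : ℝ)..t, sechSq r * g r)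
    + sechSq t * (a - ∫ r in (0 : ℝ)..t, growing r * g r)

/-- The derivative of `linSol`. -/
noncomputable def linSolDeriv (g : ℝ → ℝ) (a b t : ℝ) : ℝ :=
  growingDeriv t * (b + ∫ r in (0 : ℝ)..t, sechSq r * g r)
    + (-2 * Real.tanh t * sechSq t) * (a - ∫ r in (0 : ℝ)..t, growing r * g r)

lemma hasDerivAt_primitive {g : ℝ → ℝ} (hg : Continuous g) (t : ℝ) :
    HasDerivAt (fun t => ∫ r in (0 : ℝ)..t, g r) (g t) t :=
  intervalIntegral.integral_hasDerivAt_right (hg.intervalIntegrable _ _)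
    hg.aestronglyMeasurable.stronglyMeasurableAtFilter hg.continuousAt

lemma hasDerivAt_linSol {g : ℝ → ℝ} (hg : Continuous g) (a b t : ℝ) :
    HasDerivAt (linSol g a b) (linSolDeriv g a b t) t := by
  have h1 := hasDerivAt_primitive (continuous_sechSq.mul hg) t
  have h2 := hasDerivAt_primitive (continuous_growing.mul hg) t
  refine (((hasDerivAt_growing t).mul (h1.const_add b)).add
    ((hasDerivAt_sechSq t).mul (h2.const_sub a))).congr_deriv ?_
  simp only [linSolDeriv, Pi.mul_apply]
  ring

/-- The inhomogeneity appears with coefficient one because `sechSq` and `growing` have Wronskian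
one. -/
lemma hasDerivAt_linSolDeriv {g : ℝ → ℝ} (hg : Continuous g) (a b t : ℝ) :
    HasDerivAt (linSolDeriv g a b) ((6 * Real.tanh t ^ 2 - 2) * linSol g a b t + g t) t := by
  have h1 := hasDerivAt_primitive (continuous_sechSq.mul hg) t
  have h2 := hasDerivAt_primitive (continuous_growing.mul hg) t
  refine (((hasDerivAt_growingDeriv t).mul (h1.const_add b)).add
    ((hasDerivAt_tanh_mul_sechSq t).mul (h2.const_sub a))).congr_deriv ?_
  have hs := sechSq_mul_cosh_sq t
  simp only [linSol, growingDeriv, Pi.mul_apply]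
  linear_combination (g t) * hs

lemma linSol_zero (g : ℝ → ℝ) (a b : ℝ) : linSol g a b 0 = a := by
  simp [linSol, growing_zero, sechSq_zero]

lemma linSolDeriv_zero (g : ℝ → ℝ) (a b : ℝ) : linSolDeriv g a b 0 = b := by
  simp [linSolDeriv, growingDeriv_zero]

lemma linSol_eq (g : ℝ → ℝ) (a b t : ℝ) :
    linSol g a b t = linSol g 0 0 t + a * sechSq t + b * growing t := by
  simp only [linSol]; ring

/-- `sechSq` is even and `growing` is odd. This reduces every statement about t → -∞ to one about t
→ +∞. -/
lemma linSol_reflect (g : ℝ → ℝ) (t : ℝ) :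
    linSol g 0 0 (-t) = linSol (fun r => g (-r)) 0 0 t := by
  have h1 : ∫ r in (0 : ℝ)..(-t), sechSq r * g r = -∫ r in (0 : ℝ)..t, sechSq r * g (-r) := by
    have := intervalIntegral.integral_comp_neg (a := 0) (b := t) (fun r => sechSq r * g r)
    simp only [sechSq_neg, neg_zero] at this
    rw [this, intervalIntegral.integral_symm]
  have h2 : ∫ r in (0 : ℝ)..(-t), growing r * g r = ∫ r in (0 : ℝ)..t, growing r * g (-r) := by
    have := intervalIntegral.integral_comp_neg (a := 0) (b := t) (fun r => growing r * g r)
    simp only [growing_neg, neg_zero, neg_mul, intervalIntegral.integral_neg] at this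
    rw [intervalIntegral.integral_symm, ← this, neg_neg]
  simp only [linSol, h1, h2, growing_neg, sechSq_neg]; ring

/-! ### Growth estimate near the separatrix -/

/-- A fencing lemma for `z'' = (4 - 6 sech²) z + g` with the sharp growth rate `e^{2t}`; the bound
on `g` may presuppose the conclusion. -/
lemma growth_of_perturbed_linear {z ζ z1 ζ1 Q Q1 G : ℝ → ℝ} {L : ℝ}
    (hz : ∀ t ∈ Set.Icc 0 L, HasDerivAt z (z1 t) t)
    (hζ : ∀ t ∈ Set.Icc 0 L, HasDerivAt ζ (ζ1 t) t)
    (hQ : ∀ t, HasDerivAt Q (Q1 t) t)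
    (hz0 : |z 0| ≤ Q 0) (hζ0 : |ζ 0| ≤ 2 * Q 0)
    (hz1 : ∀ t ∈ Set.Ico 0 L, |z1 t| ≤ |ζ t|)
    (hζ1 : ∀ t ∈ Set.Ico 0 L, |z t| ≤ Real.exp (2 * t + 3 * Real.tanh t) * Q t →
      |ζ1 t - (4 - 6 * sechSq t) * z t| ≤ G t)
    (hG : ∀ t ∈ Set.Ico 0 L, G t < 2 * Real.exp (2 * t) * Q1 t)
    (hQ1 : ∀ t ∈ Set.Ico 0 L, 0 < Q1 t) :
    ∀ t ∈ Set.Icc 0 L, |z t| ≤ Real.exp (2 * t + 3 * Real.tanh t) * Q t ∧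
      |ζ t| ≤ 2 * (Real.exp (2 * t + 3 * Real.tanh t) * Q t) := by
  -- The logarithmic derivative 2 + 3 sech² of the exponential is exactly the growth rate of
  -- max(|z|, |ζ|/2) permitted by |4 - 6 sech²| ≤ 4 + 6 sech². Since tanh is bounded, the integrable
  -- part costs only a constant factor, and Q is left to pay for the inhomogeneity.
  set B : ℝ → ℝ := fun t => Real.exp (2 * t + 3 * Real.tanh t) * Q t with hB
  have hBd : ∀ t, HasDerivAt B ((2 + 3 * sechSq t) * B t
      + Real.exp (2 * t + 3 * Real.tanh t) * Q1 t) t := by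
    intro t
    have h := ((((hasDerivAt_id t).const_mul 2).add ((hasDerivAt_tanh t).const_mul 3)).exp).mul
      (hQ t)
    refine h.congr_deriv ?_
    simp only [hB, id, Pi.add_apply]; ring
  have key : ∀ t ∈ Set.Icc 0 L, ‖(z t, ζ t / 2)‖ ≤ B t := by
    -- Fencing needs the strict inequality of derivatives only at points where the norm equals B, so
    -- the hypothesis on the inhomogeneity may assume |z| ≤ B.
    refine image_norm_le_of_norm_deriv_right_lt_deriv_boundary
      (f := fun t => (z t, ζ t / 2)) (f' := fun t => (z1 t, ζ1 t / 2)) ?_ ?_ ?_ hBd ?_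
    · intro t ht
      exact ((hz t ht).continuousAt.prodMk
        ((hζ t ht).div_const 2).continuousAt).continuousWithinAt
    · intro t ht
      have ht' := Set.Ico_subset_Icc_self ht
      exact ((hz t ht').prodMk ((hζ t ht').div_const 2)).hasDerivWithinAt
    · rw [Prod.norm_def, max_le_iff]
      simp only [hB, Real.norm_eq_abs, abs_div, abs_two, mul_zero, Real.tanh_zero, add_zero,
        Real.exp_zero, one_mul]
      exact ⟨hz0, by linarith⟩
    · intro t ht he
      have h1 : |z t| ≤ B t := by
        rw [← he, ← Real.norm_eq_abs]; exact norm_fst_le (z t, ζ t / 2)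
      have h2 : |ζ t| ≤ 2 * B t := by
        have := norm_snd_le (z t, ζ t / 2)
        rw [he] at this
        simp only [Real.norm_eq_abs, abs_div, abs_two] at this
        linarith
      have h3 := hζ1 t ht h1
      have h4 := hz1 t ht
      have h5 := hG t ht
      have h6 := hQ1 t ht
      have hs := sechSq_pos t
      have hBn : 0 ≤ B t := (abs_nonneg _).trans h1
      have hexp : Real.exp (2 * t) ≤ Real.exp (2 * t + 3 * Real.tanh t) := by
        apply Real.exp_le_exp.2
        have : 0 ≤ Real.tanh t := by
          rw [Real.tanh_eq_sinh_div_cosh]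
          exact div_nonneg (Real.sinh_nonneg_iff.2 ht.1) (Real.cosh_pos t).le
        linarith
      have h7 : Real.exp (2 * t) * Q1 t ≤ Real.exp (2 * t + 3 * Real.tanh t) * Q1 t := by gcongr
      have h8 : 0 < Real.exp (2 * t + 3 * Real.tanh t) * Q1 t := by positivity
      rw [Prod.norm_def, max_lt_iff]
      simp only [Real.norm_eq_abs, abs_div, abs_two]
      have h9 : |(4 - 6 * sechSq t) * z t| ≤ (4 + 6 * sechSq t) * B t := by
        rw [abs_mul]
        gcongr
        rw [abs_le]; constructor <;> linarith
      have h10 : |ζ1 t| ≤ |ζ1 t - (4 - 6 * sechSq t) * z t| + |(4 - 6 * sechSq t) * z t| := by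
        have := abs_add_le (ζ1 t - (4 - 6 * sechSq t) * z t) ((4 - 6 * sechSq t) * z t)
        simpa using this
      have h11 : 0 ≤ sechSq t * B t := by positivity
      constructor <;> nlinarith
  intro t ht
  have h := key t ht
  rw [Prod.norm_def, max_le_iff] at h
  simp only [Real.norm_eq_abs, abs_div, abs_two] at h
  exact ⟨h.1, by linarith [h.2]⟩

/-! ### Coefficients of the cube of a series -/

section Cubic

variable {R : Type*} [CommRing R]

/-- The coefficients of the square of a formal series. -/
def squareCoeff (a : ℕ → R) (n : ℕ) : R := ∑ q ∈ antidiagonal n, a q.1 * a q.2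

/-- The coefficients of the cube of a formal series. -/
def cubeCoeff (a : ℕ → R) (n : ℕ) : R :=
  ∑ p ∈ antidiagonal n, ∑ q ∈ antidiagonal p.2, a p.1 * a q.1 * a q.2

lemma cubeCoeff_eq (a : ℕ → R) (n : ℕ) :
    cubeCoeff a n = ∑ p ∈ antidiagonal n, a p.1 * squareCoeff a p.2 := by
  simp only [cubeCoeff, squareCoeff, mul_sum, mul_assoc]

/-- The part of the `n`-th coefficient of the cube that does not contain the `n`-th coefficient of
the series. -/
def cubeRest (a : ℕ → R) (n : ℕ) : R := cubeCoeff (Function.update a n 0) n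

/-- The index n occurs only in the pairs (0, n) and (n, 0), which are distinct for n ≠ 0; setting
the n-th entries to zero removes exactly these two. -/
lemma convolution_split (a b : ℕ → R) {n : ℕ} (hn : n ≠ 0) :
    ∑ p ∈ antidiagonal n, a p.1 * b p.2 = a 0 * b n + a n * b 0
      + ∑ p ∈ antidiagonal n, Function.update a n 0 p.1 * Function.update b n 0 p.2 := by
  have h : ∀ p ∈ antidiagonal n, a p.1 * b p.2 =
      Function.update a n 0 p.1 * Function.update b n 0 p.2
        + (if p = (n, 0) then a n * b 0 else 0) + (if p = (0, n) then a 0 * b n else 0) := by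
    rintro ⟨i, j⟩ hij
    rw [HasAntidiagonal.mem_antidiagonal] at hij
    simp only at hij
    by_cases hi : i = n
    · have hj : j = 0 := by omega
      subst hi hj
      simp [hn, Ne.symm hn]
    · by_cases hj : j = n
      · have hi0 : i = 0 := by omega
        subst hj hi0
        simp [hn, Ne.symm hn]
      · simp [hi, hj]
  rw [sum_congr rfl h, sum_add_distrib, sum_add_distrib, sum_ite_eq', sum_ite_eq',
    if_pos (by simp), if_pos (by simp)]
  ring

lemma squareCoeff_congr {a b : ℕ → R} {n : ℕ} (h : ∀ j ≤ n, a j = b j) :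
    squareCoeff a n = squareCoeff b n := by
  refine sum_congr rfl fun p hp => ?_
  rw [HasAntidiagonal.mem_antidiagonal] at hp
  rw [h p.1 (by omega), h p.2 (by omega)]

lemma cubeCoeff_congr {a b : ℕ → R} {n : ℕ} (h : ∀ j ≤ n, a j = b j) :
    cubeCoeff a n = cubeCoeff b n := by
  rw [cubeCoeff_eq, cubeCoeff_eq]
  refine sum_congr rfl fun p hp => ?_
  rw [HasAntidiagonal.mem_antidiagonal] at hp
  rw [h p.1 (by omega), squareCoeff_congr fun j hj => h j (by omega)]

lemma cubeRest_congr {a b : ℕ → R} {n : ℕ} (h : ∀ j < n, a j = b j) :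
    cubeRest a n = cubeRest b n := by
  refine cubeCoeff_congr fun j hj => ?_
  rcases eq_or_ne j n with rfl | hjn
  · simp
  · simp [Function.update_of_ne hjn, h j (by omega)]

/-- This is why each equation of the hierarchy is linear in its own unknown, with the linearization
at the leading term as operator. -/
lemma cubeCoeff_split (a : ℕ → R) {n : ℕ} (hn : n ≠ 0) :
    cubeCoeff a n = 3 * a 0 ^ 2 * a n + cubeRest a n := by
  set c := Function.update a n 0 with hc
  have c0 : c 0 = a 0 := Function.update_of_ne (Ne.symm hn) _ _
  have cn : c n = 0 := by simp [hc]
  have hs : squareCoeff a n = 2 * a 0 * a n + squareCoeff c n := by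
    rw [squareCoeff, convolution_split a a hn, squareCoeff]; ring
  have hs0 : squareCoeff a 0 = a 0 ^ 2 := by simp [squareCoeff, sq]
  rw [cubeRest, ← hc, cubeCoeff_eq, cubeCoeff_eq, convolution_split _ _ hn,
    convolution_split c (squareCoeff c) hn, hs, hs0, c0, cn]
  have e : ∑ p ∈ antidiagonal n, Function.update a n 0 p.1 *
      Function.update (squareCoeff a) n 0 p.2 = ∑ p ∈ antidiagonal n, Function.update c n 0 p.1 *
      Function.update (squareCoeff c) n 0 p.2 := by
    refine sum_congr rfl fun p hp => ?_
    rw [HasAntidiagonal.mem_antidiagonal] at hp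
    congr 1
    · simp [hc]
    · rcases eq_or_ne p.2 n with h | h
      · simp [h]
      · rw [Function.update_of_ne h, Function.update_of_ne h]
        refine squareCoeff_congr fun j hj => ?_
        rw [hc, Function.update_of_ne (by omega)]
  rw [e]; ring

lemma cubeRest_one (a : ℕ → R) : cubeRest a 1 = 0 := by
  simp [cubeRest, cubeCoeff, Finset.Nat.antidiagonal_succ]

lemma map_cubeCoeff {S : Type*} [CommRing S] (φ : R →+* S) (a : ℕ → R) (n : ℕ) :
    φ (cubeCoeff a n) = cubeCoeff (fun j => φ (a j)) n := by
  simp only [cubeCoeff, map_sum, map_mul]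

lemma map_cubeRest {S : Type*} [CommRing S] (φ : R →+* S) (a : ℕ → R) (n : ℕ) :
    φ (cubeRest a n) = cubeRest (fun j => φ (a j)) n := by
  rw [cubeRest, map_cubeCoeff, cubeRest]
  refine cubeCoeff_congr fun j _ => ?_
  rcases eq_or_ne j n with rfl | h
  · simp
  · simp [Function.update_of_ne h]

lemma cubeCoeff_pow_mul (x : R) (a : ℕ → R) (n : ℕ) :
    cubeCoeff (fun j => x ^ j * a j) n = x ^ n * cubeCoeff a n := by
  simp only [cubeCoeff, mul_sum]
  refine sum_congr rfl fun p hp => sum_congr rfl fun q hq => ?_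
  rw [HasAntidiagonal.mem_antidiagonal] at hp hq
  rw [← hp, ← hq]; ring

lemma cubeCoeff_neg (a : ℕ → R) (n : ℕ) : cubeCoeff (fun j => -a j) n = -cubeCoeff a n := by
  simp only [cubeCoeff, ← sum_neg_distrib]
  refine sum_congr rfl fun p _ => sum_congr rfl fun q _ => by ring

end Cubic

lemma abs_convolution_le {a b : ℕ → ℝ} {A B x : ℝ} {n : ℕ} (hA : 0 ≤ A)
    (hx : 0 ≤ x) (ha : ∀ j ≤ n, |a j| ≤ A * x ^ j) (hb : ∀ j ≤ n, |b j| ≤ B * x ^ j) :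
    |∑ p ∈ antidiagonal n, a p.1 * b p.2| ≤ (n + 1) * (A * B) * x ^ n := by
  calc |∑ p ∈ antidiagonal n, a p.1 * b p.2| ≤ ∑ p ∈ antidiagonal n, |a p.1 * b p.2| :=
        abs_sum_le_sum_abs _ _
    _ ≤ ∑ p ∈ antidiagonal n, (A * B) * x ^ n := by
        refine sum_le_sum fun p hp => ?_
        rw [HasAntidiagonal.mem_antidiagonal] at hp
        rw [abs_mul, ← hp, pow_add]
        calc |a p.1| * |b p.2| ≤ (A * x ^ p.1) * (B * x ^ p.2) :=
              mul_le_mul (ha _ (by omega)) (hb _ (by omega)) (abs_nonneg _) (by positivity)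
          _ = _ := by ring
    _ = _ := by simp; ring

lemma abs_squareCoeff_le {a : ℕ → ℝ} {A x : ℝ} {n : ℕ} (hA : 0 ≤ A) (hx : 0 ≤ x)
    (ha : ∀ j ≤ n, |a j| ≤ A * x ^ j) : |squareCoeff a n| ≤ (n + 1) * A ^ 2 * x ^ n := by
  rw [sq]; exact abs_convolution_le hA hx ha ha

lemma abs_cubeCoeff_le {a : ℕ → ℝ} {A x : ℝ} {n : ℕ} (hA : 0 ≤ A) (hx : 0 ≤ x)
    (ha : ∀ j ≤ n, |a j| ≤ A * x ^ j) : |cubeCoeff a n| ≤ (n + 1) ^ 2 * A ^ 3 * x ^ n := by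
  rw [cubeCoeff_eq]
  refine (abs_convolution_le (B := (n + 1) * A ^ 2) hA hx ha fun j hj => ?_).trans_eq (by ring)
  refine (abs_squareCoeff_le hA hx fun i hi => ha i (by omega)).trans ?_
  have : (j : ℝ) ≤ n := by exact_mod_cast hj
  gcongr

lemma abs_sum_pow_le {a : ℕ → ℝ} {A x : ℝ} {n : ℕ} (hA : 0 ≤ A) (hx : 0 ≤ x) (hx1 : x ≤ 1)
    (ha : ∀ j < n, |a j| ≤ A * x ^ j) : |∑ j ∈ range n, a j| ≤ n * A := by
  refine (abs_sum_le_sum_abs _ _).trans ?_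
  calc ∑ j ∈ range n, |a j| ≤ ∑ j ∈ range n, A := by
        refine sum_le_sum fun j hj => (ha j (mem_range.1 hj)).trans ?_
        exact mul_le_of_le_one_right hA (pow_le_one₀ hx hx1)
    _ = _ := by simp

/-- The difference collects the products with i, j < n and i + j ≥ n. There are at most n² of them,
each at most A B x^(i+j) ≤ A B xⁿ because x ≤ 1. -/
lemma abs_mul_sub_convolution_le {a b : ℕ → ℝ} {A B x : ℝ} {n : ℕ} (hA : 0 ≤ A) (hB : 0 ≤ B)
    (hx : 0 ≤ x) (hx1 : x ≤ 1) (ha : ∀ j < n, |a j| ≤ A * x ^ j)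
    (hb : ∀ j < n, |b j| ≤ B * x ^ j) :
    |(∑ i ∈ range n, a i) * (∑ j ∈ range n, b j)
      - ∑ m ∈ range n, ∑ p ∈ antidiagonal m, a p.1 * b p.2| ≤ n ^ 2 * (A * B) * x ^ n := by
  have e1 : ∑ m ∈ range n, ∑ p ∈ antidiagonal m, a p.1 * b p.2
      = ∑ i ∈ range n, ∑ j ∈ range (n - i), a i * b j := by
    rw [← Finset.sum_range_diag_flip n fun i j => a i * b j]
    refine sum_congr rfl fun m _ => ?_
    rw [Finset.Nat.sum_antidiagonal_eq_sum_range_succ (fun i j => a i * b j)]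
  have e2 : (∑ i ∈ range n, a i) * (∑ j ∈ range n, b j)
      - ∑ m ∈ range n, ∑ p ∈ antidiagonal m, a p.1 * b p.2
      = ∑ i ∈ range n, ∑ j ∈ range n \ range (n - i), a i * b j := by
    rw [e1, sum_mul_sum, ← sum_sub_distrib]
    refine sum_congr rfl fun i _ => ?_
    rw [sum_sdiff_eq_sub (range_mono (Nat.sub_le n i))]
  rw [e2]
  calc _ ≤ ∑ i ∈ range n, ∑ j ∈ range n \ range (n - i), |a i * b j| :=
        (abs_sum_le_sum_abs _ _).trans (sum_le_sum fun i _ => abs_sum_le_sum_abs _ _)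
    _ ≤ ∑ i ∈ range n, ∑ j ∈ range n \ range (n - i), (A * B) * x ^ n := by
        refine sum_le_sum fun i hi => sum_le_sum fun j hj => ?_
        rw [Finset.mem_sdiff, mem_range, mem_range, not_lt] at hj; rw [mem_range] at hi
        rw [abs_mul]
        calc |a i| * |b j| ≤ (A * x ^ i) * (B * x ^ j) :=
              mul_le_mul (ha i hi) (hb j hj.1) (abs_nonneg _) (by positivity)
          _ = (A * B) * x ^ (i + j) := by rw [pow_add]; ring
          _ ≤ (A * B) * x ^ n := by
              have := pow_le_pow_of_le_one hx hx1 (show n ≤ i + j by omega)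
              gcongr
    _ ≤ ∑ i ∈ range n, ∑ j ∈ range n, (A * B) * x ^ n := by
        refine sum_le_sum fun i _ => sum_le_sum_of_subset_of_nonneg sdiff_subset ?_
        intros; positivity
    _ = _ := by simp; ring

/-- With S and T the truncated square and cube of the series and w its truncated sum, w³ - T = w (w²
- S) + (w S - T), and both brackets are truncation errors of a product. -/
lemma abs_cube_sub_cubeCoeff_le {a : ℕ → ℝ} {A x : ℝ} {n : ℕ} (hA : 0 ≤ A)
    (hx : 0 ≤ x) (hx1 : x ≤ 1) (ha : ∀ j < n, |a j| ≤ A * x ^ j) :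
    |(∑ i ∈ range n, a i) ^ 3 - ∑ m ∈ range n, cubeCoeff a m| ≤ 2 * n ^ 3 * A ^ 3 * x ^ n := by
  have h1 := abs_mul_sub_convolution_le hA hA hx hx1 ha ha
  have h2 := abs_mul_sub_convolution_le (b := squareCoeff a) (B := n * A ^ 2) hA (by positivity)
    hx hx1 ha fun j hj => by
      refine (abs_squareCoeff_le hA hx fun i hi => ha i (by omega)).trans ?_
      have : (j : ℝ) + 1 ≤ n := by exact_mod_cast hj
      gcongr
  have h3 := abs_sum_pow_le hA hx hx1 ha
  simp only [← cubeCoeff_eq] at h2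
  simp only [← squareCoeff.eq_1] at h1
  set w := ∑ i ∈ range n, a i
  set S := ∑ m ∈ range n, squareCoeff a m
  set T := ∑ m ∈ range n, cubeCoeff a m
  calc |w ^ 3 - T| = |w * (w * w - S) + (w * S - T)| := by congr 1; ring
    _ ≤ |w| * |w * w - S| + |w * S - T| := by rw [← abs_mul]; exact abs_add_le _ _
    _ ≤ (n * A) * (n ^ 2 * (A * A) * x ^ n) + n ^ 2 * (A * (n * A ^ 2)) * x ^ n := by
        gcongr
    _ = _ := by ring

/-! ### Growth of the coefficients and of the remainders -/

/-- The case m = 1 is resonant: forcing of size e^{2t} would produce t e^{2t}. Weaker forcing is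
dominated by the homogeneous growth e^{2t}, stronger forcing dominates it. -/
lemma growth_of_linear {z ζ g : ℝ → ℝ} {L D K : ℝ} {m : ℕ} (hm : m ≠ 1) (hK : 0 < K)
    (hz : ∀ t ∈ Set.Icc 0 L, HasDerivAt z (ζ t) t)
    (hζ : ∀ t ∈ Set.Icc 0 L, HasDerivAt ζ ((4 - 6 * sechSq t) * z t + g t) t)
    (hz0 : |z 0| ≤ D) (hζ0 : |ζ 0| ≤ 2 * D)
    (hg : ∀ t ∈ Set.Icc 0 L, |g t| ≤ K * Real.exp (2 * t) ^ m) :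
    ∀ t ∈ Set.Icc 0 L, |z t| ≤ Real.exp 3 * (D + K) * Real.exp (2 * t) ^ (max m 1) := by
  have hD : 0 ≤ D := (abs_nonneg _).trans hz0
  intro t ht
  have hexp : Real.exp (2 * t + 3 * Real.tanh t) ≤ Real.exp 3 * Real.exp (2 * t) := by
    rw [← Real.exp_add]
    apply Real.exp_le_exp.2
    have := Real.tanh_lt_one t
    linarith
  rcases Nat.eq_zero_or_pos m with rfl | hpos
  -- For bounded forcing Q stays bounded, since 2 e^{2t} Q' = 4K already exceeds K when Q' = 2K
  -- e^{-2t}.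
  · have h := (growth_of_perturbed_linear (z := z) (ζ := ζ) (z1 := ζ)
      (ζ1 := fun t => (4 - 6 * sechSq t) * z t + g t) (Q := fun t => D + K - K * Real.exp (-2 * t))
      (Q1 := fun t => 2 * K * Real.exp (-2 * t)) (G := fun _ => K) hz hζ ?_ ?_ ?_ ?_ ?_ ?_ ?_ t
      ht).1
    · refine h.trans ?_
      simp only [Nat.zero_le, sup_of_le_right, pow_one]
      have : D + K - K * Real.exp (-2 * t) ≤ D + K := by
        have := Real.exp_pos (-2 * t)
        nlinarith
      have h0 := Real.exp_pos (2 * t + 3 * Real.tanh t)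
      calc _ ≤ Real.exp (2 * t + 3 * Real.tanh t) * (D + K) := by gcongr
        _ ≤ (Real.exp 3 * Real.exp (2 * t)) * (D + K) := by gcongr
        _ = _ := by ring
    · intro t
      refine ((((hasDerivAt_id t).const_mul (-2)).exp.const_mul K).const_sub (D + K)).congr_deriv ?_
      simp only [id]; ring
    · simpa using hz0
    · simpa using hζ0
    · intro t _; rfl
    · intro t ht' _
      simpa using hg t (Set.Ico_subset_Icc_self ht')
    · intro t _
      have : Real.exp (2 * t) * Real.exp (-2 * t) = 1 := by rw [← Real.exp_add]; simp
      nlinarith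
    · intro t _
      positivity
  -- Here Q grows like e^{2(m-1)t}, and 2 e^{2t} Q' is 4(m - 1) times the bound on the forcing.
  · obtain ⟨k, rfl⟩ : ∃ k, m = k + 2 := ⟨m - 2, by omega⟩
    have h := (growth_of_perturbed_linear (z := z) (ζ := ζ) (z1 := ζ)
      (ζ1 := fun t => (4 - 6 * sechSq t) * z t + g t)
      (Q := fun t => D + K * Real.exp (2 * t) ^ (k + 1))
      (Q1 := fun t => 2 * (k + 1) * K * Real.exp (2 * t) ^ (k + 1))
      (G := fun t => K * Real.exp (2 * t) ^ (k + 2)) hz hζ ?_ ?_ ?_ ?_ ?_ ?_ ?_ t ht).1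
    · refine h.trans ?_
      rw [max_eq_left (by omega)]
      have h1 : 1 ≤ Real.exp (2 * t) ^ (k + 1) :=
        one_le_pow₀ (Real.one_le_exp (by linarith [ht.1]))
      have h0 := Real.exp_pos (2 * t)
      calc _ ≤ (Real.exp 3 * Real.exp (2 * t)) * (D * Real.exp (2 * t) ^ (k + 1)
            + K * Real.exp (2 * t) ^ (k + 1)) := by
            gcongr
            nlinarith
        _ = _ := by ring
    · intro t
      refine ((((hasDerivAt_id t).const_mul 2).exp.pow (k + 1)).const_mul K
        |>.const_add D).congr_deriv ?_
      simp only [id, Nat.add_sub_cancel]; push_cast; ring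
    · simp only [mul_zero, Real.exp_zero, one_pow, mul_one]; linarith
    · simp only [mul_zero, Real.exp_zero, one_pow, mul_one]; linarith
    · intro t _; rfl
    · intro t ht' _
      simpa using hg t (Set.Ico_subset_Icc_self ht')
    · intro t _
      have h0 := Real.exp_pos (2 * t)
      have : 0 < K * Real.exp (2 * t) ^ (k + 2) := by positivity
      have hk : (0 : ℝ) ≤ k := k.cast_nonneg
      calc K * Real.exp (2 * t) ^ (k + 2) < (4 * (k + 1)) * (K * Real.exp (2 * t) ^ (k + 2)) := by
            nlinarith
        _ = _ := by ring
    · intro t _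
      positivity

namespace IsSeparatrixSeries

variable {ω Φ s : ℝ} {U : ℕ → ℝ → ℝ}

lemma hasDerivAt (h : IsSeparatrixSeries ω Φ s U) (n : ℕ) (t : ℝ) :
    HasDerivAt (U n) (deriv (U n) t) t :=
  (((h.contDiff n).differentiable (by norm_num)) t).hasDerivAt

lemma hasDerivAt_deriv (h : IsSeparatrixSeries ω Φ s U) (n : ℕ) (t : ℝ) :
    HasDerivAt (deriv (U n)) (deriv (deriv (U n)) t) t := by
  have h2 := h.contDiff n
  rw [show (2 : WithTop ℕ∞) = 1 + 1 by norm_num, contDiff_succ_iff_deriv] at h2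
  exact ((h2.2.2.differentiable (by norm_num)) t).hasDerivAt

lemma deriv_deriv (h : IsSeparatrixSeries ω Φ s U) (n : ℕ) (t : ℝ) :
    deriv (deriv (U n)) t = -2 * U n t + 2 * cubeCoeff (fun j => U j t) n
      + if n = 1 then Real.cos (ω * t + Φ) else 0 := by
  have := h.equation n t
  rw [cubeCoeff]
  linarith

lemma deriv_deriv_linear (h : IsSeparatrixSeries ω Φ s U) (hs : s ^ 2 = 1) {n : ℕ} (hn : n ≠ 0)
    (t : ℝ) : deriv (deriv (U n)) t = (4 - 6 * sechSq t) * U n t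
      + (2 * cubeRest (fun j => U j t) n + if n = 1 then Real.cos (ω * t + Φ) else 0) := by
  rw [h.deriv_deriv, cubeCoeff_split _ hn, h.leading, mul_pow, hs, tanh_sq_eq]; ring

/-- Time reversal combined with the symmetry `u ↦ -u`. -/
lemma reflect (h : IsSeparatrixSeries ω Φ s U) :
    IsSeparatrixSeries ω (Real.pi - Φ) s (fun n t => -U n (-t)) := by
  have hd : ∀ n t, HasDerivAt (fun t => -U n (-t)) (deriv (U n) (-t)) t := by
    intro n t
    refine ((h.hasDerivAt n (-t)).scomp t (hasDerivAt_neg t)).neg.congr_deriv (by simp)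
  have hdd : ∀ n t, HasDerivAt (fun t => deriv (U n) (-t)) (-deriv (deriv (U n)) (-t)) t := by
    intro n t
    refine ((h.hasDerivAt_deriv n (-t)).scomp t (hasDerivAt_neg t)).congr_deriv (by simp)
  refine ⟨fun t => ?_, fun n => ((h.contDiff n).comp contDiff_neg).neg, fun n t => ?_⟩
  · rw [h.leading, Real.tanh_neg]; ring
  · rw [deriv_deriv_of_hasDerivAt (hd n) (hdd n)]
    have e := h.deriv_deriv n (-t)
    have e2 := cubeCoeff_neg (fun j => U j (-t)) n
    rw [cubeCoeff] at e2
    rw [e2, e]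
    split_ifs
    -- Reversing time reverses ωt relative to the phase, and the change of sign of the solution is
    -- absorbed by a shift of the phase by π.
    · rw [show ω * t + (Real.pi - Φ) = Real.pi - (ω * -t + Φ) by ring, Real.cos_pi_sub]; ring
    · ring

lemma deriv_reflect (h : IsSeparatrixSeries ω Φ s U) (n : ℕ) (t : ℝ) :
    deriv (fun t => -U n (-t)) t = deriv (U n) (-t) :=
  ((h.hasDerivAt n (-t)).scomp t (hasDerivAt_neg t)).neg.congr_deriv (by simp) |>.deriv

end IsSeparatrixSeries

/-- A bound on the coefficients of a separatrix series for `t ≥ 0`, by induction. -/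
lemma exists_coeff_bound_of_nonneg (D : ℝ) (n : ℕ) : ∃ C, 1 ≤ C ∧ ∀ (ω Φ s : ℝ) (U : ℕ → ℝ → ℝ),
    IsSeparatrixSeries ω Φ s U → s ^ 2 = 1 →
    (∀ j, 1 ≤ j → j ≤ n → |U j 0| ≤ D ∧ |deriv (U j) 0| ≤ 2 * D) →
    ∀ t, 0 ≤ t → ∀ j ≤ n, |U j t| ≤ C * Real.exp (2 * t) ^ j := by
  induction n with
  | zero =>
    refine ⟨1, le_rfl, fun ω Φ s U h hs _ t _ j hj => ?_⟩
    obtain rfl : j = 0 := by omega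
    have h1 : |s| = 1 := by rw [← sq_eq_sq₀ (abs_nonneg s) zero_le_one, sq_abs, hs, one_pow]
    rw [h.leading, abs_mul, h1]
    simpa using abs_tanh_le_one t
  | succ n ih =>
    obtain ⟨C, hC1, hC⟩ := ih
    set K : ℝ := 2 * ((n + 2) ^ 2 * C ^ 3) + 1 with hK
    have hKpos : 0 < K := by positivity
    refine ⟨max C (Real.exp 3 * (D + K)), le_max_of_le_left hC1,
      fun ω Φ s U h hs h0 t ht j hj => ?_⟩
    have hprev := hC ω Φ s U h hs fun j h1 h2 => h0 j h1 (by omega)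
    have hpos := Real.exp_pos (2 * t)
    rcases Nat.lt_or_ge n j with hlt | hle
    swap
    · refine (hprev t ht j hle).trans ?_
      gcongr
      exact le_max_left _ _
    obtain rfl : j = n + 1 := by omega
    -- The first correction is forced by a bounded cosine alone, so m = 0 there; from the second one
    -- on the forcing has size e^{2(n+1)t}. The resonant value 1 never occurs.
    set m := if n = 0 then 0 else n + 1 with hm
    have hmax : max m 1 = n + 1 := by rw [hm]; split_ifs <;> omega
    have hm1 : m ≠ 1 := by rw [hm]; split_ifs <;> omega
    have key := growth_of_linear (z := U (n + 1)) (ζ := deriv (U (n + 1))) (L := t) (D := D)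
      (K := K) (m := m) (g := fun t => 2 * cubeRest (fun j => U j t) (n + 1)
        + if n + 1 = 1 then Real.cos (ω * t + Φ) else 0) hm1 hKpos
      (fun r _ => h.hasDerivAt _ r) (fun r _ => by
        have := h.hasDerivAt_deriv (n + 1) r
        rwa [h.deriv_deriv_linear hs (by omega)] at this) (h0 _ (by omega) le_rfl).1
      (h0 _ (by omega) le_rfl).2 ?_ t ⟨ht, le_rfl⟩
    · rw [hmax] at key
      refine key.trans ?_
      gcongr
      exact le_max_right _ _
    · intro r hr
      rcases Nat.eq_zero_or_pos n with rfl | hn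
      · have h1 : (1 : ℝ) ≤ K := by rw [hK]; nlinarith [pow_pos (zero_lt_one.trans_le hC1) 3]
        simp only [hm, cubeRest_one, zero_add, if_true, pow_zero, mul_one, mul_zero]
        exact (Real.abs_cos_le_one _).trans h1
      · have hn' : n ≠ 0 := by omega
        have hb : |cubeRest (fun j => U j r) (n + 1)|
            ≤ ((n + 1 : ℕ) + 1) ^ 2 * C ^ 3 * Real.exp (2 * r) ^ (n + 1) := by
          refine abs_cubeCoeff_le (zero_le_one.trans hC1) (Real.exp_pos _).le fun j hj => ?_
          rcases eq_or_ne j (n + 1) with rfl | hne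
          · have := Real.exp_pos (2 * r)
            simp only [Function.update_self, abs_zero]; positivity
          · rw [Function.update_of_ne hne]
            exact hprev r hr.1 j (by omega)
        have : n + 1 ≠ 1 := by omega
        simp only [hm, this, hn', if_false, add_zero, abs_mul, abs_two]
        push_cast at hb
        have hp : 0 < Real.exp (2 * r) ^ (n + 1) := pow_pos (Real.exp_pos _) _
        rw [hK]
        have : (n : ℝ) + 1 + 1 = n + 2 := by ring
        rw [this] at hb
        nlinarith

/-- The coefficients of separatrix series with bounded initial data are bounded by `C e^{2n|t|}`. -/
lemma exists_coeff_bound (D : ℝ) (n : ℕ) : ∃ C, 1 ≤ C ∧ ∀ (ω Φ s : ℝ) (U : ℕ → ℝ → ℝ),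
    IsSeparatrixSeries ω Φ s U → s ^ 2 = 1 →
    (∀ j, 1 ≤ j → j ≤ n → |U j 0| ≤ D ∧ |deriv (U j) 0| ≤ 2 * D) →
    ∀ t, ∀ j ≤ n, |U j t| ≤ C * Real.exp (2 * |t|) ^ j := by
  obtain ⟨C, hC1, hC⟩ := exists_coeff_bound_of_nonneg D n
  refine ⟨C, hC1, fun ω Φ s U h hs h0 t j hj => ?_⟩
  rcases le_total 0 t with ht | ht
  · rw [abs_of_nonneg ht]; exact hC ω Φ s U h hs h0 t ht j hj
  · rw [abs_of_nonpos ht]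
    have := hC ω _ s _ h.reflect hs (fun j h1 h2 => by
      rw [h.deriv_reflect]; simpa using h0 j h1 h2) (-t) (by linarith) j hj
    simpa using this

lemma abs_sub_first_le {a : ℕ → ℝ} {A x : ℝ} {n : ℕ} (hA : 0 ≤ A) (hx : 0 ≤ x) (hx1 : x ≤ 1)
    (ha : ∀ j < n + 1, |a j| ≤ A * x ^ j) : |∑ j ∈ range (n + 1), a j - a 0| ≤ n * A * x := by
  rw [sum_range_succ', add_sub_cancel_right]
  refine (abs_sum_pow_le (A := A * x) (x := x) (by positivity) hx hx1 fun j hj => ?_).trans_eq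
    (by ring)
  refine (ha (j + 1) (by omega)).trans_eq (by ring)

/-- The remainders of a separatrix series, for `t ≥ 0`, by induction on the order. -/
lemma exists_remainder_bound_of_nonneg (D C₀ : ℝ) (n : ℕ) : ∃ C, 0 ≤ C ∧
    ∀ (ω Φ s : ℝ) (U : ℕ → ℝ → ℝ) (ε L : ℝ) (u v : ℝ → ℝ),
    IsSeparatrixSeries ω Φ s U → s ^ 2 = 1 → 0 < ε →
    (∀ j, 1 ≤ j → j ≤ n → |U j 0| ≤ D ∧ |deriv (U j) 0| ≤ 2 * D) →
    (∀ m, 1 ≤ m → m ≤ n → |u 0 - ∑ j ∈ range (m + 1), ε ^ j * U j 0| ≤ D * ε ^ (m + 1) ∧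
      |v 0 - ∑ j ∈ range (m + 1), ε ^ j * deriv (U j) 0| ≤ 2 * (D * ε ^ (m + 1))) →
    (∀ t ∈ Set.Icc 0 L, HasDerivAt u (v t) t ∧
      HasDerivAt v (2 * u t ^ 3 - 2 * u t + ε * Real.cos (ω * t + Φ)) t) →
    ε * Real.exp (2 * L) ≤ 1 →
    (∀ t ∈ Set.Icc 0 L, |u t - s * Real.tanh t| ≤ C₀ * (ε * Real.exp (2 * t))) →
    ∀ t ∈ Set.Icc 0 L, |u t - ∑ j ∈ range (n + 1), ε ^ j * U j t|
      ≤ C * (ε * Real.exp (2 * t)) ^ (n + 1) := by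
  induction n with
  | zero =>
    refine ⟨max C₀ 0, le_max_right _ _,
      fun ω Φ s U ε L u v h hs hε _ _ _ _ h0 t ht => (?_ : _ ≤ _)⟩
    have := h0 t ht
    have hp : 0 < ε * Real.exp (2 * t) := by positivity
    simp only [zero_add, sum_range_one, pow_zero, one_mul, pow_one, h.leading]
    refine this.trans ?_
    gcongr
    exact le_max_left _ _
  | succ n ih =>
    obtain ⟨C, hC0, hC⟩ := ih
    obtain ⟨Cu, hCu1, hCu⟩ := exists_coeff_bound_of_nonneg D (n + 1)
    have hCu0 : 0 ≤ Cu := by linarith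
    set E := C + Cu with hE
    set W := ((n : ℝ) + 2) * Cu with hW
    set K₀ := 2 * (2 * ((n + 2 : ℕ) : ℝ) ^ 3 * Cu ^ 3 + 3 * (W * (W + Cu)) * E + 3 * W * E ^ 2
      + E ^ 3) with hK₀
    have hE0 : 0 < E := by positivity
    have hW0 : 0 < W := by positivity
    have hK₀0 : 0 < K₀ := by positivity
    refine ⟨Real.exp 3 * (max D 0 + K₀), by positivity,
      fun ω Φ s U ε L u v h hs hε hD hinit hode hL h0 => ?_⟩
    have hprev := hC ω Φ s U ε L u v h hs hε (fun j h1 h2 => hD j h1 (by omega))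
      (fun m h1 h2 => hinit m h1 (by omega)) hode hL h0
    intro t ht
    -- The remainder itself satisfies the linearized equation. Its inhomogeneity is of order (ε
    -- e^{2t})^(n+2), by the bound on the remainder of the previous order.
    have key := growth_of_linear (m := n + 2)
      (z := fun t => u t - ∑ j ∈ range (n + 1 + 1), ε ^ j * U j t)
      (ζ := fun t => v t - ∑ j ∈ range (n + 1 + 1), ε ^ j * deriv (U j) t)
      (g := fun t => 2 * (u t ^ 3 - ∑ j ∈ range (n + 2), ε ^ j * cubeCoeff (fun j => U j t) j
        - 3 * U 0 t ^ 2 * (u t - ∑ j ∈ range (n + 1 + 1), ε ^ j * U j t)))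
      (L := L) (D := D * ε ^ (n + 2)) (K := K₀ * ε ^ (n + 2)) (by omega) (by positivity)
      (fun r hr => ?_) (fun r hr => ?_) (hinit (n + 1) (by omega) le_rfl).1
      (hinit (n + 1) (by omega) le_rfl).2 (fun r hr => ?_) t ht
    · refine key.trans ?_
      rw [max_eq_left (by omega), mul_pow]
      have := Real.exp_pos (2 * t)
      calc _ ≤ Real.exp 3 * (max D 0 * ε ^ (n + 2) + K₀ * ε ^ (n + 2))
            * Real.exp (2 * t) ^ (n + 2) := by
            gcongr
            exact le_max_left _ _
        _ = _ := by ring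
    · refine (hode r hr).1.sub (HasDerivAt.fun_sum fun j _ => ?_)
      exact (h.hasDerivAt j r).const_mul _
    · refine ((hode r hr).2.sub (HasDerivAt.fun_sum (A' := fun j => ε ^ j * deriv (deriv (U j)) r)
        fun j _ => ?_)).congr_deriv ?_
      · exact (h.hasDerivAt_deriv j r).const_mul _
      · have e : ∑ j ∈ range (n + 2), ε ^ j * deriv (deriv (U j)) r
            = -2 * ∑ j ∈ range (n + 2), ε ^ j * U j r
              + 2 * ∑ j ∈ range (n + 2), ε ^ j * cubeCoeff (fun j => U j r) j
              + ε * Real.cos (ω * r + Φ) := by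
          have e1 : ε * Real.cos (ω * r + Φ) = ∑ j ∈ range (n + 2),
              ε ^ j * (if j = 1 then Real.cos (ω * r + Φ) else 0) := by
            rw [sum_eq_single 1]
            · simp
            · intro b _ hb; simp [hb]
            · intro hb; simp at hb
          rw [e1, mul_sum, mul_sum, ← sum_add_distrib, ← sum_add_distrib]
          refine sum_congr rfl fun j _ => ?_
          rw [h.deriv_deriv]; ring
        have e0 : U 0 r ^ 2 = 1 - sechSq r := by rw [h.leading, mul_pow, hs, tanh_sq_eq, one_mul]
        simp only [e, e0]; ring
    · set x := ε * Real.exp (2 * r) with hx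
      have hx0 : 0 < x := by positivity
      have hx1 : x ≤ 1 := by
        refine le_trans ?_ hL
        rw [hx]
        gcongr
        exact hr.2
      set a : ℕ → ℝ := fun j => ε ^ j * U j r with ha
      have hab : ∀ j < n + 1 + 1, |a j| ≤ Cu * x ^ j := by
        intro j hj
        rw [ha, abs_mul, abs_of_pos (pow_pos hε j), hx, mul_pow]
        have := hCu ω Φ s U h hs hD r hr.1 j (by omega)
        calc ε ^ j * |U j r| ≤ ε ^ j * (Cu * Real.exp (2 * r) ^ j) := by gcongr
          _ = _ := by ring
      have hcub : ∀ m, ε ^ m * cubeCoeff (fun j => U j r) m = cubeCoeff a m :=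
        fun m => (cubeCoeff_pow_mul ε (fun j => U j r) m).symm
      set w := ∑ j ∈ range (n + 1 + 1), a j with hw
      set z := u r - w with hz
      -- The remainder after one more term is bounded by the previous remainder plus that term. This
      -- is one power of x too weak; the power is regained below, because z is always multiplied by
      -- w - U₀ = O(x) or by z.
      have hz' : |z| ≤ E * x ^ (n + 1) := by
        have h1 := hprev r hr
        have h2 := hab (n + 1) (by omega)
        rw [hz, hw, sum_range_succ, ← sub_sub]
        refine (abs_sub _ _).trans ?_
        rw [hE, add_mul]
        exact add_le_add h1 h2
      have hw1 : |w| ≤ W := by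
        have := abs_sum_pow_le hCu0 hx0.le hx1 hab
        rw [hW]; push_cast at this; convert this using 2; ring
      have hw2 : |w - U 0 r| ≤ W * x := by
        have := abs_sub_first_le hCu0 hx0.le hx1 hab
        simp only [ha, pow_zero, one_mul] at this
        refine this.trans ?_
        rw [hW]; push_cast
        gcongr
        linarith
      have hU0 : |U 0 r| ≤ Cu := by
        have := hab 0 (by omega)
        simpa [ha] using this
      have hcube := abs_cube_sub_cubeCoeff_le hCu0 hx0.le hx1 hab
      have hxn : x ^ (n + 1) ≤ 1 := pow_le_one₀ hx0.le hx1
      have hz1 : |z| ≤ E := hz'.trans (mul_le_of_le_one_right hE0.le hxn)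
      have hzx : x ^ (n + 1) * x ^ (n + 1) ≤ x ^ (n + 2) := by
        rw [← pow_add]
        exact pow_le_pow_of_le_one hx0.le hx1 (by omega)
      have hz2 : |z| * |z| ≤ E ^ 2 * x ^ (n + 2) := by
        calc |z| * |z| ≤ (E * x ^ (n + 1)) * (E * x ^ (n + 1)) := by gcongr
          _ = E ^ 2 * (x ^ (n + 1) * x ^ (n + 1)) := by ring
          _ ≤ _ := by gcongr
      -- The inhomogeneity splits into the truncation error of the cube, the error of replacing w²
      -- by U₀² in the linear term, and the terms of second and third degree in z.
      have e : u r ^ 3 - ∑ j ∈ range (n + 2), ε ^ j * cubeCoeff (fun j => U j r) j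
          - 3 * U 0 r ^ 2 * (u r - ∑ j ∈ range (n + 1 + 1), ε ^ j * U j r)
          = (w ^ 3 - ∑ m ∈ range (n + 2), cubeCoeff a m)
            + 3 * ((w - U 0 r) * (w + U 0 r)) * z + 3 * w * (z * z) + z * (z * z) := by
        simp only [hcub]
        have : u r = w + z := by rw [hz]; ring
        rw [← hw, this]; ring
      rw [abs_mul, abs_two, e]
      have b1 : |3 * ((w - U 0 r) * (w + U 0 r)) * z| ≤ 3 * (W * (W + Cu)) * E * x ^ (n + 2) := by
        rw [abs_mul, abs_mul, abs_mul, abs_of_pos (by norm_num : (0 : ℝ) < 3)]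
        have : |w + U 0 r| ≤ W + Cu := (abs_add_le _ _).trans (add_le_add hw1 hU0)
        calc _ ≤ 3 * ((W * x) * (W + Cu)) * (E * x ^ (n + 1)) := by gcongr
          _ = _ := by ring
      have b2 : |3 * w * (z * z)| ≤ 3 * W * (E ^ 2 * x ^ (n + 2)) := by
        rw [abs_mul, abs_mul, abs_mul, abs_of_pos (by norm_num : (0 : ℝ) < 3)]
        gcongr
      have b3 : |z * (z * z)| ≤ E * (E ^ 2 * x ^ (n + 2)) := by
        rw [abs_mul, abs_mul]
        gcongr
      have b4 : |(w ^ 3 - ∑ m ∈ range (n + 2), cubeCoeff a m)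
            + 3 * ((w - U 0 r) * (w + U 0 r)) * z + 3 * w * (z * z) + z * (z * z)|
          ≤ 2 * ((n + 2 : ℕ) : ℝ) ^ 3 * Cu ^ 3 * x ^ (n + 2)
            + 3 * (W * (W + Cu)) * E * x ^ (n + 2) + 3 * W * (E ^ 2 * x ^ (n + 2))
            + E * (E ^ 2 * x ^ (n + 2)) := by
        refine (abs_add_le _ _).trans (add_le_add ((abs_add_le _ _).trans
          (add_le_add ((abs_add_le _ _).trans (add_le_add ?_ b1)) b2)) b3)
        exact hcube
      refine (mul_le_mul_of_nonneg_left b4 zero_le_two).trans_eq ?_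
      rw [hK₀, hx, mul_pow]
      ring

/-- The remainders of a separatrix series near an exact solution. -/
lemma exists_remainder_bound (D C₀ : ℝ) (n : ℕ) : ∃ C, 0 ≤ C ∧
    ∀ (ω Φ s : ℝ) (U : ℕ → ℝ → ℝ) (ε L : ℝ) (u v : ℝ → ℝ),
    IsSeparatrixSeries ω Φ s U → s ^ 2 = 1 → 0 < ε →
    (∀ j, 1 ≤ j → j ≤ n → |U j 0| ≤ D ∧ |deriv (U j) 0| ≤ 2 * D) →
    (∀ m, 1 ≤ m → m ≤ n → |u 0 - ∑ j ∈ range (m + 1), ε ^ j * U j 0| ≤ D * ε ^ (m + 1) ∧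
      |v 0 - ∑ j ∈ range (m + 1), ε ^ j * deriv (U j) 0| ≤ 2 * (D * ε ^ (m + 1))) →
    (∀ t, |t| ≤ L → HasDerivAt u (v t) t ∧
      HasDerivAt v (2 * u t ^ 3 - 2 * u t + ε * Real.cos (ω * t + Φ)) t) →
    ε * Real.exp (2 * L) ≤ 1 →
    (∀ t, |t| ≤ L → |u t - s * Real.tanh t| ≤ C₀ * (ε * Real.exp (2 * |t|))) →
    ∀ t, |t| ≤ L → |u t - ∑ j ∈ range (n + 1), ε ^ j * U j t|
      ≤ C * (ε * Real.exp (2 * |t|)) ^ (n + 1) := by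
  obtain ⟨C, hC0, hC⟩ := exists_remainder_bound_of_nonneg D C₀ n
  refine ⟨C, hC0, fun ω Φ s U ε L u v h hs hε hD hinit hode hL h0 t ht => ?_⟩
  rcases le_total 0 t with h1 | h1
  · rw [abs_of_nonneg h1] at ht ⊢
    exact hC ω Φ s U ε L u v h hs hε hD hinit
      (fun r hr => hode r (by rw [abs_of_nonneg hr.1]; exact hr.2)) hL
      (fun r hr => by
        have := h0 r (by rw [abs_of_nonneg hr.1]; exact hr.2)
        rwa [abs_of_nonneg hr.1] at this) t ⟨h1, ht⟩
  · rw [abs_of_nonpos h1] at ht ⊢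
    have key := hC ω (Real.pi - Φ) s _ ε L (fun t => -u (-t)) (fun t => v (-t)) h.reflect hs hε
      (fun j h2 h3 => by rw [h.deriv_reflect]; simpa using hD j h2 h3)
      (fun m h2 h3 => by
        simp only [h.deriv_reflect, neg_zero, mul_neg, sum_neg_distrib]
        obtain ⟨h4, h5⟩ := hinit m h2 h3
        refine ⟨?_, h5⟩
        rw [← abs_neg]; convert h4 using 2; ring)
      (fun r hr => by
        obtain ⟨h4, h5⟩ := hode (-r) (by rw [abs_neg, abs_of_nonneg hr.1]; exact hr.2)
        refine ⟨(h4.scomp r (hasDerivAt_neg r)).neg.congr_deriv (by simp),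
          (h5.scomp r (hasDerivAt_neg r)).congr_deriv ?_⟩
        rw [show ω * r + (Real.pi - Φ) = Real.pi - (ω * -r + Φ) by ring, Real.cos_pi_sub]
        simp only [smul_eq_mul]; ring) hL
      (fun r hr => by
        have := h0 (-r) (by rw [abs_neg, abs_of_nonneg hr.1]; exact hr.2)
        rw [abs_neg, abs_of_nonneg hr.1, Real.tanh_neg] at this
        rw [← abs_neg]; convert this using 2; ring) (-t) ⟨by linarith, ht⟩
    simp only [neg_neg, mul_neg, sum_neg_distrib] at key
    rw [← abs_neg, mul_neg]; convert key using 2; ring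

/-! ### The clipped equation -/

/-- Truncation to `[-3, 3]`. -/
noncomputable def clip (x : ℝ) : ℝ := max (-3) (min x 3)

lemma clip_of_abs_le {x : ℝ} (hx : |x| ≤ 3) : clip x = x := by
  rw [abs_le] at hx
  rw [clip, min_eq_left hx.2, max_eq_right hx.1]

lemma abs_clip_le (x : ℝ) : |clip x| ≤ 3 := by
  rw [abs_le, clip]
  exact ⟨le_max_left _ _, max_le (by norm_num) (min_le_right _ _)⟩

lemma abs_clip_sub_le (x y : ℝ) : |clip x - clip y| ≤ |x - y| :=
  (abs_max_sub_max_le_max _ _ _ _).trans <| by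
    rw [sub_self, abs_zero, max_eq_right (abs_nonneg _)]
    refine (abs_min_sub_min_le_max _ _ _ _).trans ?_
    rw [sub_self, abs_zero, max_eq_left (abs_nonneg _)]

lemma clip_neg (x : ℝ) : clip (-x) = -clip x := by
  rw [clip, clip, ← min_neg_neg, ← max_neg_neg, neg_neg, max_min_distrib_left]
  norm_num
  rw [min_comm, max_comm]

/-- A solution, as a first order system, of `u'' + 2u - 2u³ = ε f` with all terms truncated. -/
structure IsClippedSol (ε : ℝ) (f u v : ℝ → ℝ) : Prop where
  deriv_left : ∀ t, HasDerivAt u (clip (v t)) t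
  deriv_right : ∀ t, HasDerivAt v (2 * clip (u t) ^ 3 - 2 * clip (u t) + ε * f t) t

namespace IsClippedSol

variable {ε : ℝ} {f u v : ℝ → ℝ}

lemma neg (h : IsClippedSol ε f u v) :
    IsClippedSol ε (fun t => -f t) (fun t => -u t) (fun t => -v t) := by
  refine ⟨fun t => ?_, fun t => ?_⟩
  · rw [clip_neg]; exact (h.deriv_left t).neg
  · rw [clip_neg]; exact (h.deriv_right t).neg.congr_deriv (by ring)

lemma sign_mul (h : IsClippedSol ε f u v) {s : ℝ} (hs : s = 1 ∨ s = -1) :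
    IsClippedSol ε (fun t => s * f t) (fun t => s * u t) (fun t => s * v t) := by
  rcases hs with rfl | rfl
  · simpa using h
  · simpa using h.neg

lemma reflect (h : IsClippedSol ε f u v) :
    IsClippedSol ε (fun t => -f (-t)) (fun t => -u (-t)) (fun t => v (-t)) := by
  refine ⟨fun t => ?_, fun t => ?_⟩
  · exact ((h.deriv_left (-t)).scomp t (hasDerivAt_neg t)).neg.congr_deriv (by simp)
  · rw [clip_neg]
    refine ((h.deriv_right (-t)).scomp t (hasDerivAt_neg t)).congr_deriv ?_
    simp only [smul_eq_mul]; ring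

lemma comp_add (h : IsClippedSol ε f u v) (T : ℝ) :
    IsClippedSol ε (fun t => f (t + T)) (fun t => u (t + T)) (fun t => v (t + T)) :=
  ⟨fun t => (h.deriv_left (t + T)).comp_add_const t T,
    fun t => (h.deriv_right (t + T)).comp_add_const t T⟩

lemma continuous_left (h : IsClippedSol ε f u v) : Continuous u :=
  continuous_iff_continuousAt.2 fun t => (h.deriv_left t).continuousAt

lemma continuous_right (h : IsClippedSol ε f u v) : Continuous v :=
  continuous_iff_continuousAt.2 fun t => (h.deriv_right t).continuousAt

end IsClippedSol

/-- A Taylor estimate valid for every z. Truncation acts only if |T + z| > 3, and then |z| ≥ 2, so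
that the error it causes, at most 2|z|, is at most z². -/
lemma abs_clipped_force_sub_le {T z : ℝ} (hT : |T| ≤ 1) :
    |2 * clip (T + z) ^ 3 - 2 * clip (T + z) - (2 * T ^ 3 - 2 * T) - (6 * T ^ 2 - 2) * z|
      ≤ 18 * z ^ 2 := by
  set d := clip (T + z) - T with hd
  have hTc : clip T = T := clip_of_abs_le (by linarith)
  have h1 : |d| ≤ |z| := by
    have := abs_clip_sub_le (T + z) T
    rwa [hTc, add_sub_cancel_left] at this
  have h2 : |d| ≤ 4 := (abs_sub _ _).trans (by linarith [abs_clip_le (T + z)])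
  have h3 : |d - z| ≤ z ^ 2 := by
    rcases le_or_gt |T + z| 3 with h | h
    · rw [hd, clip_of_abs_le h]; simp; positivity
    · have h4 : 2 ≤ |z| := by
        have := abs_add_le T z
        linarith
      have h5 : |d - z| ≤ |d| + |z| := abs_sub _ _
      have h6 : |z| ^ 2 = z ^ 2 := sq_abs z
      nlinarith
  have hT2 : T ^ 2 ≤ 1 := by rw [← sq_abs]; nlinarith [abs_nonneg T]
  have h4 : |6 * T ^ 2 - 2| ≤ 4 := by rw [abs_le]; constructor <;> nlinarith [sq_nonneg T]
  have hd2 : d ^ 2 ≤ z ^ 2 := sq_le_sq.2 h1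
  have e : 2 * clip (T + z) ^ 3 - 2 * clip (T + z) - (2 * T ^ 3 - 2 * T) - (6 * T ^ 2 - 2) * z
      = (6 * T ^ 2 - 2) * (d - z) + (6 * T + 2 * d) * d ^ 2 := by
    have : clip (T + z) = T + d := by rw [hd]; ring
    rw [this]; ring
  rw [e]
  have h5 : |6 * T + 2 * d| ≤ 14 := by
    refine (abs_add_le _ _).trans ?_
    rw [abs_mul, abs_mul, abs_of_pos (by norm_num : (0 : ℝ) < 6), abs_two]
    linarith
  calc _ ≤ |6 * T ^ 2 - 2| * |d - z| + |6 * T + 2 * d| * d ^ 2 := by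
        refine (abs_add_le _ _).trans ?_
        rw [abs_mul, abs_mul, abs_of_nonneg (sq_nonneg d)]
    _ ≤ 4 * z ^ 2 + 14 * z ^ 2 := by gcongr
    _ = _ := by ring

/-- Solutions that start `O(ε)`-close to the separatrix stay close while `ε e^{2|t|}` is small. -/
lemma exists_near_separatrix (A : ℝ) (hA : 0 ≤ A) : ∃ C > 0, ∃ δ > 0, C * δ ≤ 1 ∧ δ ≤ 1 ∧
    ∀ (ε : ℝ) (f u v : ℝ → ℝ), 0 < ε → (∀ t, |f t| ≤ 1) → IsClippedSol ε f u v →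
    |u 0| ≤ A * ε → |v 0 - 1| ≤ A * ε → ∀ t, ε * Real.exp (2 * |t|) ≤ δ →
    |u t - Real.tanh t| ≤ C * (ε * Real.exp (2 * |t|)) ∧
    |v t - sechSq t| ≤ C * (ε * Real.exp (2 * |t|)) := by
  -- D is chosen so that 4D exceeds the factor 18 of the quadratic error times (e³(A+2))²; C carries
  -- a factor 2 because the velocity is fenced by 2B.
  set D := 5 * Real.exp 3 ^ 2 * (A + 2) ^ 2 with hD
  set C := 2 * Real.exp 3 * (A + 2) with hC
  have hD0 : 0 < D := by positivity
  have hC0 : 0 < C := by positivity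
  have main : ∀ (ε : ℝ) (f u v : ℝ → ℝ), 0 < ε → (∀ t, |f t| ≤ 1) → IsClippedSol ε f u v →
      |u 0| ≤ A * ε → |v 0 - 1| ≤ A * ε → ∀ t, 0 ≤ t → D * (ε * Real.exp (2 * t)) ≤ 1 →
      |u t - Real.tanh t| ≤ C * (ε * Real.exp (2 * t)) ∧
      |v t - sechSq t| ≤ C * (ε * Real.exp (2 * t)) := by
    intro ε f u v hε hf h hu0 hv0 L hL0 hL
    have hX : ∀ t ∈ Set.Icc 0 L, D * (ε * Real.exp (2 * t)) ≤ 1 := fun t ht => by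
      refine le_trans ?_ hL
      gcongr
      exact ht.2
    have hexp : ∀ t, Real.exp (2 * t + 3 * Real.tanh t) ≤ Real.exp 3 * Real.exp (2 * t) := by
      intro t
      rw [← Real.exp_add]
      apply Real.exp_le_exp.2
      have := Real.tanh_lt_one t
      linarith
    -- The term -e^{-2t} pays for the forcing ε, the last one for the quadratic error. As D ε e^{2t}
    -- ≤ 1 on the interval, Q ≤ ε(A + 2), which closes the bootstrap.
    set Q : ℝ → ℝ := fun t => ε * (A + 1 - Real.exp (-2 * t) + D * (ε * Real.exp (2 * t))) with hQ
    have hQle : ∀ t ∈ Set.Icc 0 L, Q t ≤ ε * (A + 2) := fun t ht => by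
      have := hX t ht
      have := Real.exp_pos (-2 * t)
      exact mul_le_mul_of_nonneg_left (by linarith) hε.le
    have hB : ∀ t ∈ Set.Icc 0 L, Real.exp (2 * t + 3 * Real.tanh t) * Q t
        ≤ Real.exp 3 * (A + 2) * (ε * Real.exp (2 * t)) := fun t ht => by
      have h1 := hQle t ht
      have h2 := hexp t
      have := Real.exp_pos (2 * t)
      calc _ ≤ Real.exp (2 * t + 3 * Real.tanh t) * (ε * (A + 2)) := by gcongr
        _ ≤ (Real.exp 3 * Real.exp (2 * t)) * (ε * (A + 2)) := by gcongr
        _ = _ := by ring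
    have key := growth_of_perturbed_linear (L := L) (z := fun t => u t - Real.tanh t)
      (ζ := fun t => v t - sechSq t) (z1 := fun t => clip (v t) - sechSq t)
      (ζ1 := fun t => 2 * clip (u t) ^ 3 - 2 * clip (u t) + ε * f t
        - (-2 * Real.tanh t * sechSq t))
      (Q := Q) (Q1 := fun t => ε * (2 * Real.exp (-2 * t) + 2 * D * (ε * Real.exp (2 * t))))
      (G := fun t => ε + 18 * (Real.exp 3 * (A + 2) * (ε * Real.exp (2 * t))) ^ 2)
      (fun t _ => (h.deriv_left t).sub (hasDerivAt_tanh t))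
      (fun t _ => (h.deriv_right t).sub (hasDerivAt_sechSq t)) ?_ ?_ ?_ ?_ ?_ ?_ ?_ L ⟨hL0, le_rfl⟩
    · have h1 := hB L ⟨hL0, le_rfl⟩
      have hpos : 0 < Real.exp 3 * (A + 2) * (ε * Real.exp (2 * L)) := by positivity
      have hCe : C * (ε * Real.exp (2 * L))
          = 2 * (Real.exp 3 * (A + 2) * (ε * Real.exp (2 * L))) := by rw [hC]; ring
      exact ⟨by linarith [key.1], by linarith [key.2]⟩
    · intro t
      refine (((((hasDerivAt_id t).const_mul (-2)).exp.const_sub (A + 1)).add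
        ((((hasDerivAt_id t).const_mul 2).exp.const_mul ε).const_mul D)).const_mul ε).congr_deriv ?_
      simp only [id]; ring
    · simp only [hQ, Real.tanh_zero, sub_zero, mul_zero, Real.exp_zero]
      have : 0 ≤ ε * (D * (ε * 1)) := by positivity
      linarith
    · simp only [hQ, sechSq_zero, mul_zero, Real.exp_zero]
      have : 0 ≤ ε * (D * (ε * 1)) := by positivity
      nlinarith
    · intro t _
      have : clip (sechSq t) = sechSq t := clip_of_abs_le (by
        rw [abs_of_pos (sechSq_pos t)]; linarith [sechSq_le_one t])
      have h2 := abs_clip_sub_le (v t) (sechSq t)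
      rwa [this] at h2
    · intro t ht hz
      have ht' := Set.Ico_subset_Icc_self ht
      have h1 := abs_clipped_force_sub_le (T := Real.tanh t) (z := u t - Real.tanh t)
        (abs_tanh_le_one t)
      rw [add_sub_cancel] at h1
      have h2 : (u t - Real.tanh t) ^ 2
          ≤ (Real.exp 3 * (A + 2) * (ε * Real.exp (2 * t))) ^ 2 := by
        rw [← sq_abs]
        have := hz.trans (hB t ht')
        gcongr
      have h3 : |ε * f t| ≤ ε := by
        rw [abs_mul, abs_of_pos hε]
        exact mul_le_of_le_one_right hε.le (hf t)
      have e : 2 * clip (u t) ^ 3 - 2 * clip (u t) + ε * f t - (-2 * Real.tanh t * sechSq t)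
            - (4 - 6 * sechSq t) * (u t - Real.tanh t)
          = (2 * clip (u t) ^ 3 - 2 * clip (u t) - (2 * Real.tanh t ^ 3 - 2 * Real.tanh t)
            - (6 * Real.tanh t ^ 2 - 2) * (u t - Real.tanh t)) + ε * f t := by
        rw [sechSq_eq]; ring
      rw [e]
      refine (abs_add_le _ _).trans ?_
      linarith
    · intro t ht
      have h1 : Real.exp (2 * t) * Real.exp (-2 * t) = 1 := by rw [← Real.exp_add]; simp
      have h2 : 2 * Real.exp (2 * t) * (ε * (2 * Real.exp (-2 * t)
          + 2 * D * (ε * Real.exp (2 * t)))) = 4 * ε + 4 * D * (ε * Real.exp (2 * t)) ^ 2 := by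
        linear_combination (4 * ε) * h1
      have h3 : 0 < (ε * Real.exp (2 * t)) ^ 2 := by positivity
      have h4 : 18 * (Real.exp 3 * (A + 2) * (ε * Real.exp (2 * t))) ^ 2
          ≤ 4 * D * (ε * Real.exp (2 * t)) ^ 2 := by
        rw [hD]
        have : 0 < Real.exp 3 ^ 2 * (A + 2) ^ 2 * (ε * Real.exp (2 * t)) ^ 2 := by positivity
        nlinarith
      rw [h2]; linarith
    · intro t _
      positivity
  refine ⟨C, hC0, min (1 / D) (min (1 / C) 1), by positivity, ?_, ?_, ?_⟩
  · calc C * min (1 / D) (min (1 / C) 1) ≤ C * (1 / C) := by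
          gcongr
          exact (min_le_right _ _).trans (min_le_left _ _)
      _ = 1 := by field_simp
  · exact (min_le_right _ _).trans (min_le_right _ _)
  intro ε f u v hε hf h hu0 hv0 t ht
  have hX : D * (ε * Real.exp (2 * |t|)) ≤ 1 := by
    have := ht.trans (min_le_left _ _)
    rw [le_div_iff₀ hD0] at this
    linarith
  rcases le_total 0 t with h1 | h1
  · rw [abs_of_nonneg h1] at hX ⊢
    exact main ε f u v hε hf h hu0 hv0 t h1 hX
  · rw [abs_of_nonpos h1] at hX ⊢
    have := main ε _ _ _ hε (fun t => by rw [abs_neg]; exact hf _) h.reflect (by simpa using hu0)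
      (by simpa using hv0) (-t) (by linarith) hX
    simp only [neg_neg, Real.tanh_neg, sechSq_neg] at this
    refine ⟨?_, this.2⟩
    rw [← abs_neg]; convert this.1 using 2; ring

/-! ### Existence and continuous dependence for the clipped equation -/

/-- The vector field of the clipped equation. -/
noncomputable def clippedField (ε : ℝ) (f : ℝ → ℝ) (t : ℝ) (p : ℝ × ℝ) : ℝ × ℝ :=
  (clip p.2, 2 * clip p.1 ^ 3 - 2 * clip p.1 + ε * f t)

lemma abs_cubic_sub_le {c d : ℝ} (hc : |c| ≤ 3) (hd : |d| ≤ 3) :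
    |2 * c ^ 3 - 2 * c - (2 * d ^ 3 - 2 * d)| ≤ 56 * |c - d| := by
  have e : 2 * c ^ 3 - 2 * c - (2 * d ^ 3 - 2 * d)
      = (2 * (c ^ 2 + c * d + d ^ 2) - 2) * (c - d) := by ring
  rw [e, abs_mul]
  refine mul_le_mul_of_nonneg_right ?_ (abs_nonneg _)
  rw [abs_le] at hc hd ⊢
  constructor <;> nlinarith [sq_nonneg (c + d), sq_nonneg (c - d)]

lemma lipschitzWith_clippedField (ε : ℝ) (f : ℝ → ℝ) (t : ℝ) :
    LipschitzWith 56 (clippedField ε f t) := by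
  refine LipschitzWith.of_dist_le_mul fun p q => ?_
  have h1 : |p.1 - q.1| ≤ dist p q := by rw [← Real.dist_eq]; exact le_max_left _ _
  have h2 : |p.2 - q.2| ≤ dist p q := by rw [← Real.dist_eq]; exact le_max_right _ _
  have h3 := abs_clip_sub_le p.1 q.1
  have h4 := abs_clip_sub_le p.2 q.2
  have h5 := abs_cubic_sub_le (abs_clip_le p.1) (abs_clip_le q.1)
  have h0 : 0 ≤ dist p q := dist_nonneg
  rw [Prod.dist_eq]
  refine max_le ?_ ?_
  · simp only [clippedField, Real.dist_eq, NNReal.coe_ofNat]; linarith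
  · simp only [clippedField, Real.dist_eq, NNReal.coe_ofNat, add_sub_add_right_eq_sub]; linarith

lemma norm_clippedField_le {ε : ℝ} {f : ℝ → ℝ} (hf : ∀ t, |f t| ≤ 1) (t : ℝ) (p : ℝ × ℝ) :
    ‖clippedField ε f t p‖ ≤ 200 + |ε| := by
  have h1 := abs_clip_le p.2
  have h2 := abs_cubic_sub_le (abs_clip_le p.1) (d := 0) (by simp)
  have h3 := abs_clip_le p.1
  have h4 : |ε * f t| ≤ |ε| := by
    rw [abs_mul]; exact mul_le_of_le_one_right (abs_nonneg _) (hf t)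
  have h5 := abs_nonneg ε
  simp only [sub_zero, mul_zero, ne_eq, OfNat.ofNat_ne_zero, not_false_eq_true, zero_pow] at h2
  rw [Prod.norm_def]
  refine max_le ?_ ?_
  · simp only [clippedField, Real.norm_eq_abs]; linarith
  · simp only [clippedField, Real.norm_eq_abs]
    refine (abs_add_le _ _).trans ?_
    linarith

lemma isClippedSol_iff {ε : ℝ} {f u v : ℝ → ℝ} : IsClippedSol ε f u v ↔
    ∀ t, HasDerivAt (fun t => (u t, v t)) (clippedField ε f t (u t, v t)) t := by
  refine ⟨fun h t => (h.deriv_left t).prodMk (h.deriv_right t), fun h => ⟨fun t => ?_, fun t => ?_⟩⟩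
  · exact (h t).fst
  · exact (h t).snd

/-- The truncated field is bounded and globally Lipschitz, so solutions exist on every interval
(-(n+1), n+1); by uniqueness they agree and glue to a global one. -/
lemma exists_isClippedSol (ε : ℝ) {f : ℝ → ℝ} (hfc : Continuous f) (hf : ∀ t, |f t| ≤ 1)
    (a b : ℝ) : ∃ u v, IsClippedSol ε f u v ∧ u 0 = a ∧ v 0 = b := by
  set L : NNReal := (200 + |ε|).toNNReal with hL
  have hloc : ∀ n : ℕ, ∃ α : ℝ → ℝ × ℝ, α 0 = (a, b) ∧
      ∀ t ∈ Set.Ioo (-((n : ℝ) + 1)) (n + 1), HasDerivAt α (clippedField ε f t (α t)) t := by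
    intro n
    have hn : (0 : ℝ) ≤ n := n.cast_nonneg
    -- The radius is the maximal speed times the half-length of the interval, so a solution cannot
    -- leave the ball.
    have hP : IsPicardLindelof (clippedField ε f) (tmin := -((n : ℝ) + 1)) (tmax := n + 1)
        ⟨0, by constructor <;> linarith⟩ (a, b) (L * (n + 1)) 0 L 56 := by
      refine ⟨fun t _ => (lipschitzWith_clippedField ε f t).lipschitzOnWith, fun x _ => ?_,
        fun t _ x _ => ?_, ?_⟩
      · unfold clippedField
        fun_prop
      · rw [hL, Real.coe_toNNReal _ (by positivity)]; exact norm_clippedField_le hf t x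
      · simp
    obtain ⟨α, h0, hα⟩ := hP.exists_eq_forall_mem_Icc_hasDerivWithinAt₀
    exact ⟨α, h0, fun t ht =>
      (hα t (Set.Ioo_subset_Icc_self ht)).hasDerivAt (Icc_mem_nhds ht.1 ht.2)⟩
  choose α h0 hα using hloc
  have hagree : ∀ m n : ℕ, m ≤ n → ∀ t ∈ Set.Ioo (-((m : ℝ) + 1)) (m + 1), α m t = α n t := by
    intro m n hmn
    have hm : (0 : ℝ) ≤ m := m.cast_nonneg
    have hmn' : (m : ℝ) ≤ n := by exact_mod_cast hmn
    refine ODE_solution_unique_of_mem_Ioo (t₀ := 0) (s := fun _ => Set.univ)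
      (fun t _ => (lipschitzWith_clippedField ε f t).lipschitzOnWith)
      (by constructor <;> linarith) (fun t ht => ⟨hα m t ht, trivial⟩)
      (fun t ht => ⟨hα n t ⟨by linarith [ht.1], by linarith [ht.2]⟩, trivial⟩) ?_
    rw [h0, h0]
  set β : ℝ → ℝ × ℝ := fun t => α ⌈|t|⌉₊ t with hβ
  have hβα : ∀ n : ℕ, ∀ t ∈ Set.Ioo (-((n : ℝ) + 1)) (n + 1), β t = α n t := by
    intro n t ht
    have h1 : |t| ≤ ⌈|t|⌉₊ := Nat.le_ceil _
    rcases le_total ⌈|t|⌉₊ n with h | h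
    · refine hagree _ _ h t ?_
      rw [abs_le] at h1
      constructor <;> linarith
    · exact (hagree _ _ h t ht).symm
  have hsol : ∀ t, HasDerivAt β (clippedField ε f t (β t)) t := by
    intro t
    have h1 : |t| ≤ ⌈|t|⌉₊ := Nat.le_ceil _
    rw [abs_le] at h1
    have hmem : t ∈ Set.Ioo (-((⌈|t|⌉₊ : ℝ) + 1)) (⌈|t|⌉₊ + 1) := by constructor <;> linarith
    have := hα _ t hmem
    rw [← hβα _ t hmem] at this
    refine this.congr_of_eventuallyEq ?_
    filter_upwards [Ioo_mem_nhds hmem.1 hmem.2] with r hr using hβα _ r hr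
  refine ⟨fun t => (β t).1, fun t => (β t).2, isClippedSol_iff.2 hsol, ?_, ?_⟩
  · simp [hβ, h0]
  · simp [hβ, h0]

/-- Grönwall's inequality for two solutions of the clipped equation. -/
lemma IsClippedSol.dist_le {ε : ℝ} {f u v u' v' : ℝ → ℝ} (h : IsClippedSol ε f u v)
    (h' : IsClippedSol ε f u' v') {t : ℝ} (ht : 0 ≤ t) :
    dist (u t, v t) (u' t, v' t) ≤ dist (u 0, v 0) (u' 0, v' 0) * Real.exp (56 * t) := by
  have hc : ∀ {u v : ℝ → ℝ}, IsClippedSol ε f u v →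
      ContinuousOn (fun t => (u t, v t)) (Set.Icc 0 t) := fun h =>
    (h.continuous_left.prodMk h.continuous_right).continuousOn
  have := dist_le_of_trajectories_ODE (K := 56) (v := clippedField ε f)
    (fun t => lipschitzWith_clippedField ε f t) (hc h)
    (fun r _ => (isClippedSol_iff.1 h r).hasDerivWithinAt) (hc h')
    (fun r _ => (isClippedSol_iff.1 h' r).hasDerivWithinAt) le_rfl t ⟨ht, le_rfl⟩
  simpa using this

/-- Comparison of a solution with one of the unforced equation. -/
lemma IsClippedSol.dist_unforced_le {ε : ℝ} {f u v u' v' : ℝ → ℝ} (hε : 0 ≤ ε)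
    (hf : ∀ t, |f t| ≤ 1) (h : IsClippedSol ε f u v)
    (h' : IsClippedSol 0 0 u' v') {t δ : ℝ} (hδ : dist (u 0, v 0) (u' 0, v' 0) ≤ δ) (ht : 0 ≤ t) :
    dist (u t, v t) (u' t, v' t) ≤ (δ + ε) * Real.exp (56 * t) := by
  have hc : ∀ {ε : ℝ} {f u v : ℝ → ℝ}, IsClippedSol ε f u v →
      ContinuousOn (fun t => (u t, v t)) (Set.Icc 0 t) := fun h =>
    (h.continuous_left.prodMk h.continuous_right).continuousOn
  have key := dist_le_of_approx_trajectories_ODE (K := 56) (v := clippedField 0 0) (εf := ε)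
    (εg := 0) (fun t => lipschitzWith_clippedField 0 0 t) (hc h)
    (fun r _ => (isClippedSol_iff.1 h r).hasDerivWithinAt) (fun r _ => by
      simp only [clippedField, Prod.dist_eq, dist_self, Real.dist_eq, zero_mul, add_zero,
        add_sub_cancel_left, abs_mul, abs_of_nonneg hε]
      exact max_le hε (mul_le_of_le_one_right hε (hf r))) (hc h')
    (fun r _ => (isClippedSol_iff.1 h' r).hasDerivWithinAt) (fun r _ => (dist_self _).le) hδ t
    ⟨ht, le_rfl⟩
  refine key.trans ?_
  rw [gronwallBound_of_K_ne_0 (by norm_num)]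
  have h1 : 1 ≤ Real.exp (56 * t) := Real.one_le_exp (by positivity)
  simp only [NNReal.coe_ofNat, sub_zero, add_zero]
  nlinarith

/-- A family of solutions with continuous initial data is jointly continuous. -/
lemma continuous_of_isClippedSol {ε : ℝ} {f : ℝ → ℝ} (hf : ∀ t, |f t| ≤ 1) {u v : ℝ → ℝ → ℝ}
    (h : ∀ b, IsClippedSol ε f (u b) (v b)) (hu : Continuous fun b => u b 0)
    (hv : Continuous fun b => v b 0) :
    Continuous fun p : ℝ × ℝ => (u p.1 p.2, v p.1 p.2) := by
  -- Joint continuity follows from continuity in the parameter at fixed time, by Grönwall's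
  -- inequality, and a Lipschitz bound in time that is uniform in the parameter.
  refine (continuous_prod_of_continuous_lipschitzWith
    (fun p : ℝ × ℝ => (u p.2 p.1, v p.2 p.1)) (200 + |ε|).toNNReal ?_ ?_).comp
    continuous_swap
  · intro t
    have hpos : ∀ {f : ℝ → ℝ} {u v : ℝ → ℝ → ℝ} (_ : ∀ b, IsClippedSol ε f (u b) (v b))
        (_ : Continuous fun b => u b 0) (_ : Continuous fun b => v b 0) {t : ℝ}, 0 ≤ t →
        Continuous fun b => (u b t, v b t) := by
      intro f u v h hu hv t ht
      rw [continuous_iff_continuousAt]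
      intro b₀
      rw [ContinuousAt, tendsto_iff_dist_tendsto_zero]
      have h0 : Tendsto (fun b => dist (u b 0, v b 0) (u b₀ 0, v b₀ 0) * Real.exp (56 * t))
          (𝓝 b₀) (𝓝 0) := by
        have := (((hu.prodMk hv).tendsto b₀).dist tendsto_const_nhds (b := (u b₀ 0, v b₀ 0))
          ).mul_const (Real.exp (56 * t))
        simpa using this
      exact squeeze_zero (fun _ => dist_nonneg) (fun b => (h b).dist_le (h b₀) ht) h0
    rcases le_total 0 t with ht | ht
    · exact hpos h hu hv ht
    · have := hpos (fun b => (h b).reflect) (by simp only [neg_zero]; exact hu.neg) (by simpa using hv)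
        (t := -t) (by linarith)
      simp only [neg_neg] at this
      have h2 := this.fst.neg.prodMk this.snd
      simpa using h2
  · intro b
    refine lipschitzWith_of_nnnorm_deriv_le
      (fun t => (isClippedSol_iff.1 (h b) t).differentiableAt) fun t => ?_
    rw [(isClippedSol_iff.1 (h b) t).deriv, ← NNReal.coe_le_coe,
      Real.coe_toNNReal _ (by positivity)]
    exact norm_clippedField_le hf t _

/-! ### Energy and the turn near the saddle -/

/-- The energy deficit `1/2 - E` of a state with respect to the separatrices. -/
noncomputable def deficit (u v : ℝ) : ℝ := ((1 - u ^ 2) ^ 2 - v ^ 2) / 2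

/-- The part of a closed condition that starts at `a` and is left before `b`. -/
lemma exists_exit {G : Set ℝ} (hG : IsClosed G) {a b : ℝ} (ha : a ∈ G) (hab : a ≤ b)
    (hb : ¬ Set.Icc a b ⊆ G) :
    ∃ c, a ≤ c ∧ Set.Icc a c ⊆ G ∧ ∀ δ > 0, ∃ r ∈ Set.Ioo c (c + δ), r ∉ G := by
  set S := {c | c ∈ Set.Icc a b ∧ Set.Icc a c ⊆ G} with hS
  have haS : a ∈ S := ⟨⟨le_rfl, hab⟩, by simpa using ha⟩
  have hbd : BddAbove S := ⟨b, fun c hc => hc.1.2⟩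
  set c := sSup S with hc
  have hac : a ≤ c := le_csSup hbd haS
  have hcb : c ≤ b := csSup_le ⟨a, haS⟩ fun c hc => hc.1.2
  have hico : Set.Ico a c ⊆ G := by
    intro r hr
    obtain ⟨d, hd, hrd⟩ := exists_lt_of_lt_csSup ⟨a, haS⟩ hr.2
    exact hd.2 ⟨hr.1, hrd.le⟩
  have hicc : Set.Icc a c ⊆ G := by
    rcases eq_or_lt_of_le hac with h | h
    · rw [← h]; simpa using ha
    · have := closure_mono hico
      rwa [closure_Ico h.ne, hG.closure_eq] at this
  refine ⟨c, hac, hicc, fun δ hδ => ?_⟩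
  by_contra hcon
  push Not at hcon
  rcases eq_or_lt_of_le hcb with h | h
  · exact hb (h ▸ hicc)
  · set d := min b (c + δ / 2)
    have hcd : c < d := lt_min h (by linarith)
    have hdS : d ∈ S := by
      refine ⟨⟨hac.trans hcd.le, min_le_left _ _⟩, fun r hr => ?_⟩
      rcases le_or_gt r c with h1 | h1
      · exact hicc ⟨hr.1, h1⟩
      · exact hcon r ⟨h1, hr.2.trans_lt ((min_le_right _ _).trans_lt (by linarith))⟩
    exact absurd (le_csSup hbd hdS) (not_le.2 hcd)

namespace IsClippedSol

variable {ε : ℝ} {f u v : ℝ → ℝ}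

lemma hasDerivAt_left (h : IsClippedSol ε f u v) {t : ℝ} (hv : |v t| ≤ 3) :
    HasDerivAt u (v t) t := by
  have := h.deriv_left t
  rwa [clip_of_abs_le hv] at this

lemma hasDerivAt_right (h : IsClippedSol ε f u v) {t : ℝ} (hu : |u t| ≤ 3) :
    HasDerivAt v (2 * u t ^ 3 - 2 * u t + ε * f t) t := by
  have := h.deriv_right t
  rwa [clip_of_abs_le hu] at this

lemma hasDerivAt_deficit (h : IsClippedSol ε f u v) {t : ℝ} (hu : |u t| ≤ 3) (hv : |v t| ≤ 3) :
    HasDerivAt (fun t => deficit (u t) (v t)) (-(ε * (v t * f t))) t := by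
  have h1 := h.hasDerivAt_left hv
  have h2 := h.hasDerivAt_right hu
  refine (((((h1.pow 2).const_sub 1).pow 2).sub (h2.pow 2)).div_const 2).congr_deriv ?_
  push_cast
  simp only [Pi.pow_apply]
  ring

lemma continuous_deficit (h : IsClippedSol ε f u v) :
    Continuous fun t => deficit (u t) (v t) := by
  have h1 := h.continuous_left
  have h2 := h.continuous_right
  unfold deficit
  fun_prop

/-- On an interval where `u` is monotone the deficit changes by at most `ε` times the change of
`u`. -/
lemma abs_deficit_sub_le_of_nonneg (h : IsClippedSol ε f u v) (hε : 0 ≤ ε) (hf : ∀ t, |f t| ≤ 1)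
    {a b : ℝ} (hab : a ≤ b) (hu : ∀ t ∈ Set.Icc a b, |u t| ≤ 3) (hv : ∀ t ∈ Set.Icc a b, |v t| ≤ 3)
    (hpos : ∀ t ∈ Set.Icc a b, 0 ≤ v t) :
    |deficit (u b) (v b) - deficit (u a) (v a)| ≤ ε * (u b - u a) := by
  have hd : ∀ t ∈ Set.Icc a b, HasDerivAt (fun t => deficit (u t) (v t)) (-(ε * (v t * f t))) t :=
    fun t ht => h.hasDerivAt_deficit (hu t ht) (hv t ht)
  have hdu : ∀ t ∈ Set.Icc a b, HasDerivAt (fun t => ε * u t) (ε * v t) t :=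
    fun t ht => (h.hasDerivAt_left (hv t ht)).const_mul ε
  -- As u' = v ≥ 0 and |f| ≤ 1, both ε u + h and ε u - h are nondecreasing, h being the deficit.
  have m1 : MonotoneOn (fun t => ε * u t + deficit (u t) (v t)) (Set.Icc a b) := by
    refine monotoneOn_of_hasDerivWithinAt_nonneg (convex_Icc a b)
      ((h.continuous_left.const_mul ε).add h.continuous_deficit).continuousOn
      (fun t ht => ((hdu t (interior_subset ht)).add (hd t (interior_subset ht))).hasDerivWithinAt)
      fun t ht => ?_
    have h1 := hpos t (interior_subset ht)
    have h2 := (abs_le.1 (hf t)).2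
    nlinarith [mul_nonneg hε h1]
  have m2 : MonotoneOn (fun t => ε * u t - deficit (u t) (v t)) (Set.Icc a b) := by
    refine monotoneOn_of_hasDerivWithinAt_nonneg (convex_Icc a b)
      ((h.continuous_left.const_mul ε).sub h.continuous_deficit).continuousOn
      (fun t ht => ((hdu t (interior_subset ht)).sub (hd t (interior_subset ht))).hasDerivWithinAt)
      fun t ht => ?_
    have h1 := hpos t (interior_subset ht)
    have h2 := (abs_le.1 (hf t)).1
    nlinarith [mul_nonneg hε h1]
  have e1 := m1 ⟨le_rfl, hab⟩ ⟨hab, le_rfl⟩ hab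
  have e2 := m2 ⟨le_rfl, hab⟩ ⟨hab, le_rfl⟩ hab
  simp only at e1 e2
  rw [abs_le]
  constructor <;> linarith

lemma abs_deficit_sub_le_of_nonpos (h : IsClippedSol ε f u v) (hε : 0 ≤ ε) (hf : ∀ t, |f t| ≤ 1)
    {a b : ℝ} (hab : a ≤ b) (hu : ∀ t ∈ Set.Icc a b, |u t| ≤ 3) (hv : ∀ t ∈ Set.Icc a b, |v t| ≤ 3)
    (hneg : ∀ t ∈ Set.Icc a b, v t ≤ 0) :
    |deficit (u b) (v b) - deficit (u a) (v a)| ≤ ε * (u a - u b) := by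
  have := h.neg.abs_deficit_sub_le_of_nonneg hε (fun t => by rw [abs_neg]; exact hf t) hab
    (fun t ht => by rw [abs_neg]; exact hu t ht) (fun t ht => by rw [abs_neg]; exact hv t ht)
    (fun t ht => neg_nonneg.2 (hneg t ht))
  simp only [deficit, neg_sq] at this ⊢
  refine this.trans_eq (by ring)

/-- Estimates on an interval where the solution stays near the saddle `u = 1`, inside the
separatrices. -/
lemma turn_estimates (h : IsClippedSol ε f u v) (hε : 0 < ε) (hf : ∀ t, |f t| ≤ 1) {t₁ t H : ℝ}
    (ht : t₁ ≤ t) (hu₁ : 9 / 10 ≤ u t₁) (hH1 : H ≤ 1)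
    (hH : deficit (u t₁) (v t₁) = ε * H) (hy₁ : 1 - u t₁ ^ 2 ≤ H / 100) (hεH : 64 * ε ≤ H)
    (hG : ∀ r ∈ Set.Icc t₁ t, u t₁ ≤ u r ∧ u r ≤ 1 ∧ ε * H / 2 ≤ deficit (u r) (v r)) :
    (∀ r ∈ Set.Icc t₁ t, u r < 1 ∧ |v r| < 1 - u r ^ 2 ∧
      |deficit (u r) (v r) - ε * H| ≤ 2 * ε * (1 - u t₁)) ∧
    StrictAntiOn v (Set.Icc t₁ t) ∧
    |Real.log (1 - u t ^ 2 - v t) - Real.log (1 - u t₁ ^ 2 - v t₁) - 2 * (t - t₁)| ≤ 8 / 100 := by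
  have hH0 : 0 < H := by linarith
  have hεH0 : 0 < ε * H := by positivity
  -- The lower bound on the deficit gives (1 - u²)² ≥ εH + v² ≥ (8ε)². Hence the restoring force
  -- -2u(1 - u²) outweighs the forcing, and v decreases strictly.
  have hy : ∀ r ∈ Set.Icc t₁ t, |v r| < 1 - u r ^ 2 ∧ 8 * ε ≤ 1 - u r ^ 2 ∧ u r < 1 := by
    intro r hr
    obtain ⟨h1, h2, h3⟩ := hG r hr
    rw [deficit] at h3
    have h4 : 0 ≤ 1 - u r ^ 2 := by nlinarith
    have h5 : v r ^ 2 < (1 - u r ^ 2) ^ 2 := by nlinarith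
    have h6 : (8 * ε) ^ 2 ≤ (1 - u r ^ 2) ^ 2 := by nlinarith [sq_nonneg (v r)]
    have h7 : 8 * ε ≤ 1 - u r ^ 2 := le_of_sq_le_sq h6 h4 |>.trans le_rfl
    refine ⟨abs_lt_of_sq_lt_sq h5 h4, h7, ?_⟩
    rcases eq_or_lt_of_le h2 with h8 | h8
    · rw [h8] at h7; nlinarith
    · exact h8
  have hyle : ∀ r ∈ Set.Icc t₁ t, 1 - u r ^ 2 ≤ 1 - u t₁ ^ 2 := by
    intro r hr
    have := (hG r hr).1
    nlinarith
  have hu3 : ∀ r ∈ Set.Icc t₁ t, |u r| ≤ 3 := by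
    intro r hr
    obtain ⟨h1, h2, -⟩ := hG r hr
    rw [abs_le]; constructor <;> linarith
  have hv3 : ∀ r ∈ Set.Icc t₁ t, |v r| ≤ 3 := by
    intro r hr
    have := (hy r hr).1
    nlinarith [sq_nonneg (u r)]
  have hdv : ∀ r ∈ Set.Icc t₁ t, 2 * u r ^ 3 - 2 * u r + ε * f r ≤ -(1 - u r ^ 2) := by
    intro r hr
    have h1 := (hG r hr).1
    have h2 := (hy r hr).2.1
    have h3 := (abs_le.1 (hf r)).2
    nlinarith
  have hanti : StrictAntiOn v (Set.Icc t₁ t) := by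
    refine strictAntiOn_of_hasDerivWithinAt_neg (convex_Icc _ _) h.continuous_right.continuousOn
      (fun r hr => (h.hasDerivAt_right (hu3 r (interior_subset hr))).hasDerivWithinAt)
      fun r hr => ?_
    have h1 := hdv r (interior_subset hr)
    have h2 := (hy r (interior_subset hr)).2.1
    linarith
  refine ⟨fun r hr => ⟨(hy r hr).2.2, (hy r hr).1, ?_⟩, hanti, ?_⟩
  · have hsub : ∀ {a b}, t₁ ≤ a → b ≤ r → Set.Icc a b ⊆ Set.Icc t₁ t := fun ha hb x hx =>
      ⟨ha.trans hx.1, hx.2.trans (hb.trans hr.2)⟩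
    have hur := (hG r hr).1
    have hur1 := (hy r hr).2.2
    rw [← hH]
    -- Since v decreases, u is increasing, decreasing, or first increasing up to a time σ and then
    -- decreasing. On each monotone piece u varies by less than 1 - u(t₁), which bounds the change
    -- of the deficit by twice ε times that.
    rcases le_or_gt 0 (v r) with h0 | h0
    · have := h.abs_deficit_sub_le_of_nonneg hε.le hf hr.1
        (fun x hx => hu3 x (hsub le_rfl le_rfl hx)) (fun x hx => hv3 x (hsub le_rfl le_rfl hx))
        (fun x hx => h0.trans (hanti.antitoneOn (hsub le_rfl le_rfl hx) hr hx.2))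
      nlinarith
    · rcases le_or_gt (v t₁) 0 with h1 | h1
      · have := h.abs_deficit_sub_le_of_nonpos hε.le hf hr.1
          (fun x hx => hu3 x (hsub le_rfl le_rfl hx)) (fun x hx => hv3 x (hsub le_rfl le_rfl hx))
          (fun x hx => (hanti.antitoneOn ⟨le_rfl, ht⟩ (hsub le_rfl le_rfl hx) hx.1).trans h1)
        nlinarith
      · obtain ⟨σ, hσ, hσ0⟩ := intermediate_value_Icc' hr.1 h.continuous_right.continuousOn
          (show (0 : ℝ) ∈ Set.Icc (v r) (v t₁) from ⟨h0.le, h1.le⟩)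
        have hσt : σ ∈ Set.Icc t₁ t := hsub le_rfl le_rfl hσ
        have e1 := h.abs_deficit_sub_le_of_nonneg hε.le hf hσ.1
          (fun x hx => hu3 x (hsub le_rfl hσ.2 hx)) (fun x hx => hv3 x (hsub le_rfl hσ.2 hx))
          (fun x hx => hσ0.symm.le.trans (hanti.antitoneOn (hsub le_rfl hσ.2 hx) hσt hx.2))
        have e2 := h.abs_deficit_sub_le_of_nonpos hε.le hf hσ.2
          (fun x hx => hu3 x (hsub hσ.1 le_rfl hx)) (fun x hx => hv3 x (hsub hσ.1 le_rfl hx))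
          (fun x hx => (hanti.antitoneOn hσt (hsub hσ.1 le_rfl hx) hx.1).trans hσ0.le)
        have e3 := (hy σ hσt).2.2
        have e4 := abs_add_le (deficit (u r) (v r) - deficit (u σ) (v σ))
          (deficit (u σ) (v σ) - deficit (u t₁) (v t₁))
        rw [sub_add_sub_cancel] at e4
        nlinarith
  -- The quantity q = 1 - u² - v is the expanding coordinate at the saddle: log q grows at the rate
  -- 2, with an error at most K(1 - u²).
  · have hqpos : ∀ r ∈ Set.Icc t₁ t, 0 < 1 - u r ^ 2 - v r := fun r hr => by
      linarith [(abs_lt.1 (hy r hr).1).2]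
    set K := 4 / H with hK
    have hlog : ∀ r ∈ Set.Icc t₁ t, HasDerivAt (fun r => Real.log (1 - u r ^ 2 - v r))
        ((-(2 * u r * v r) - (2 * u r ^ 3 - 2 * u r + ε * f r)) / (1 - u r ^ 2 - v r)) r := by
      intro r hr
      refine ((((h.hasDerivAt_left (hv3 r hr)).pow 2).const_sub 1).sub
        (h.hasDerivAt_right (hu3 r hr))).log (hqpos r hr).ne' |>.congr_deriv ?_
      push_cast
      simp
    have hest : ∀ r ∈ Set.Icc t₁ t,
        |(-(2 * u r * v r) - (2 * u r ^ 3 - 2 * u r + ε * f r)) / (1 - u r ^ 2 - v r) - 2|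
          ≤ K * (1 - u r ^ 2) := by
      intro r hr
      obtain ⟨h1, h2, h3⟩ := hG r hr
      obtain ⟨h4, h5, h6⟩ := hy r hr
      have hq := hqpos r hr
      have hv' := abs_lt.1 h4
      have e : (-(2 * u r * v r) - (2 * u r ^ 3 - 2 * u r + ε * f r)) / (1 - u r ^ 2 - v r) - 2
          = -(2 * (1 - u r)) - ε * f r / (1 - u r ^ 2 - v r) := by
        field_simp; ring
      have e2 : |ε * f r / (1 - u r ^ 2 - v r)| ≤ 2 / H * (1 - u r ^ 2) := by
        rw [abs_div, abs_of_pos hq, abs_mul, abs_of_pos hε, div_le_iff₀ hq]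
        have hfr := hf r
        rw [deficit] at h3
        have h7 : ε * H ≤ (1 - u r ^ 2 - v r) * (1 - u r ^ 2 + v r) := by nlinarith
        have h8 : ε * H ≤ (1 - u r ^ 2 - v r) * (2 * (1 - u r ^ 2)) :=
          h7.trans (mul_le_mul_of_nonneg_left (by linarith) hq.le)
        calc ε * |f r| ≤ ε := mul_le_of_le_one_right hε.le hfr
          _ = (ε * H) / H := by field_simp
          _ ≤ ((1 - u r ^ 2 - v r) * (2 * (1 - u r ^ 2))) / H := by gcongr
          _ = _ := by ring
      rw [e]
      have e3 : |-(2 * (1 - u r))| ≤ 2 * (1 - u r ^ 2) := by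
        rw [abs_neg, abs_of_nonneg (by linarith)]; nlinarith
      have e4 : 2 * (1 - u r ^ 2) ≤ 2 / H * (1 - u r ^ 2) := by
        have : 2 ≤ 2 / H := by rw [le_div_iff₀ hH0]; linarith
        have : 0 ≤ 1 - u r ^ 2 := by linarith
        gcongr
      refine (abs_sub _ _).trans ?_
      have : K * (1 - u r ^ 2) = 2 / H * (1 - u r ^ 2) + 2 / H * (1 - u r ^ 2) := by rw [hK]; ring
      linarith
    have hK0 : 0 < K := by positivity
    have hcl : ContinuousOn (fun r => Real.log (1 - u r ^ 2 - v r)) (Set.Icc t₁ t) :=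
      fun r hr => (hlog r hr).continuousAt.continuousWithinAt
    -- The error in the rate is integrated by means of v, since v' ≤ -(1 - u²); the total is K(v(t₁)
    -- - v(t)), which is small because |v| ≤ H/100 throughout.
    have m1 : MonotoneOn (fun r => Real.log (1 - u r ^ 2 - v r) - 2 * r - K * v r)
        (Set.Icc t₁ t) := by
      refine monotoneOn_of_hasDerivWithinAt_nonneg (convex_Icc _ _)
        ((hcl.sub (by fun_prop)).sub (h.continuous_right.continuousOn.const_smul K)) (fun r hr =>
        (((hlog r (interior_subset hr)).sub ((hasDerivAt_id r).const_mul 2)).sub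
          ((h.hasDerivAt_right (hu3 r (interior_subset hr))).const_mul K)).hasDerivWithinAt)
        fun r hr => ?_
      have h1 := (abs_le.1 (hest r (interior_subset hr))).1
      have h2 := hdv r (interior_subset hr)
      have h3 := mul_le_mul_of_nonneg_left h2 hK0.le
      linarith
    have m2 : AntitoneOn (fun r => Real.log (1 - u r ^ 2 - v r) - 2 * r + K * v r)
        (Set.Icc t₁ t) := by
      refine antitoneOn_of_hasDerivWithinAt_nonpos (convex_Icc _ _)
        ((hcl.sub (by fun_prop)).add (h.continuous_right.continuousOn.const_smul K)) (fun r hr =>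
        (((hlog r (interior_subset hr)).sub ((hasDerivAt_id r).const_mul 2)).add
          ((h.hasDerivAt_right (hu3 r (interior_subset hr))).const_mul K)).hasDerivWithinAt)
        fun r hr => ?_
      have h1 := (abs_le.1 (hest r (interior_subset hr))).2
      have h2 := hdv r (interior_subset hr)
      have h3 := mul_le_mul_of_nonneg_left h2 hK0.le
      linarith
    have e1 := m1 ⟨le_rfl, ht⟩ ⟨ht, le_rfl⟩ ht
    have e2 := m2 ⟨le_rfl, ht⟩ ⟨ht, le_rfl⟩ ht
    simp only at e1 e2
    have b1 := abs_lt.1 (hy t₁ ⟨le_rfl, ht⟩).1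
    have b2 := abs_lt.1 (hy t ⟨ht, le_rfl⟩).1
    have b3 := hyle t ⟨ht, le_rfl⟩
    have b4 : K * (v t₁ - v t) ≤ 8 / 100 := by
      have : v t₁ - v t ≤ 2 * (H / 100) := by linarith
      calc K * (v t₁ - v t) ≤ K * (2 * (H / 100)) := by gcongr
        _ = 8 / 100 := by rw [hK]; field_simp; norm_num
    rw [abs_le]
    constructor <;> linarith

/-- The turn near the saddle `u = 1`: a solution that enters a small neighbourhood with a deficit
`εH` returns after the time `(1/2) log (y² / (εH)) + O(1)`. -/
lemma exists_turn (h : IsClippedSol ε f u v) (hε : 0 < ε) (hf : ∀ t, |f t| ≤ 1) {t₁ H : ℝ}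
    (hu₁ : 9 / 10 ≤ u t₁) (hu₁' : u t₁ < 1) (hv₁ : 0 < v t₁) (hH1 : H ≤ 1)
    (hH : deficit (u t₁) (v t₁) = ε * H) (hy₁ : 1 - u t₁ ^ 2 ≤ H / 100) (hεH : 64 * ε ≤ H) :
    ∃ t₂, t₁ < t₂ ∧ u t₂ = u t₁ ∧ v t₂ < 0 ∧
      (∀ r ∈ Set.Icc t₁ t₂, u t₁ ≤ u r ∧ u r < 1 ∧ |v r| < 1 - u r ^ 2 ∧
        |deficit (u r) (v r) - ε * H| ≤ 2 * ε * (1 - u t₁)) ∧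
      |2 * (t₂ - t₁) - Real.log ((1 - u t₁ ^ 2) ^ 2 / (ε * H))| ≤ 1 := by
  have hH0 : 0 < H := by linarith
  have hεH0 : 0 < ε * H := by positivity
  set y := 1 - u t₁ ^ 2 with hy
  have hy0 : 0 < y := by rw [hy]; nlinarith
  have hu1y : 1 - u t₁ ≤ y := by rw [hy]; nlinarith
  have hq₁ : (y - v t₁) * (y + v t₁) = 2 * (ε * H) := by
    rw [← hH, deficit, hy]; ring
  have hvy : v t₁ < y := by
    by_contra hc
    push Not at hc
    nlinarith
  -- The solution is followed as long as it stays in this closed condition. It has to leave it, and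
  -- it can do so only through u = u(t₁), the other two inequalities being strict.
  set G := {r | u t₁ ≤ u r ∧ u r ≤ 1 ∧ ε * H / 2 ≤ deficit (u r) (v r)} with hGdef
  have hcu := h.continuous_left
  have hGc : IsClosed G :=
    (isClosed_le continuous_const hcu).inter ((isClosed_le hcu continuous_const).inter
      (isClosed_le continuous_const h.continuous_deficit))
  have ht₁G : t₁ ∈ G := ⟨le_rfl, hu₁'.le, by rw [hH]; linarith⟩
  have hq1 : ε * H / y ≤ y - v t₁ ∧ y - v t₁ ≤ 2 * (ε * H) / y := by
    constructor
    · rw [div_le_iff₀ hy0]; nlinarith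
    · rw [le_div_iff₀ hy0]; nlinarith
  have hq1pos : 0 < y - v t₁ := by linarith
  have hlq1 : Real.log (ε * H) - Real.log y ≤ Real.log (y - v t₁) := by
    rw [← Real.log_div hεH0.ne' hy0.ne']
    exact Real.log_le_log (by positivity) hq1.1
  have hlq2 : Real.log (y - v t₁) ≤ Real.log 2 + Real.log (ε * H) - Real.log y := by
    rw [← Real.log_mul two_ne_zero hεH0.ne', ← Real.log_div (by positivity) hy0.ne']
    exact Real.log_le_log hq1pos hq1.2
  -- Inside G the expanding coordinate starts at least at εH/y, grows like e^{2t} and cannot exceed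
  -- 2y, which bounds the length of the stay.
  have htime : ∀ t, t₁ ≤ t → Set.Icc t₁ t ⊆ G →
      2 * (t - t₁) ≤ Real.log 2 + 2 * Real.log y - Real.log (ε * H) + 8 / 100 := by
    intro t ht hsub
    obtain ⟨h1, -, h2⟩ := h.turn_estimates hε hf ht hu₁ hH1 hH hy₁ hεH fun r hr => hsub hr
    have h3 := h1 t ⟨ht, le_rfl⟩
    have h4 := abs_lt.1 h3.2.1
    have h5 : 1 - u t ^ 2 ≤ y := by
      have := (hsub ⟨ht, le_rfl⟩).1
      rw [hy]; nlinarith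
    have h6 : Real.log (1 - u t ^ 2 - v t) ≤ Real.log 2 + Real.log y := by
      rw [← Real.log_mul two_ne_zero hy0.ne']
      exact Real.log_le_log (by linarith) (by linarith)
    have h7 := (abs_le.1 h2).1
    linarith
  obtain ⟨t₂, ht₂, hsub, hexit⟩ := exists_exit hGc (a := t₁)
    (b := t₁ + |Real.log 2 + 2 * Real.log y - Real.log (ε * H) + 8 / 100| + 1) ht₁G
    (by linarith [abs_nonneg (Real.log 2 + 2 * Real.log y - Real.log (ε * H) + 8 / 100)])
    (fun hcon => by
      have h0 := abs_nonneg (Real.log 2 + 2 * Real.log y - Real.log (ε * H) + 8 / 100)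
      have := htime _ (by linarith) hcon
      have := le_abs_self (Real.log 2 + 2 * Real.log y - Real.log (ε * H) + 8 / 100)
      linarith)
  obtain ⟨hall, hanti, hlog⟩ := h.turn_estimates hε hf ht₂ hu₁ hH1 hH hy₁ hεH fun r hr => hsub hr
  have ht₂mem : t₂ ∈ Set.Icc t₁ t₂ := ⟨ht₂, le_rfl⟩
  have ht₁mem : t₁ ∈ Set.Icc t₁ t₂ := ⟨le_rfl, ht₂⟩
  -- The deficit has changed by at most 2ε(1 - u(t₁)) ≤ 2εH/100, so it is still well above εH/2.
  have hin : ∀ᶠ r in 𝓝 t₂, u r ≤ 1 ∧ ε * H / 2 ≤ deficit (u r) (v r) := by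
    obtain ⟨h1, -, h3⟩ := hall t₂ ht₂mem
    have h4 : ε * H / 2 < deficit (u t₂) (v t₂) := by
      have h5 := (abs_le.1 h3).1
      have h6 : ε * (1 - u t₁) ≤ ε * (H / 100) := mul_le_mul_of_nonneg_left (hu1y.trans hy₁) hε.le
      nlinarith
    filter_upwards [hcu.continuousAt.eventually_lt continuousAt_const h1,
      continuousAt_const.eventually_lt h.continuous_deficit.continuousAt h4] with r hr1 hr2
      using ⟨hr1.le, hr2.le⟩
  have hnot : ¬ ∀ᶠ r in 𝓝[>] t₂, u t₁ ≤ u r := by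
    intro hcon
    have := hcon.and (nhdsWithin_le_nhds hin)
    rw [eventually_nhdsWithin_iff, Metric.eventually_nhds_iff] at this
    obtain ⟨δ, hδ, hδ'⟩ := this
    obtain ⟨r, hr, hrG⟩ := hexit δ hδ
    refine hrG (hδ' ?_ hr.1)
    rw [Real.dist_eq, abs_lt]
    constructor <;> linarith [hr.1, hr.2]
  have hv3 : ∀ r ∈ Set.Icc t₁ t₂, |v r| ≤ 3 := fun r hr => by
    have := (hall r hr).2.1
    nlinarith [sq_nonneg (u r)]
  have hut₂ : u t₂ = u t₁ := by
    rcases eq_or_lt_of_le (hsub ht₂mem).1 with h1 | h1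
    · exact h1.symm
    · refine absurd ?_ hnot
      exact nhdsWithin_le_nhds ((continuousAt_const.eventually_lt hcu.continuousAt h1).mono
        fun r hr => hr.le)
  have hlt : t₁ < t₂ := by
    rcases eq_or_lt_of_le ht₂ with h1 | h1
    · refine absurd ?_ hnot
      rw [← h1]
      have hd := h.hasDerivAt_left (hv3 t₁ ht₁mem)
      have := hd.hasDerivWithinAt (s := Set.Ioi t₁)
      rw [hasDerivWithinAt_iff_tendsto_slope' (by simp)] at this
      filter_upwards [this.eventually (lt_mem_nhds hv₁), self_mem_nhdsWithin] with r hr hr2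
      rw [slope_def_field, lt_div_iff₀ (sub_pos.2 hr2)] at hr
      linarith
    · exact h1
  have hvt₂ : v t₂ < 0 := by
    by_contra hc
    push Not at hc
    have : StrictMonoOn u (Set.Icc t₁ t₂) := by
      refine strictMonoOn_of_hasDerivWithinAt_pos (convex_Icc _ _) hcu.continuousOn
        (fun r hr => (h.hasDerivAt_left (hv3 r (interior_subset hr))).hasDerivWithinAt)
        fun r hr => ?_
      rw [interior_Icc] at hr
      exact hc.trans_lt (hanti (Set.Ioo_subset_Icc_self hr) ht₂mem hr.2)
    have := this ht₁mem ht₂mem hlt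
    linarith
  refine ⟨t₂, hlt, hut₂, hvt₂, fun r hr => ⟨(hsub hr).1, hall r hr⟩, ?_⟩
  have h4 := abs_lt.1 (hall t₂ ht₂mem).2.1
  rw [hut₂, ← hy] at h4 hlog
  -- At the exit -y < v < 0, so the expanding coordinate lies between y and 2y. Together with its
  -- initial size between εH/y and 2εH/y this determines the duration up to an additive constant.
  have h5 : Real.log y ≤ Real.log (y - v t₂) := Real.log_le_log hy0 (by linarith)
  have h6 : Real.log (y - v t₂) ≤ Real.log 2 + Real.log y := by
    rw [← Real.log_mul two_ne_zero hy0.ne']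
    exact Real.log_le_log (by linarith) (by linarith)
  rw [Real.log_div (by positivity) hεH0.ne', Real.log_pow]
  have h7 := Real.log_two_lt_d9
  rw [abs_le] at hlog ⊢
  push_cast
  constructor <;> linarith [hlog.1, hlog.2]

end IsClippedSol

/-! ### One passage along a separatrix -/

lemma isClippedSol_separatrix (τ : ℝ) :
    IsClippedSol 0 0 (fun t => -Real.tanh (t - τ)) (fun t => -sechSq (t - τ)) := by
  refine ⟨fun t => ?_, fun t => ?_⟩
  · rw [clip_of_abs_le]
    · exact ((hasDerivAt_tanh _).comp_sub_const t τ).neg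
    · rw [abs_neg, abs_of_pos (sechSq_pos _)]
      linarith [sechSq_le_one (t - τ)]
  · rw [clip_of_abs_le]
    · refine ((hasDerivAt_sechSq _).comp_sub_const t τ).neg.congr_deriv ?_
      rw [sechSq_eq]; ring
    · rw [abs_neg]; linarith [abs_tanh_le_one (t - τ)]

lemma tanh_one_ge : 3 / 5 ≤ Real.tanh 1 := by
  have h1 := tanh_sq_eq 1
  have h2 := sechSq_le_exp 1
  have h3 : Real.exp (-2 * |(1 : ℝ)|) ≤ 1 / 7 := by
    rw [abs_one, mul_one, Real.exp_neg, one_div]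
    have : (7 : ℝ) ≤ Real.exp 2 := by
      have h := Real.exp_one_gt_d9
      rw [show (2 : ℝ) = 1 + 1 by norm_num, Real.exp_add]
      nlinarith
    exact inv_anti₀ (by norm_num) this
  have h4 : 0 ≤ Real.tanh 1 := by
    rw [Real.tanh_eq_sinh_div_cosh]
    exact div_nonneg (Real.sinh_nonneg_iff.2 zero_le_one) (Real.cosh_pos _).le
  have h5 : sechSq 1 ≤ 4 * (1 / 7) := h2.trans (mul_le_mul_of_nonneg_left h3 (by norm_num))
  by_contra hc
  push Not at hc
  have h6 : Real.tanh 1 ^ 2 ≤ (3 / 5) ^ 2 := pow_le_pow_left₀ h4 hc.le 2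
  rw [h1] at h6
  norm_num at h6
  linarith

lemma tanh_mono {x y : ℝ} (h : x ≤ y) : Real.tanh x ≤ Real.tanh y :=
  monotone_of_hasDerivAt_nonneg hasDerivAt_tanh (fun t => (sechSq_pos t).le) h

lemma one_sub_tanh_le {x : ℝ} (hx : 0 ≤ x) : 1 - Real.tanh x ≤ 4 * Real.exp (-2 * x) := by
  have h1 := sechSq_le_exp x
  rw [abs_of_nonneg hx, sechSq_eq] at h1
  have h2 : 0 ≤ Real.tanh x := by
    have := tanh_mono hx
    rwa [Real.tanh_zero] at this
  have h3 := Real.tanh_lt_one x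
  nlinarith

/-- The descent from the neighbourhood of the saddle to the next zero. -/
lemma IsClippedSol.exists_descent {ε : ℝ} {f u v : ℝ → ℝ} (h : IsClippedSol ε f u v) (hε : 0 ≤ ε)
    (hf : ∀ t, |f t| ≤ 1) {t₂ τ κ δ : ℝ} (hτ : 1 ≤ τ)
    (hδ : dist (u t₂, v t₂) (Real.tanh τ, -sechSq τ) ≤ δ)
    (hκ : (δ + ε) * Real.exp (56 * (τ + 1)) ≤ κ) (hκ' : κ ≤ Real.exp (-2 * (τ + 1)) / 2) :
    (∀ t ∈ Set.Icc t₂ (t₂ + τ + 1), |u t + Real.tanh (t - t₂ - τ)| ≤ κ ∧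
      v t < 0 ∧ |v t| ≤ 2) ∧
    ∃ T ∈ Set.Ioo (t₂ + τ - 1) (t₂ + τ + 1), u T = 0 ∧ ∀ t ∈ Set.Ico t₂ T, 0 < u t := by
  have hδ0 : 0 ≤ δ := dist_nonneg.trans hδ
  have hκs : κ ≤ 1 / 10 := by
    refine hκ'.trans ?_
    have h1 : Real.exp (-2 * (τ + 1)) ≤ Real.exp (-4) := Real.exp_le_exp.2 (by linarith)
    have h2 : Real.exp (-4) ≤ 1 / 5 := by
      rw [Real.exp_neg, one_div]
      have := Real.add_one_le_exp (4 : ℝ)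
      exact inv_anti₀ (by norm_num) (by linarith)
    linarith
  have hall : ∀ t ∈ Set.Icc t₂ (t₂ + τ + 1), |u t + Real.tanh (t - t₂ - τ)| ≤ κ ∧
      v t < 0 ∧ |v t| ≤ 2 := by
    intro t ht
    -- The descent takes a time bounded in terms of τ alone, so Grönwall's inequality against the
    -- unforced lower separatrix suffices.
    have key := (h.comp_add t₂).dist_unforced_le hε (fun t => hf _) (isClippedSol_separatrix τ)
      (t := t - t₂) (δ := δ) (by simpa [Real.tanh_neg, sechSq_neg] using hδ) (by linarith [ht.1])
    have hexp : (δ + ε) * Real.exp (56 * (t - t₂)) ≤ κ := by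
      refine le_trans ?_ hκ
      gcongr
      linarith [ht.2]
    have key := key.trans hexp
    rw [Prod.dist_eq, max_le_iff, Real.dist_eq, Real.dist_eq] at key
    simp only [sub_add_cancel, sub_neg_eq_add] at key
    -- The speed on the separatrix is at least 2κ on this interval; an error κ cannot change the
    -- sign of v.
    have h1 : Real.exp (-2 * (τ + 1)) ≤ sechSq (t - t₂ - τ) := by
      refine le_trans (Real.exp_le_exp.2 ?_) (exp_le_sechSq _)
      have : |t - t₂ - τ| ≤ τ + 1 := by
        rw [abs_le]; constructor <;> linarith [ht.1, ht.2]
      linarith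
    have h2 := sechSq_le_one (t - t₂ - τ)
    have h3 := Real.exp_pos (-2 * (τ + 1))
    have h4 := abs_le.1 key.2
    refine ⟨key.1, by linarith [h4.2], ?_⟩
    rw [abs_le]; constructor <;> linarith [h4.1, h4.2]
  refine ⟨hall, ?_⟩
  have hanti : StrictAntiOn u (Set.Icc t₂ (t₂ + τ + 1)) := by
    refine strictAntiOn_of_hasDerivWithinAt_neg (convex_Icc _ _) h.continuous_left.continuousOn
      (fun r hr => (h.hasDerivAt_left
        (by linarith [(hall r (interior_subset hr)).2.2])).hasDerivWithinAt)
      fun r hr => (hall r (interior_subset hr)).2.1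
  have h1 := tanh_one_ge
  have ha := (hall (t₂ + τ - 1) ⟨by linarith, by linarith⟩).1
  have hb := (hall (t₂ + τ + 1) ⟨by linarith, by linarith⟩).1
  rw [show t₂ + τ - 1 - t₂ - τ = -1 by ring, Real.tanh_neg] at ha
  rw [show t₂ + τ + 1 - t₂ - τ = 1 by ring] at hb
  have ha' := (abs_le.1 ha).1
  have hb' := (abs_le.1 hb).2
  obtain ⟨T, hT, hT0⟩ := intermediate_value_Ioo' (a := t₂ + τ - 1) (b := t₂ + τ + 1) (by linarith)
    h.continuous_left.continuousOn (show (0 : ℝ) ∈ Set.Ioo _ _ from ⟨by linarith, by linarith⟩)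
  have hTm : T ∈ Set.Icc t₂ (t₂ + τ + 1) := ⟨by linarith [hT.1], hT.2.le⟩
  refine ⟨T, hT, hT0, fun t ht => ?_⟩
  rw [← hT0]
  exact hanti ⟨ht.1, ht.2.le.trans hTm.2⟩ hTm ht.2

lemma exp_two_ge : (7 : ℝ) ≤ Real.exp 2 := by
  have h := Real.exp_one_gt_d9
  rw [show (2 : ℝ) = 1 + 1 by norm_num, Real.exp_add]
  nlinarith

lemma seven_mul_exp_le (τ : ℝ) : 7 * Real.exp (-2 * τ) ≤ Real.exp (-2 * (τ - 1)) := by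
  rw [show -2 * (τ - 1) = 2 + -2 * τ by ring, Real.exp_add]
  have := exp_two_ge
  gcongr

/-- The state in which the neighbourhood of the saddle is entered. -/
lemma saddle_entry {τ x η : ℝ} (hτ : 1 ≤ τ) (hx : |x - Real.tanh τ| ≤ η)
    (hη : η ≤ Real.exp (-2 * τ) / 8) (hτ' : 500 * Real.exp (-2 * τ) ≤ 1) :
    |1 - x ^ 2 - sechSq τ| ≤ 3 * η ∧ Real.exp (-2 * τ) / 2 ≤ 1 - x ^ 2 ∧
      1 - x ^ 2 ≤ 5 * Real.exp (-2 * τ) ∧ 9 / 10 ≤ x ∧ x < 1 := by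
  set E' := Real.exp (-2 * τ) with hE'
  have hE'0 : 0 < E' := Real.exp_pos _
  have hσE : E' ≤ sechSq τ := by
    have := exp_le_sechSq τ
    rwa [abs_of_nonneg (by linarith)] at this
  have hσE4 : sechSq τ ≤ 4 * E' := by
    have := sechSq_le_exp τ
    rwa [abs_of_nonneg (by linarith)] at this
  have hth0 : 3 / 5 ≤ Real.tanh τ := tanh_one_ge.trans (tanh_mono hτ)
  have hth1 := Real.tanh_lt_one τ
  have hx' := abs_le.1 hx
  have hσt := sechSq_eq τ
  have hyσ : |1 - x ^ 2 - sechSq τ| ≤ 3 * η := by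
    have e : 1 - x ^ 2 - sechSq τ = -(Real.tanh τ + x) * (x - Real.tanh τ) := by rw [hσt]; ring
    rw [e, abs_mul, abs_neg]
    refine mul_le_mul ?_ hx (abs_nonneg _) (by norm_num)
    rw [abs_le]; constructor <;> linarith only [hx'.1, hx'.2, hη, hτ', hth0, hth1, hE'0]
  have hyσ' := abs_le.1 hyσ
  have h1 : E' / 2 ≤ 1 - x ^ 2 := by linarith only [hE'0, hyσ'.1, hη, hσE]
  have h2 : 1 - x ^ 2 ≤ 5 * E' := by linarith only [hyσ'.2, hη, hσE4, hE'0]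
  have h3 : 0 < x := by linarith only [hx'.1, hη, hτ', hth0, hE'0]
  refine ⟨hyσ, h1, h2, ?_, ?_⟩
  · by_contra hcon
    push Not at hcon
    nlinarith only [hcon, h2, hτ', h3]
  · by_contra hcon
    push Not at hcon
    nlinarith only [hcon, h1, hE'0]

/-- The velocity with which the neighbourhood of the saddle is left. -/
lemma saddle_exit {y σ w d ε E' η : ℝ} (hE' : 0 < E') (hE'1 : E' ≤ 1 / 7) (hσE : E' ≤ σ)
    (hσE4 : σ ≤ 4 * E') (hy : 0 ≤ y) (hyE : y ≤ 5 * E') (hyσ : |y - σ| ≤ 3 * η) (hη : 0 ≤ η)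
    (hw : w < 0) (hw2 : w ^ 2 = y ^ 2 - 2 * d) (hd : |d| ≤ 3 * ε) :
    |w + σ| * E' ≤ 4 * η + 6 * ε := by
  -- Energy determines w², and w < 0 < σ keeps the factor w - σ away from zero, so that w itself is
  -- close to -σ.
  have e : (w + σ) * (w - σ) = (y - σ) * (y + σ) - 2 * d := by linear_combination hw2
  have e2 : |(w + σ) * (w - σ)| ≤ 3 * η * (9 / 7) + 2 * (3 * ε) := by
    rw [e]
    refine (abs_sub _ _).trans (add_le_add ?_ ?_)
    · rw [abs_mul]
      refine mul_le_mul hyσ ?_ (abs_nonneg _) (by positivity)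
      rw [abs_le]; constructor <;> linarith
    · rw [abs_mul, abs_two]; gcongr
  have e3 : E' ≤ |w - σ| := by
    rw [abs_of_neg (by linarith)]; linarith
  rw [abs_mul] at e2
  have : |w + σ| * E' ≤ |w + σ| * |w - σ| := by gcongr
  linarith

lemma log_near_exp {τ y : ℝ} (h1 : Real.exp (-2 * τ) / 2 ≤ y) (h2 : y ≤ 5 * Real.exp (-2 * τ)) :
    Real.log y ≤ -2 * τ + 2 ∧ -2 * τ - 1 ≤ Real.log y := by
  have hE' : 0 < Real.exp (-2 * τ) := Real.exp_pos _
  have hy0 : 0 < y := by linarith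
  constructor
  · calc Real.log y ≤ Real.log (5 * Real.exp (-2 * τ)) := Real.log_le_log hy0 h2
      _ = Real.log 5 + -2 * τ := by rw [Real.log_mul (by norm_num) hE'.ne', Real.log_exp]
      _ ≤ _ := by
        have : Real.log 5 ≤ 2 := by
          rw [Real.log_le_iff_le_exp (by norm_num)]
          linarith [exp_two_ge]
        linarith
  · calc -2 * τ - 1 ≤ -2 * τ - Real.log 2 := by linarith [Real.log_two_lt_d9]
      _ = Real.log (Real.exp (-2 * τ) / 2) := by
        rw [Real.log_div hE'.ne' two_ne_zero, Real.log_exp]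
      _ ≤ _ := Real.log_le_log (by positivity) h1

/-- One passage along the upper separatrix: the part after the time `τ`, where the solution is
`η`-close to the separatrix. -/
lemma IsClippedSol.exists_return {ε : ℝ} {f u v : ℝ → ℝ} (h : IsClippedSol ε f u v) (hε : 0 < ε)
    (hf : ∀ t, |f t| ≤ 1) {τ η H : ℝ} (hτ : 1 ≤ τ) (hu : |u τ - Real.tanh τ| ≤ η)
    (hv : |v τ - sechSq τ| ≤ η) (hη : η ≤ Real.exp (-2 * τ) / 8)
    (hH : deficit (u τ) (v τ) = ε * H) (hcH : 800 * Real.exp (-2 * (τ - 1)) ≤ H) (hH1 : H ≤ 1)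
    (hεH : 64 * ε ≤ H) (hεE : 400 * ε ≤ Real.exp (-2 * τ) ^ 2)
    (hκ : ((4 * η + 6 * ε) * Real.exp (2 * τ) + ε) * Real.exp (56 * (τ + 1))
      ≤ Real.exp (-2 * (τ + 1)) / 2) :
    ∃ T, τ < T ∧ u T = 0 ∧ (∀ t ∈ Set.Ico τ T, 0 < u t) ∧ v T < 0 ∧ |v T + 1| ≤ 8 * ε ∧
      |2 * T - Real.log (1 / (ε * H))| ≤ 9 ∧
      |deficit (u (T - τ)) (v (T - τ)) - ε * H| ≤ ε * (15 * Real.exp (-2 * (τ - 1))) ∧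
      ∀ t ∈ Set.Icc τ T, |u t| ≤ 2 ∧ |v t| ≤ 2 := by
  have hη0 : 0 ≤ η := (abs_nonneg _).trans hu
  set E' := Real.exp (-2 * τ) with hE'
  set r := Real.exp (-2 * (τ - 1)) with hr
  have hE'0 : 0 < E' := Real.exp_pos _
  have hr0 : 0 < r := Real.exp_pos _
  have hE'r : 7 * E' ≤ r := seven_mul_exp_le τ
  have hH0 : 0 < H := by linarith only [hεH, hε]
  have hE'1 : 500 * E' ≤ H := by linarith only [hE'r, hcH, hr0]
  obtain ⟨hyσ, hy1, hy2, hu9, hult⟩ := saddle_entry hτ hu hη (hE'1.trans hH1)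
  set y := 1 - u τ ^ 2 with hy
  have hy0 : 0 < y := by linarith only [hy1, hE'0]
  have hσE : E' ≤ sechSq τ := by
    have := exp_le_sechSq τ
    rwa [abs_of_nonneg (by linarith only [hτ])] at this
  have hσE4 : sechSq τ ≤ 4 * E' := by
    have := sechSq_le_exp τ
    rwa [abs_of_nonneg (by linarith only [hτ])] at this
  have hvpos : 0 < v τ := by linarith only [(abs_le.1 hv).1, hη, hσE, hE'0]
  obtain ⟨t₂, ht₂, hut₂, hvt₂, hturn, htime⟩ :=
    h.exists_turn hε hf hu9 hult hvpos hH1 hH (hy2.trans (by linarith only [hE'1])) hεH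
  have ht₂mem : t₂ ∈ Set.Icc τ t₂ := ⟨ht₂.le, le_rfl⟩
  have hd2 := (hturn t₂ ht₂mem).2.2.2
  have e1 : ε * H ≤ ε := mul_le_of_le_one_right hε.le hH1
  have e2 : 0 < ε * H := by positivity
  have e3 : 2 * ε * (1 - u τ) ≤ ε / 2 := by nlinarith only [hu9, hε]
  have hd2' := abs_le.1 hd2
  have hdle : |deficit (u t₂) (v t₂)| ≤ 3 * ε := by
    rw [abs_le]; constructor <;> linarith only [hd2'.1, hd2'.2, e1, e2, e3, hε]
  -- At the exit u has its entrance value and the deficit is O(ε), so the velocity is nearly the one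
  -- on the lower separatrix.
  have hv2σ := saddle_exit hE'0 (by linarith only [hE'1, hH1]) hσE hσE4 hy0.le hy2 hyσ hη0
    hvt₂ (d := deficit (u t₂) (v t₂)) (by rw [deficit, hut₂, ← hy]; ring) hdle
  have hEE' : Real.exp (2 * τ) * E' = 1 := by rw [hE', ← Real.exp_add]; simp
  have hE1 : 1 ≤ Real.exp (2 * τ) := Real.one_le_exp (by linarith only [hτ])
  have hdist : dist (u t₂, v t₂) (Real.tanh τ, -sechSq τ)
      ≤ (4 * η + 6 * ε) * Real.exp (2 * τ) := by
    rw [Prod.dist_eq, Real.dist_eq, Real.dist_eq, hut₂, sub_neg_eq_add]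
    refine max_le (hu.trans ?_) ?_
    · nlinarith only [hE1, hη0, hε]
    · calc |v t₂ + sechSq τ| = (|v t₂ + sechSq τ| * E') * Real.exp (2 * τ) := by
            linear_combination (-|v t₂ + sechSq τ|) * hEE'
        _ ≤ _ := by gcongr
  obtain ⟨hdesc, T, hT, hT0, hTpos⟩ := h.exists_descent hε.le hf hτ hdist hκ le_rfl
  have hTt₂ : t₂ < T := by linarith only [hT.1, hτ]
  have hTmem : T ∈ Set.Icc t₂ (t₂ + τ + 1) := ⟨hTt₂.le, hT.2.le⟩
  have hκr : Real.exp (-2 * (τ + 1)) / 2 ≤ r := by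
    have h1 : Real.exp (-2 * (τ + 1)) ≤ r := Real.exp_le_exp.2 (by linarith only)
    linarith only [h1, hr0]
  have hr1 : r ≤ 1 := Real.exp_le_one_iff.2 (by linarith only [hτ])
  have hu_desc : ∀ t ∈ Set.Icc t₂ (t₂ + τ + 1), |u t| ≤ 2 := by
    intro t ht
    have h1 := abs_le.1 (hdesc t ht).1
    have h2 := abs_le.1 (abs_tanh_le_one (t - t₂ - τ))
    rw [abs_le]; constructor <;> linarith only [h1.1, h1.2, h2.1, h2.2, hκr, hr1]
  have hsub : ∀ {a b}, t₂ ≤ a → b ≤ t₂ + τ + 1 → ∀ t ∈ Set.Icc a b,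
      |u t| ≤ 3 ∧ |v t| ≤ 3 ∧ v t ≤ 0 := fun ha hb t ht => by
    have hm : t ∈ Set.Icc t₂ (t₂ + τ + 1) := ⟨ha.trans ht.1, ht.2.trans hb⟩
    have h1 := hdesc t hm
    exact ⟨(hu_desc t hm).trans (by norm_num), h1.2.2.trans (by norm_num), h1.2.1.le⟩
  have hly := log_near_exp hy1 hy2
  have hlog : |2 * (t₂ - τ) - Real.log (1 / (ε * H)) - 2 * Real.log y| ≤ 1 := by
    rw [Real.log_div (by positivity) (by positivity), Real.log_pow] at htime
    rw [Real.log_div (by positivity) (by positivity), Real.log_one]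
    push_cast at htime
    convert htime using 2
    ring
  have hlog' := abs_le.1 hlog
  have hdT : |deficit (u T) (v T)| ≤ 4 * ε := by
    have h1 := h.abs_deficit_sub_le_of_nonpos hε.le hf hTt₂.le
      (fun t ht => (hsub le_rfl hTmem.2 t ht).1) (fun t ht => (hsub le_rfl hTmem.2 t ht).2.1)
      (fun t ht => (hsub le_rfl hTmem.2 t ht).2.2)
    have h2 := abs_le.1 h1
    have e4 : ε * (u t₂ - u T) ≤ ε := by
      rw [hT0, hut₂, sub_zero]; exact mul_le_of_le_one_right hε.le hult.le
    rw [abs_le]; constructor <;> linarith only [h2.1, h2.2, hd2'.1, hd2'.2, e1, e2, e3, e4, hε]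
  refine ⟨T, ht₂.trans hTt₂, hT0, ?_, (hdesc T hTmem).2.1, ?_, ?_, ?_, ?_⟩
  · intro t ht
    rcases lt_or_ge t t₂ with h2 | h2
    · exact (by linarith only [hu9] : 0 < u τ).trans_le (hturn t ⟨ht.1, h2.le⟩).1
    · exact hTpos t ⟨h2, ht.2⟩
  · have hvT := (hdesc T hTmem).2.1
    -- At a zero of u the deficit is (1 - v²)/2, so the bound on it gives an error 8ε whose constant
    -- does not depend on the previous passage. This is what lets passages be iterated with one
    -- fixed neighbourhood.
    have e : (v T + 1) * (v T - 1) = -2 * deficit (u T) (v T) := by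
      rw [deficit, hT0]; ring
    have e5 : |v T + 1| * |v T - 1| ≤ 8 * ε := by
      rw [← abs_mul, e, abs_mul, abs_neg, abs_two]; linarith only [hdT]
    have e6 : 1 ≤ |v T - 1| := by
      rw [abs_of_neg (by linarith only [hvT])]; linarith only [hvT]
    exact (le_mul_of_one_le_right (abs_nonneg _) e6).trans e5
  -- Here 2T = 2τ + 2(t₂ - τ) + 2(T - t₂). The turn contributes log(1/(εH)) + 2 log y with log y =
  -- -2τ + O(1), the descent 2τ + O(1), and the multiples of τ cancel.
  · rw [abs_le]
    constructor <;> linarith only [hT.1, hT.2, hly.1, hly.2, hlog'.1, hlog'.2]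
  · have h1τ : 1 - u τ ≤ r := by
      have h1 := one_sub_tanh_le (x := τ) (by linarith only [hτ])
      linarith only [h1, (abs_le.1 hu).1, hη, hE'r, hE'0]
    have e4 : 2 * ε * (1 - u τ) ≤ 2 * ε * r := by gcongr
    have e5 : 0 < ε * r := by positivity
    -- The time T - τ falls either into the descent, where u has moved little below 1, or into the
    -- turn.
    rcases le_total t₂ (T - τ) with h1 | h1
    · have hb : T - τ ≤ t₂ + τ + 1 := by linarith only [hT.2, hτ]
      have h2 := h.abs_deficit_sub_le_of_nonpos hε.le hf h1
        (fun t ht => (hsub le_rfl hb t ht).1) (fun t ht => (hsub le_rfl hb t ht).2.1)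
        (fun t ht => (hsub le_rfl hb t ht).2.2)
      have h3 : 1 - 5 * r ≤ u (T - τ) := by
        have h4 := (abs_le.1 (hdesc (T - τ) ⟨h1, hb⟩).1).1
        have h5 : Real.tanh (T - τ - t₂ - τ) ≤ Real.tanh (-(τ - 1)) :=
          tanh_mono (by linarith only [hT.2])
        rw [Real.tanh_neg] at h5
        have h6 := one_sub_tanh_le (x := τ - 1) (by linarith only [hτ])
        linarith only [h4, h5, h6, hκr]
      have h4 := abs_add_le (deficit (u (T - τ)) (v (T - τ)) - deficit (u t₂) (v t₂))
        (deficit (u t₂) (v t₂) - ε * H)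
      rw [sub_add_sub_cancel] at h4
      have h5 : ε * (u t₂ - u (T - τ)) ≤ ε * (5 * r) := by
        rw [hut₂]
        gcongr
        linarith only [h3, hult]
      linarith only [h2, h4, h5, hd2, e4, e5]
    -- A turn of length at least 1 ensures T - τ > t₂ - 1 ≥ τ, so that T - τ does not precede the
    -- turn.
    · have hΔ : 1 ≤ t₂ - τ := by
        have h2 : 3 ≤ Real.log (y ^ 2 / (ε * H)) := by
          rw [Real.le_log_iff_exp_le (by positivity), le_div_iff₀ (by positivity)]
          have h3 : Real.exp 3 ≤ 27 := by
            have h := Real.exp_one_lt_d9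
            rw [show (3 : ℝ) = 1 + 1 + 1 by norm_num, Real.exp_add, Real.exp_add]
            have h0 := Real.exp_pos 1
            have : Real.exp 1 ≤ 3 := by linarith only [h]
            calc Real.exp 1 * Real.exp 1 * Real.exp 1 ≤ 3 * 3 * 3 := by gcongr
              _ = 27 := by norm_num
          have h4 : (E' / 2) ^ 2 ≤ y ^ 2 := by gcongr
          have h5 : Real.exp 3 * (ε * H) ≤ 27 * ε := by gcongr
          linarith only [h4, h5, hεE, hε]
        linarith only [(abs_le.1 htime).1, h2]
      have := (hturn (T - τ) ⟨by linarith only [hT.1, hΔ], h1⟩).2.2.2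
      linarith only [this, e4, e5]
  · intro t ht
    rcases lt_or_ge t t₂ with h2 | h2
    · obtain ⟨h3, h4, h5, -⟩ := hturn t ⟨ht.1, h2.le⟩
      refine ⟨?_, ?_⟩
      · rw [abs_le]; constructor <;> linarith only [h3, h4, hu9]
      · linarith only [h5, sq_nonneg (u t)]
    · have hm : t ∈ Set.Icc t₂ (t₂ + τ + 1) := ⟨h2, ht.2.trans hTmem.2⟩
      exact ⟨hu_desc t hm, (hdesc t hm).2.2⟩

/-- One passage along the upper separatrix, from a zero to the next zero: if the solution starts at
`t = 0` in an `O(ε)`-neighbourhood of the separatrix and the deficit at the fixed time `τ` is `εH`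
with `c ≤ H ≤ 1`, then it turns, and the next zero comes at `(1/2) log (1 / (εH)) + O(1)`. -/
lemma exists_passage (A c τ : ℝ) (hA : 0 ≤ A) (hc : 0 < c) (hτ : 1 ≤ τ)
    (hτc : 800 * Real.exp (-2 * (τ - 1)) ≤ c) : ∃ ε₀ > 0, ∀ (ε : ℝ) (f u v : ℝ → ℝ), 0 < ε →
    ε ≤ ε₀ → (∀ t, |f t| ≤ 1) → IsClippedSol ε f u v → |u 0| ≤ A * ε → |v 0 - 1| ≤ A * ε →
    ∀ H, deficit (u τ) (v τ) = ε * H → c ≤ H → H ≤ 1 →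
    ∃ T, τ < T ∧ u T = 0 ∧ (∀ t ∈ Set.Ico 1 T, 0 < u t) ∧ v T < 0 ∧ |v T + 1| ≤ 8 * ε ∧
      |2 * T - Real.log (1 / (ε * H))| ≤ 9 ∧
      |deficit (u (T - τ)) (v (T - τ)) - ε * H| ≤ ε * (15 * Real.exp (-2 * (τ - 1))) ∧
      ∀ t ∈ Set.Icc 0 T, |u t| ≤ 2 ∧ |v t| ≤ 2 := by
  obtain ⟨C, hC0, δ, hδ0, hCδ, -, hnear⟩ := exists_near_separatrix A hA
  set E := Real.exp (2 * τ) with hE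
  set E' := Real.exp (-2 * τ) with hE'
  have hE0 : 0 < E := Real.exp_pos _
  have hE'0 : 0 < E' := Real.exp_pos _
  set κ := Real.exp (-2 * (τ + 1)) / 2 with hκ
  have hκ0 : 0 < κ := by positivity
  set F := Real.exp (56 * (τ + 1)) with hF
  have hF0 : 0 < F := Real.exp_pos _
  set D := (4 * (C * E) + 6) * E with hD
  have hD0 : 0 < D := by positivity
  -- In order, the bounds on ε ensure closeness to the separatrix up to the time τ, the entry
  -- condition η ≤ E'/8, the Grönwall bound of the descent, 64ε ≤ H, and a turn of length at least
  -- 1.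
  refine ⟨min (δ / E) (min (E' / (8 * (C * E))) (min (κ / ((D + 1) * F)) (min (c / 64)
    (E' ^ 2 / 400)))), by positivity, ?_⟩
  intro ε f u v hε hεle hf h hu0 hv0 H hH hcH hH1
  simp only [le_min_iff] at hεle
  obtain ⟨hεδ, hεC, hεκ, hεc, hεE⟩ := hεle
  rw [le_div_iff₀ (by positivity)] at hεδ hεC hεκ hεc hεE
  have hηE : C * (ε * E) ≤ E' / 8 := by linarith only [hεC]
  have hE'8 : E' ≤ 1 := Real.exp_le_one_iff.2 (by linarith only [hτ])
  have hnear' : ∀ t ∈ Set.Icc 0 τ, |u t - Real.tanh t| ≤ C * (ε * E) ∧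
      |v t - sechSq t| ≤ C * (ε * E) := by
    intro t ht
    have hexp : ε * Real.exp (2 * |t|) ≤ ε * E := by
      rw [abs_of_nonneg ht.1, hE]
      gcongr
      exact ht.2
    obtain ⟨h1, h2⟩ := hnear ε f u v hε hf h hu0 hv0 t (hexp.trans hεδ)
    exact ⟨h1.trans (by gcongr), h2.trans (by gcongr)⟩
  obtain ⟨hu1, hv1⟩ := hnear' τ ⟨by linarith only [hτ], le_rfl⟩
  obtain ⟨T, h1, h2, h3, h4, h5, h6, h7, h8⟩ := h.exists_return hε hf hτ hu1 hv1 hηE hH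
    (hτc.trans hcH) hH1 (by linarith only [hεc, hcH]) (by linarith only [hεE])
    (by refine le_trans (le_of_eq ?_) hεκ; rw [hD]; ring)
  refine ⟨T, h1, h2, fun t ht => ?_, h4, h5, h6, h7, fun t ht => ?_⟩
  · rcases le_or_gt t τ with h9 | h9
    · have h10 := (abs_le.1 (hnear' t ⟨by linarith only [ht.1], h9⟩).1).1
      have h11 := tanh_one_ge.trans (tanh_mono ht.1)
      linarith only [h10, h11, hηE, hE'8]
    · exact h3 t ⟨h9.le, ht.2⟩
  · rcases le_or_gt t τ with h9 | h9
    · obtain ⟨h2, h3⟩ := hnear' t ⟨ht.1, h9⟩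
      have h4 := abs_le.1 (abs_tanh_le_one t)
      have h5 := sechSq_pos t
      have h6 := sechSq_le_one t
      rw [abs_le] at h2 h3
      constructor <;> rw [abs_le] <;> constructor <;>
        linarith only [h2.1, h2.2, h3.1, h3.2, h4.1, h4.2, h5, h6, hηE, hE'8]
    · exact h8 t ⟨h9.le, ht.2⟩

/-- The change of the deficit during a passage, to first order in `ε`. -/
lemma exists_deficit_change (A τ : ℝ) (hA : 0 ≤ A) (hτ : 0 ≤ τ) : ∃ ε₀ > 0, ∃ C > 0,
    ∀ (ε : ℝ) (f u v : ℝ → ℝ), 0 < ε → ε ≤ ε₀ → Continuous f → (∀ t, |f t| ≤ 1) →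
    IsClippedSol ε f u v → |u 0| ≤ A * ε → |v 0 - 1| ≤ A * ε →
    ∀ a ∈ Set.Icc (-τ) τ, |deficit (u a) (v a) + (v 0 - 1) + ε * ∫ r in (0 : ℝ)..a, sechSq r * f r|
      ≤ C * ε ^ 2 := by
  obtain ⟨C, hC0, δ, hδ0, hCδ, -, hnear⟩ := exists_near_separatrix A hA
  set E := Real.exp (2 * τ) with hE
  have hE0 : 0 < E := Real.exp_pos _
  refine ⟨min (δ / E) (1 / (A + 1)), by positivity, C * E * τ + 3 * A ^ 2 + 1, by positivity, ?_⟩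
  intro ε f u v hε hεle hfc hf h hu0 hv0 a ha
  have hεδ : ε * E ≤ δ := by
    rw [← le_div_iff₀ hE0]; exact hεle.trans (min_le_left _ _)
  have hεA : A * ε ≤ 1 := by
    have := hεle.trans (min_le_right _ _)
    rw [le_div_iff₀ (by positivity)] at this
    linarith
  have hsub : ∀ r ∈ Set.uIcc 0 a, |r| ≤ τ := by
    intro r hr
    have : Set.uIcc 0 a ⊆ Set.Icc (-τ) τ := Set.uIcc_subset_Icc ⟨by linarith, hτ⟩ ha
    exact abs_le.2 (this hr)
  have hnear' : ∀ r ∈ Set.uIcc 0 a, |u r| ≤ 3 ∧ |v r| ≤ 3 ∧ |v r - sechSq r| ≤ C * (ε * E) := by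
    intro r hr
    have hexp : ε * Real.exp (2 * |r|) ≤ ε * E := by
      rw [hE]
      gcongr
      exact hsub r hr
    obtain ⟨h1, h2⟩ := hnear ε f u v hε hf h hu0 hv0 r (hexp.trans hεδ)
    have h3 : C * (ε * Real.exp (2 * |r|)) ≤ 1 := (by gcongr; exact hexp.trans hεδ :
      C * (ε * Real.exp (2 * |r|)) ≤ C * δ).trans hCδ
    have h4 := abs_le.1 (abs_tanh_le_one r)
    have h5 := sechSq_pos r
    have h6 := sechSq_le_one r
    refine ⟨?_, ?_, h2.trans (by gcongr)⟩
    · have := abs_le.1 (h1.trans h3)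
      rw [abs_le]; constructor <;> linarith [this.1, this.2, h4.1, h4.2]
    · have := abs_le.1 (h2.trans h3)
      rw [abs_le]; constructor <;> linarith [this.1, this.2]
  have hcv := h.continuous_right
  have hcs := continuous_sechSq
  -- The derivative of the deficit is integrated; replacing v by sech² costs ε times the O(ε)
  -- distance from the separatrix.
  have hint : ∫ r in (0 : ℝ)..a, -(ε * (v r * f r))
      = deficit (u a) (v a) - deficit (u 0) (v 0) := by
    refine intervalIntegral.integral_eq_sub_of_hasDerivAt
      (f := fun t => deficit (u t) (v t)) (fun r hr => ?_) ?_
    · obtain ⟨h1, h2, -⟩ := hnear' r hr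
      exact h.hasDerivAt_deficit h1 h2
    · exact (by fun_prop : Continuous fun r => -(ε * (v r * f r))).intervalIntegrable _ _
  have hdiff : |∫ r in (0 : ℝ)..a, ε * ((v r - sechSq r) * f r)| ≤ ε * (C * (ε * E)) * τ := by
    have h1 := intervalIntegral.norm_integral_le_of_norm_le_const (a := 0) (b := a)
      (f := fun r => ε * ((v r - sechSq r) * f r)) (C := ε * (C * (ε * E))) fun r hr => by
        obtain ⟨-, -, h3⟩ := hnear' r (Set.uIoc_subset_uIcc hr)
        rw [Real.norm_eq_abs, abs_mul, abs_mul, abs_of_pos hε]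
        have := hf r
        calc ε * (|v r - sechSq r| * |f r|) ≤ ε * ((C * (ε * E)) * 1) := by gcongr
          _ = _ := by ring
    rw [Real.norm_eq_abs, sub_zero] at h1
    refine h1.trans ?_
    gcongr
    exact abs_le.2 ha
  have hsplit : ∫ r in (0 : ℝ)..a, ε * ((v r - sechSq r) * f r)
      = -(∫ r in (0 : ℝ)..a, -(ε * (v r * f r))) - ε * ∫ r in (0 : ℝ)..a, sechSq r * f r := by
    rw [← intervalIntegral.integral_const_mul, ← intervalIntegral.integral_neg,
      ← intervalIntegral.integral_sub]
    · congr 1; ext r; ring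
    · exact (by fun_prop : Continuous _).intervalIntegrable _ _
    · exact (by fun_prop : Continuous _).intervalIntegrable _ _
  -- At t = 0 the deficit equals -(v - 1) up to terms quadratic in u and v - 1.
  have h0 : |deficit (u 0) (v 0) + (v 0 - 1)| ≤ (3 * A ^ 2 + 1) * ε ^ 2 := by
    have e : deficit (u 0) (v 0) + (v 0 - 1)
        = -u 0 ^ 2 + (u 0 ^ 2 * u 0 ^ 2) / 2 - (v 0 - 1) ^ 2 / 2 := by rw [deficit]; ring
    have e1 : u 0 ^ 2 ≤ A ^ 2 * ε ^ 2 := by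
      rw [← sq_abs, ← mul_pow]; gcongr
    have e2 : (v 0 - 1) ^ 2 ≤ A ^ 2 * ε ^ 2 := by
      rw [← sq_abs, ← mul_pow]; gcongr
    have e3 : A ^ 2 * ε ^ 2 ≤ 1 := by
      rw [← mul_pow]; exact pow_le_one₀ (by positivity) hεA
    have e4 : 0 ≤ u 0 ^ 2 := sq_nonneg _
    have e5 : u 0 ^ 2 * u 0 ^ 2 ≤ u 0 ^ 2 := mul_le_of_le_one_right e4 (e1.trans e3)
    have e6 : 0 ≤ u 0 ^ 2 * u 0 ^ 2 := by positivity
    have e7 : 0 ≤ (v 0 - 1) ^ 2 := sq_nonneg _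
    have e8 : 0 < ε ^ 2 := by positivity
    rw [e, abs_le]; constructor <;> nlinarith
  rw [hint] at hsplit
  have e : deficit (u a) (v a) + (v 0 - 1) + ε * ∫ r in (0 : ℝ)..a, sechSq r * f r
      = (deficit (u 0) (v 0) + (v 0 - 1)) - ∫ r in (0 : ℝ)..a, ε * ((v r - sechSq r) * f r) := by
    rw [hsplit]; ring
  rw [e]
  refine (abs_sub _ _).trans ((add_le_add h0 hdiff).trans_eq (by ring))

/-! ### Melnikov integrals -/

theorem tendsto_tanh_atTop : Tendsto Real.tanh atTop (𝓝 1) := by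
  have h : Tendsto (fun t : ℝ => 1 - 4 * Real.exp (-(2 * t))) atTop (𝓝 (1 - 4 * 0)) := by
    refine tendsto_const_nhds.sub (Tendsto.const_mul 4 ?_)
    exact Real.tendsto_exp_neg_atTop_nhds_zero.comp (tendsto_id.const_mul_atTop two_pos)
  rw [mul_zero, sub_zero] at h
  refine tendsto_of_tendsto_of_tendsto_of_le_of_le' h tendsto_const_nhds ?_ ?_
  · filter_upwards [eventually_ge_atTop 0] with t ht
    have := one_sub_tanh_le ht
    rw [show -(2 * t) = -2 * t by ring]
    linarith
  · exact Eventually.of_forall fun t => (abs_le.1 (abs_tanh_le_one t)).2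

theorem integrableOn_sechSq (a : ℝ) : MeasureTheory.IntegrableOn sechSq (Set.Ioi a) :=
  MeasureTheory.integrableOn_Ioi_deriv_of_nonneg' (fun t _ => hasDerivAt_tanh t)
    (fun t _ => (sechSq_pos t).le) tendsto_tanh_atTop

theorem integral_Ioi_sechSq (a : ℝ) : ∫ t in Set.Ioi a, sechSq t = 1 - Real.tanh a :=
  MeasureTheory.integral_Ioi_of_hasDerivAt_of_nonneg' (fun t _ => hasDerivAt_tanh t)
    (fun t _ => (sechSq_pos t).le) tendsto_tanh_atTop

theorem integrableOn_sechSq_mul {f : ℝ → ℝ} (hfc : Continuous f) (hf : ∀ t, |f t| ≤ 1) (a : ℝ) :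
    MeasureTheory.IntegrableOn (fun t => sechSq t * f t) (Set.Ioi a) := by
  refine (integrableOn_sechSq a).mono' ?_ (Eventually.of_forall fun t => ?_)
  · exact (continuous_sechSq.mul hfc).aestronglyMeasurable
  · rw [Real.norm_eq_abs, abs_mul, abs_of_pos (sechSq_pos t)]
    exact mul_le_of_le_one_right (sechSq_pos t).le (hf t)

theorem abs_integral_sechSq_mul_sub_le {f : ℝ → ℝ} (hfc : Continuous f) (hf : ∀ t, |f t| ≤ 1)
    (τ : ℝ) : |(∫ t in (0 : ℝ)..τ, sechSq t * f t) - ∫ t in Set.Ioi 0, sechSq t * f t|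
      ≤ 1 - Real.tanh τ := by
  have h := intervalIntegral.integral_Ioi_sub_Ioi' (integrableOn_sechSq_mul hfc hf 0)
    (integrableOn_sechSq_mul hfc hf τ)
  rw [← h, sub_sub_cancel_left, abs_neg, ← integral_Ioi_sechSq, ← Real.norm_eq_abs]
  refine MeasureTheory.norm_integral_le_of_norm_le (integrableOn_sechSq τ)
    (Eventually.of_forall fun t => ?_)
  rw [Real.norm_eq_abs, abs_mul, abs_of_pos (sechSq_pos t)]
  exact mul_le_of_le_one_right (sechSq_pos t).le (hf t)

/-- The Melnikov integral of the separatrix. -/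
noncomputable def melnikov (ω : ℝ) : ℝ := ∫ t, sechSq t * Real.cos (ω * t)

theorem melnikov_eq_two_mul (ω : ℝ) :
    melnikov ω = 2 * ∫ t in Set.Ioi 0, sechSq t * Real.cos (ω * t) := by
  rw [← integral_comp_abs (f := fun t => sechSq t * Real.cos (ω * t)), melnikov]
  congr 1; ext t
  rcases abs_cases t with ⟨h, _⟩ | ⟨h, _⟩ <;> rw [h]
  rw [sechSq_neg, mul_neg, Real.cos_neg]

/-- By evenness of sech² only the part cos Φ cos(ωt) of the cosine contributes, and each of the two
tails is at most 1 - tanh τ. -/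
theorem abs_integral_sechSq_mul_cos_sub_le (ω Φ τ : ℝ) :
    |(∫ t in (-τ)..τ, sechSq t * Real.cos (ω * t + Φ)) - melnikov ω * Real.cos Φ|
      ≤ 2 * (1 - Real.tanh τ) := by
  have hi : ∀ a b Ψ : ℝ, IntervalIntegrable (fun t => sechSq t * Real.cos (ω * t + Ψ))
      MeasureTheory.volume a b := fun a b Ψ =>
    (continuous_sechSq.mul (Real.continuous_cos.comp (by fun_prop))).intervalIntegrable a b
  have h1 : (∫ t in (-τ)..τ, sechSq t * Real.cos (ω * t + Φ))
      = (2 * ∫ t in (0 : ℝ)..τ, sechSq t * Real.cos (ω * t)) * Real.cos Φ := by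
    rw [← intervalIntegral.integral_add_adjacent_intervals (hi (-τ) 0 Φ) (hi 0 τ Φ)]
    have h2 := intervalIntegral.integral_comp_neg (a := 0) (b := τ)
      (fun t => sechSq t * Real.cos (ω * t + Φ))
    rw [neg_zero] at h2
    rw [← h2, ← intervalIntegral.integral_add, mul_comm, ← mul_assoc,
      ← intervalIntegral.integral_const_mul]
    · refine intervalIntegral.integral_congr fun t _ => ?_
      simp only [sechSq_neg, mul_neg]
      rw [Real.cos_add, Real.cos_add, Real.cos_neg, Real.sin_neg]; ring
    · exact ((continuous_sechSq.comp continuous_neg).mul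
        (Real.continuous_cos.comp (by fun_prop))).intervalIntegrable _ _
    · exact hi 0 τ Φ
  rw [h1, melnikov_eq_two_mul, ← sub_mul, abs_mul, ← mul_sub, abs_mul, abs_two]
  have h3 := abs_integral_sechSq_mul_sub_le (f := fun t => Real.cos (ω * t)) (by fun_prop)
    (fun t => Real.abs_cos_le_one _) τ
  have h4 := Real.abs_cos_le_one Φ
  refine (mul_le_of_le_one_right (by positivity) h4).trans ?_
  linarith

/-- The substitution x = (1 + tanh t)/2, with dx = (sech² t)/2 dt, turns the Fourier transform of
sech² into a beta integral. -/
theorem logistic_image : (fun t : ℝ => (1 + Real.tanh t) / 2) '' Set.univ = Set.Ioo 0 1 := by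
  ext x
  simp only [Set.image_univ, Set.mem_range, Set.mem_Ioo]
  constructor
  · rintro ⟨t, rfl⟩
    have h1 := sechSq_pos t
    rw [sechSq_eq] at h1
    have h2 : |Real.tanh t| < 1 := by
      rw [← sq_lt_one_iff_abs_lt_one]; linarith
    rw [abs_lt] at h2
    constructor <;> linarith
  · rintro ⟨h0, h1⟩
    refine ⟨Real.log (x / (1 - x)) / 2, ?_⟩
    have hpos : 0 < x / (1 - x) := div_pos h0 (by linarith)
    set t := Real.log (x / (1 - x)) / 2 with ht
    have he : Real.exp t * Real.exp t = x / (1 - x) := by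
      rw [← Real.exp_add, ht, add_halves, Real.exp_log hpos]
    have hx : (1 - x) ≠ 0 := by linarith
    have hne : Real.exp t + Real.exp (-t) ≠ 0 := by positivity
    rw [Real.tanh_eq_sinh_div_cosh, Real.sinh_eq, Real.cosh_eq]
    have hn : Real.exp t * Real.exp (-t) = 1 := by rw [← Real.exp_add]; simp
    have h5 : (1 - x) * (Real.exp t * Real.exp t) = x := by rw [he]; field_simp
    have h6 : (1 - x) * Real.exp t = x * Real.exp (-t) := by
      have : Real.exp t ≠ 0 := (Real.exp_pos t).ne'
      apply mul_right_cancel₀ this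
      linear_combination h5 - x * hn
    field_simp
    linear_combination 2 * h6

/-- Under this substitution x/(1 - x) = e^{2t}, so the oscillating factor becomes the integrand of
the beta function. -/
theorem cpow_logistic (w t : ℝ) :
    (((1 + Real.tanh t) / 2 : ℝ) : ℂ) ^ ((w : ℂ) * Complex.I)
      * (1 - (((1 + Real.tanh t) / 2 : ℝ) : ℂ)) ^ (-((w : ℂ) * Complex.I))
      = Complex.exp (((2 * w * t : ℝ) : ℂ) * Complex.I) := by
  have hmem : (1 + Real.tanh t) / 2 ∈ Set.Ioo (0 : ℝ) 1 := by
    rw [← logistic_image]; exact ⟨t, trivial, rfl⟩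
  set x := (1 + Real.tanh t) / 2 with hx
  have h1 : Real.log x - Real.log (1 - x) = 2 * t := by
    rw [← Real.log_div hmem.1.ne' (by linarith [hmem.2])]
    have : x / (1 - x) = Real.exp (2 * t) := by
      rw [div_eq_iff (by linarith [hmem.2]), hx, Real.tanh_eq_sinh_div_cosh, Real.sinh_eq,
        Real.cosh_eq, two_mul t, Real.exp_add]
      have hn : Real.exp t * Real.exp (-t) = 1 := by rw [← Real.exp_add]; simp
      have hne : Real.exp t + Real.exp (-t) ≠ 0 := by positivity
      field_simp
      linear_combination (-2 * Real.exp t) * hn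
    rw [this, Real.log_exp]
  rw [← Complex.ofReal_one, ← Complex.ofReal_sub,
    Complex.cpow_def_of_ne_zero (Complex.ofReal_ne_zero.2 hmem.1.ne'),
    Complex.cpow_def_of_ne_zero (Complex.ofReal_ne_zero.2 (by linarith [hmem.2])),
    ← Complex.ofReal_log hmem.1.le, ← Complex.ofReal_log (by linarith [hmem.2]), ← Complex.exp_add]
  congr 1
  have : ((Real.log x : ℝ) : ℂ) - ((Real.log (1 - x) : ℝ) : ℂ) = 2 * (t : ℂ) := by
    rw [← Complex.ofReal_sub, h1]; push_cast; ring
  push_cast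
  linear_combination (w : ℂ) * Complex.I * this

theorem integral_sechSq_mul_exp (w : ℝ) :
    ∫ t, (sechSq t : ℂ) * Complex.exp (((2 * w * t : ℝ) : ℂ) * Complex.I)
      = 2 * Complex.betaIntegral (1 + w * Complex.I) (1 - w * Complex.I) := by
  have hd : ∀ t ∈ (Set.univ : Set ℝ), HasDerivWithinAt (fun t : ℝ => (1 + Real.tanh t) / 2)
      (sechSq t / 2) Set.univ t := fun t _ =>
    (((hasDerivAt_tanh t).const_add 1).div_const 2).hasDerivWithinAt
  have hinj : Set.InjOn (fun t : ℝ => (1 + Real.tanh t) / 2) Set.univ := by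
    have : StrictMono fun t : ℝ => (1 + Real.tanh t) / 2 :=
      strictMono_of_hasDerivAt_pos
        (fun t => ((hasDerivAt_tanh t).const_add 1).div_const 2)
        (fun t => half_pos (sechSq_pos t))
    exact this.injective.injOn
  have h := MeasureTheory.integral_image_eq_integral_abs_deriv_smul MeasurableSet.univ hd hinj
    (fun x : ℝ => (x : ℂ) ^ ((w : ℂ) * Complex.I) * (1 - (x : ℂ)) ^ (-((w : ℂ) * Complex.I)))
  rw [logistic_image] at h
  rw [Complex.betaIntegral, intervalIntegral.integral_of_le zero_le_one,
    MeasureTheory.integral_Ioc_eq_integral_Ioo]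
  simp only [add_sub_cancel_left, show (1 - (w : ℂ) * Complex.I - 1) = -(w * Complex.I) by ring]
  rw [h, MeasureTheory.Measure.restrict_univ, ← MeasureTheory.integral_const_mul]
  congr 1; ext t
  rw [cpow_logistic, abs_of_pos (half_pos (sechSq_pos t)), Complex.real_smul]
  push_cast; ring

/-- The beta integral is Γ(1 + iω/2) Γ(1 - iω/2), the two arguments having sum 2. The factors are
conjugate, so the value is a squared modulus, and Γ has no zeros. -/
theorem melnikov_pos (ω : ℝ) : 0 < melnikov ω := by
  have hre1 : 0 < (1 + ((ω / 2 : ℝ) : ℂ) * Complex.I).re := by simp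
  have hre2 : 0 < (1 - ((ω / 2 : ℝ) : ℂ) * Complex.I).re := by simp
  have hB := Complex.Gamma_mul_Gamma_eq_betaIntegral hre1 hre2
  have hconj : (1 - ((ω / 2 : ℝ) : ℂ) * Complex.I)
      = (starRingEnd ℂ) (1 + ((ω / 2 : ℝ) : ℂ) * Complex.I) := by
    simp only [map_add, map_one, map_mul, Complex.conj_ofReal, Complex.conj_I]; ring
  rw [show (1 + ((ω / 2 : ℝ) : ℂ) * Complex.I) + (1 - ((ω / 2 : ℝ) : ℂ) * Complex.I) = ((1 : ℕ) : ℂ) + 1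
    by push_cast; ring, Complex.Gamma_nat_eq_factorial, Nat.factorial_one, Nat.cast_one, one_mul]
    at hB
  have hE := integral_sechSq_mul_exp (ω / 2)
  rw [← hB, hconj, Complex.Gamma_conj, Complex.mul_conj] at hE
  -- Integrability comes for free: the integral of a nonintegrable function is zero by convention,
  -- whereas the value found is not zero.
  have hint : MeasureTheory.Integrable
      fun t => (sechSq t : ℂ) * Complex.exp (((2 * (ω / 2) * t : ℝ) : ℂ) * Complex.I) := by
    by_contra hcon
    rw [MeasureTheory.integral_undef hcon] at hE
    have h0 := Complex.Gamma_ne_zero_of_re_pos hre1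
    rw [eq_comm, mul_eq_zero, Complex.ofReal_eq_zero, Complex.normSq_eq_zero] at hE
    rcases hE with h | h
    · norm_num at h
    · exact h0 h
  have hM : melnikov ω = 2 * Complex.normSq (Complex.Gamma (1 + ((ω / 2 : ℝ) : ℂ) * Complex.I)) := by
    have h1 := integral_re (𝕜 := ℂ) hint
    rw [hE] at h1
    have h2 : ∀ t : ℝ, RCLike.re ((sechSq t : ℂ) *
        Complex.exp (((2 * (ω / 2) * t : ℝ) : ℂ) * Complex.I)) = sechSq t * Real.cos (ω * t) := by
      intro t
      rw [RCLike.re_eq_complex_re, Complex.re_ofReal_mul, Complex.exp_ofReal_mul_I_re]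
      congr 2; ring
    simp only [h2] at h1
    rw [melnikov, h1, RCLike.re_eq_complex_re,
      show (2 : ℂ) = ((2 : ℝ) : ℂ) by norm_num, Complex.re_ofReal_mul, Complex.ofReal_re]
  rw [hM]
  exact mul_pos two_pos (Complex.normSq_pos.2 (Complex.Gamma_ne_zero_of_re_pos hre1))

/-! ### Asymptotic expansions in exponential polynomials -/

/-- The function `t^l e^{(2κ + i m ω) t}`. -/
noncomputable def expoPow (ω : ℝ) (κ : ℤ) (l : ℕ) (m : ℤ) : ℝ → ℂ :=
  fun t => (t : ℂ) ^ l * Complex.exp ((2 * κ + m * ω * Complex.I) * t)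

/-- The complex span of the functions `t^l e^{(2κ + i m ω) t}` with `κ ≤ n`. -/
noncomputable def expoSpan (ω : ℝ) (n : ℤ) : Submodule ℂ (ℝ → ℂ) :=
  Submodule.span ℂ {f | ∃ κ l m, κ ≤ n ∧ f = expoPow ω κ l m}

theorem expoPow_mem {ω : ℝ} {n κ : ℤ} (l : ℕ) (m : ℤ) (h : κ ≤ n) :
    expoPow ω κ l m ∈ expoSpan ω n :=
  Submodule.subset_span ⟨κ, l, m, h, rfl⟩

theorem expoSpan_mono {ω : ℝ} {n n' : ℤ} (h : n ≤ n') : expoSpan ω n ≤ expoSpan ω n' :=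
  Submodule.span_mono fun _ ⟨κ, l, m, hκ, hf⟩ => ⟨κ, l, m, hκ.trans h, hf⟩

theorem expoPow_mul (ω : ℝ) (κ κ' : ℤ) (l l' : ℕ) (m m' : ℤ) :
    expoPow ω κ l m * expoPow ω κ' l' m' = expoPow ω (κ + κ') (l + l') (m + m') := by
  ext t
  simp only [expoPow, Pi.mul_apply]
  rw [show (2 * ((κ + κ' : ℤ) : ℂ) + ((m + m' : ℤ) : ℂ) * ω * Complex.I) * (t : ℂ)
    = (2 * κ + m * ω * Complex.I) * t + (2 * κ' + m' * ω * Complex.I) * t by push_cast; ring,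
    Complex.exp_add, pow_add]
  ring

theorem mul_mem_expoSpan {ω : ℝ} {n n' : ℤ} {f g : ℝ → ℂ} (hf : f ∈ expoSpan ω n)
    (hg : g ∈ expoSpan ω n') : f * g ∈ expoSpan ω (n + n') := by
  have h := Submodule.mul_mem_mul hf hg
  rw [expoSpan, expoSpan, Submodule.span_mul_span] at h
  refine Submodule.span_mono ?_ h
  rintro _ ⟨_, ⟨κ, l, m, hκ, rfl⟩, _, ⟨κ', l', m', hκ', rfl⟩, rfl⟩
  exact ⟨_, _, _, add_le_add hκ hκ', expoPow_mul ..⟩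

theorem continuous_of_mem_expoSpan {ω : ℝ} {n : ℤ} {f : ℝ → ℂ} (hf : f ∈ expoSpan ω n) :
    Continuous f := by
  induction hf using Submodule.span_induction with
  | mem f hf => obtain ⟨κ, l, m, -, rfl⟩ := hf; unfold expoPow; fun_prop
  | zero => exact continuous_const
  | add f g _ _ hf hg => exact hf.add hg
  | smul c f _ hf => exact hf.const_smul c

theorem norm_expoPow (ω : ℝ) (κ : ℤ) (l : ℕ) (m : ℤ) (t : ℝ) :
    ‖expoPow ω κ l m t‖ = |t| ^ l * Real.exp (2 * κ * t) := by
  rw [expoPow, norm_mul, norm_pow, Complex.norm_real, Real.norm_eq_abs, Complex.norm_exp]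
  congr 2
  simp [Complex.mul_re]

/-- The extra unit in the exponent absorbs the powers of t. -/
theorem isBigO_of_mem_expoSpan {ω : ℝ} {n : ℤ} {f : ℝ → ℂ} (hf : f ∈ expoSpan ω n) :
    f =O[atTop] fun t : ℝ => Real.exp ((2 * n + 1) * t) := by
  induction hf using Submodule.span_induction with
  | mem f hf =>
    obtain ⟨κ, l, m, hκ, rfl⟩ := hf
    have h1 : (fun t : ℝ => t ^ l) =O[atTop] fun t => Real.exp (1 * t) :=
      (isLittleO_pow_exp_pos_mul_atTop l one_pos).isBigO
    have h2 : (fun t : ℝ => Real.exp (2 * κ * t)) =O[atTop] fun t => Real.exp (2 * n * t) := by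
      refine IsBigO.of_bound 1 ?_
      filter_upwards [eventually_ge_atTop 0] with t ht
      rw [Real.norm_eq_abs, Real.norm_eq_abs, Real.abs_exp, Real.abs_exp, one_mul]
      have : (κ : ℝ) ≤ n := by exact_mod_cast hκ
      gcongr
    have h3 := h1.mul h2
    refine IsBigO.trans (IsBigO.of_bound 1 ?_) (h3.congr_right fun t => ?_)
    · exact Eventually.of_forall fun t => by
        rw [norm_expoPow, Real.norm_eq_abs, abs_mul, abs_pow, Real.abs_exp, one_mul]
    · rw [← Real.exp_add]; ring_nf
  | zero => exact isBigO_zero _ _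
  | add f g _ _ hf hg => exact hf.add hg
  | smul c f _ hf => exact hf.const_smul_left c

/-- If the exponent vanishes, integration raises the power of t, which is why such powers are
admitted in the span. Otherwise integration by parts lowers it, and induction on l applies. -/
theorem exists_primitive_expoPow {ω : ℝ} (κ : ℤ) (l : ℕ) (m : ℤ) :
    ∃ G ∈ expoSpan ω κ, ∀ t, HasDerivAt G (expoPow ω κ l m t) t := by
  by_cases hl : (2 * κ + m * ω * Complex.I : ℂ) = 0
  · refine ⟨(1 / (l + 1 : ℂ)) • expoPow ω κ (l + 1) m,
      Submodule.smul_mem _ _ (expoPow_mem _ _ le_rfl), fun t => ?_⟩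
    have hne : (l + 1 : ℂ) ≠ 0 := by exact_mod_cast Nat.succ_ne_zero l
    have h := (((hasDerivAt_id (t : ℂ)).comp_ofReal.pow (l + 1)).const_mul (1 / (l + 1 : ℂ)))
    have e : (1 / (l + 1 : ℂ)) • expoPow ω κ (l + 1) m
        = fun y => 1 / (l + 1 : ℂ) * ((fun y : ℝ => id (y : ℂ)) ^ (l + 1)) y := by
      ext s; simp [expoPow, hl]
    rw [e]
    refine h.congr_deriv ?_
    simp only [expoPow, hl]
    simp
    field_simp
  · set lam : ℂ := 2 * κ + m * ω * Complex.I with hlam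
    have hexp : ∀ t : ℝ, HasDerivAt (fun s : ℝ => Complex.exp (lam * s))
        (Complex.exp (lam * t) * lam) t := fun t => by
      have := ((hasDerivAt_id (t : ℂ)).const_mul lam).cexp.comp_ofReal
      simpa using this
    induction l with
    | zero =>
      refine ⟨(1 / lam) • expoPow ω κ 0 m,
        Submodule.smul_mem _ _ (expoPow_mem _ _ le_rfl), fun t => ?_⟩
      have h := (hexp t).const_mul (1 / lam)
      have e : (1 / lam) • expoPow ω κ 0 m = fun y : ℝ => 1 / lam * Complex.exp (lam * y) := by
        ext s; simp [expoPow, hlam]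
      rw [e]
      refine h.congr_deriv ?_
      simp only [expoPow, ← hlam]; field_simp
    | succ l ih =>
      obtain ⟨G, hG, hd⟩ := ih
      refine ⟨(1 / lam) • expoPow ω κ (l + 1) m - ((l + 1 : ℂ) / lam) • G,
        Submodule.sub_mem _ (Submodule.smul_mem _ _ (expoPow_mem _ _ le_rfl))
          (Submodule.smul_mem _ _ hG), fun t => ?_⟩
      have h1 := ((hasDerivAt_id (t : ℂ)).comp_ofReal.pow (l + 1)).mul (hexp t)
      have h := (h1.const_mul (1 / lam)).sub ((hd t).const_mul ((l + 1 : ℂ) / lam))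
      have e : (1 / lam) • expoPow ω κ (l + 1) m - ((l + 1 : ℂ) / lam) • G
          = (fun y : ℝ => 1 / lam * (((fun y : ℝ => id (y : ℂ)) ^ (l + 1)
            * fun s : ℝ => Complex.exp (lam * s)) y)) - fun y => (l + 1 : ℂ) / lam * G y := by
        ext s; simp [expoPow, hlam]
      rw [e]
      refine h.congr_deriv ?_
      simp only [expoPow, ← hlam]
      simp
      field_simp
      ring

theorem exists_primitive_of_mem_expoSpan {ω : ℝ} {n : ℤ} {f : ℝ → ℂ}
    (hf : f ∈ expoSpan ω n) : ∃ G ∈ expoSpan ω n, ∀ t, HasDerivAt G (f t) t := by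
  induction hf using Submodule.span_induction with
  | mem f hf =>
    obtain ⟨κ, l, m, hκ, rfl⟩ := hf
    obtain ⟨G, hG, hd⟩ := exists_primitive_expoPow (ω := ω) κ l m
    exact ⟨G, expoSpan_mono hκ hG, hd⟩
  | zero => exact ⟨0, Submodule.zero_mem _, fun t => hasDerivAt_const t 0⟩
  | add f g _ _ hf hg =>
    obtain ⟨F, hF, hF'⟩ := hf
    obtain ⟨G, hG, hG'⟩ := hg
    exact ⟨F + G, Submodule.add_mem _ hF hG, fun t => (hF' t).add (hG' t)⟩
  | smul c f _ hf =>
    obtain ⟨F, hF, hF'⟩ := hf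
    exact ⟨c • F, Submodule.smul_mem _ _ hF, fun t => (hF' t).const_smul c⟩

/-- A continuous function that has, as `t → ∞`, an expansion to all orders in the
functions `t^l e^{(2κ + i m ω) t}` with `κ ≤ n`. -/
structure HasExpansion (ω : ℝ) (n : ℤ) (f : ℝ → ℂ) : Prop where
  continuous : Continuous f
  expansion : ∀ K : ℤ, ∃ g ∈ expoSpan ω n,
    (fun t => f t - g t) =O[atTop] fun t : ℝ => Real.exp (2 * K * t)

theorem exp_isBigO_exp {a b : ℝ} (h : a ≤ b) :
    (fun t : ℝ => Real.exp (a * t)) =O[atTop] fun t : ℝ => Real.exp (b * t) := by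
  refine IsBigO.of_bound 1 ?_
  filter_upwards [eventually_ge_atTop 0] with t ht
  rw [Real.norm_eq_abs, Real.norm_eq_abs, Real.abs_exp, Real.abs_exp, one_mul]
  gcongr

namespace HasExpansion

variable {ω : ℝ} {n n' : ℤ} {f g : ℝ → ℂ}

theorem of_mem (hf : f ∈ expoSpan ω n) : HasExpansion ω n f :=
  ⟨continuous_of_mem_expoSpan hf, fun K => ⟨f, hf, by simpa using isBigO_zero _ _⟩⟩

theorem mono (hf : HasExpansion ω n f) (h : n ≤ n') : HasExpansion ω n' f :=
  ⟨hf.continuous, fun K => let ⟨g, hg, hO⟩ := hf.expansion K; ⟨g, expoSpan_mono h hg, hO⟩⟩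

theorem add (hf : HasExpansion ω n f) (hg : HasExpansion ω n g) :
    HasExpansion ω n (fun t => f t + g t) := by
  refine ⟨hf.continuous.add hg.continuous, fun K => ?_⟩
  obtain ⟨F, hF, hF'⟩ := hf.expansion K
  obtain ⟨G, hG, hG'⟩ := hg.expansion K
  refine ⟨F + G, Submodule.add_mem _ hF hG, (hF'.add hG').congr_left fun t => ?_⟩
  simp only [Pi.add_apply]; ring

theorem const_mul (hf : HasExpansion ω n f) (c : ℂ) : HasExpansion ω n (fun t => c * f t) := by
  refine ⟨continuous_const.mul hf.continuous, fun K => ?_⟩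
  obtain ⟨F, hF, hF'⟩ := hf.expansion K
  refine ⟨c • F, Submodule.smul_mem _ _ hF, (hF'.const_mul_left c).congr_left fun t => ?_⟩
  simp only [Pi.smul_apply, smul_eq_mul]; ring

theorem neg (hf : HasExpansion ω n f) : HasExpansion ω n (fun t => -f t) := by
  simpa using hf.const_mul (-1)

theorem sub (hf : HasExpansion ω n f) (hg : HasExpansion ω n g) :
    HasExpansion ω n (fun t => f t - g t) := by
  simpa [sub_eq_add_neg] using hf.add hg.neg

theorem isBigO (hf : HasExpansion ω n f) :
    f =O[atTop] fun t : ℝ => Real.exp ((2 * n + 1) * t) := by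
  obtain ⟨F, hF, hF'⟩ := hf.expansion n
  have := (hF'.trans (exp_isBigO_exp (by linarith))).add (isBigO_of_mem_expoSpan hF)
  exact this.congr_left fun t => by ring

theorem mul (hf : HasExpansion ω n f) (hg : HasExpansion ω n' g) :
    HasExpansion ω (n + n') (fun t => f t * g t) := by
  refine ⟨hf.continuous.mul hg.continuous, fun K => ?_⟩
  -- Each factor is expanded far enough for its error to beat the growth e^{(2n+1)t} of the other.
  obtain ⟨F, hF, hF'⟩ := hf.expansion (K - n' - 1)
  obtain ⟨G, hG, hG'⟩ := hg.expansion (K - n - 1)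
  refine ⟨F * G, mul_mem_expoSpan hF hG, ?_⟩
  have h1 := hF'.mul hg.isBigO
  have h2 := (isBigO_of_mem_expoSpan hF).mul hG'
  simp only [← Real.exp_add, ← add_mul] at h1 h2
  have h3 := (h1.trans (exp_isBigO_exp (b := 2 * K) (by push_cast; linarith))).add
    (h2.trans (exp_isBigO_exp (b := 2 * K) (by push_cast; linarith)))
  refine h3.congr_left fun t => ?_
  simp only [Pi.mul_apply]; ring

end HasExpansion

theorem exists_integral_isBigO {f : ℝ → ℂ} (hf : Continuous f) {a : ℝ} (ha : 0 < a)
    (hO : f =O[atTop] fun t : ℝ => Real.exp (-a * t)) :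
    ∃ c : ℂ, (fun t : ℝ => (∫ s in (0 : ℝ)..t, f s) - c) =O[atTop]
      fun t : ℝ => Real.exp (-a * t) := by
  have hint : MeasureTheory.IntegrableOn f (Set.Ioi 0) := by
    have h := integrable_of_isBigO_exp_neg ha (a := 0) hf.norm.continuousOn hO.norm_left
    exact (MeasureTheory.integrable_norm_iff hf.aestronglyMeasurable).1 h
  refine ⟨∫ s in Set.Ioi 0, f s, ?_⟩
  obtain ⟨C, hC⟩ := hO.bound
  obtain ⟨t₀, ht₀⟩ := eventually_atTop.1 hC
  refine IsBigO.of_bound (C / a) ?_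
  filter_upwards [eventually_ge_atTop (max t₀ 0)] with t ht
  have ht1 : 0 ≤ t := (le_max_right _ _).trans ht
  have hi := intervalIntegral.integral_Ioi_sub_Ioi hint ht1
  rw [← hi, sub_sub_cancel_left, norm_neg, Real.norm_eq_abs, Real.abs_exp]
  have hE : MeasureTheory.IntegrableOn (fun s => C * Real.exp (-a * s)) (Set.Ioi t) :=
    (integrableOn_exp_mul_Ioi (by linarith) t).const_mul C
  refine (MeasureTheory.norm_integral_le_of_norm_le hE ?_).trans ?_
  · rw [MeasureTheory.ae_restrict_iff' measurableSet_Ioi]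
    refine Eventually.of_forall fun s hs => ?_
    have := ht₀ s (((le_max_left _ _).trans ht).trans (le_of_lt hs))
    rwa [Real.norm_eq_abs, Real.abs_exp] at this
  · rw [MeasureTheory.integral_const_mul, integral_exp_mul_Ioi (by linarith)]
    apply le_of_eq; field_simp

namespace HasExpansion

variable {ω : ℝ} {n n' : ℤ} {f g : ℝ → ℂ}

/-- The expansion is integrated term by term. The remainder is exponentially small, so its integral
converges, and the limit is contained in the constant c. -/
theorem exists_integral (hf : HasExpansion ω n f) {K : ℤ} (hK : K < 0) :
    ∃ G ∈ expoSpan ω n, ∃ c : ℂ, (fun t : ℝ => (∫ s in (0 : ℝ)..t, f s) - G t - c) =O[atTop]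
      fun t : ℝ => Real.exp (2 * K * t) := by
  obtain ⟨g, hg, hO⟩ := hf.expansion K
  obtain ⟨G, hG, hd⟩ := exists_primitive_of_mem_expoSpan hg
  have hgc := continuous_of_mem_expoSpan hg
  have hK' : 0 < -(2 * K : ℝ) := by
    have : (K : ℝ) < 0 := by exact_mod_cast hK
    linarith
  obtain ⟨c, hc⟩ := exists_integral_isBigO (f := fun t => f t - g t)
    (hf.continuous.sub hgc) hK' (by simpa only [neg_neg] using hO)
  refine ⟨G, hG, c - G 0, ?_⟩
  simp only [neg_neg] at hc
  refine hc.congr_left fun t => ?_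
  rw [intervalIntegral.integral_sub (hf.continuous.intervalIntegrable _ _)
    (hgc.intervalIntegrable _ _), intervalIntegral.integral_eq_sub_of_hasDerivAt
    (fun s _ => hd s) (hgc.intervalIntegrable _ _)]
  ring

theorem continuous_integral (hf : Continuous f) : Continuous fun t : ℝ => ∫ s in (0 : ℝ)..t, f s :=
  intervalIntegral.continuous_primitive (fun a b => hf.intervalIntegrable a b) 0

theorem const (c : ℂ) : HasExpansion ω 0 fun _ => c := by
  have h : (fun _ => c : ℝ → ℂ) = c • expoPow ω 0 0 0 := by ext t; simp [expoPow]
  rw [h]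
  exact of_mem (Submodule.smul_mem _ _ (expoPow_mem _ _ le_rfl))

theorem integral (hf : HasExpansion ω n f) (hn : 0 ≤ n) :
    HasExpansion ω n fun t : ℝ => ∫ s in (0 : ℝ)..t, f s := by
  refine ⟨continuous_integral hf.continuous, fun K => ?_⟩
  -- The order is lowered below zero, as convergence of the integral of the remainder requires.
  obtain ⟨G, hG, c, hO⟩ := hf.exists_integral (K := min K (-1)) (by omega)
  have hc : (fun _ => c : ℝ → ℂ) ∈ expoSpan ω n := by
    have h : (fun _ => c : ℝ → ℂ) = c • expoPow ω 0 0 0 := by ext t; simp [expoPow]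
    rw [h]
    exact Submodule.smul_mem _ _ (expoPow_mem _ _ hn)
  refine ⟨G + fun _ => c, Submodule.add_mem _ hG hc, ?_⟩
  have hle : ((min K (-1) : ℤ) : ℝ) ≤ K := by exact_mod_cast min_le_left _ _
  refine (hO.trans (exp_isBigO_exp (by linarith))).congr_left fun t => ?_
  simp only [Pi.add_apply]; ring

/-- Subtracting the limit removes the constant of integration, so a decaying order survives
integration. This isolates the coefficient of the growing solution in `hasExpansion_linSol_sub`. -/
theorem integral_sub (hf : HasExpansion ω n f) (hn : n < 0) {c : ℂ}
    (hc : Tendsto (fun t : ℝ => ∫ s in (0 : ℝ)..t, f s) atTop (𝓝 c)) :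
    HasExpansion ω n fun t : ℝ => (∫ s in (0 : ℝ)..t, f s) - c := by
  refine ⟨(continuous_integral hf.continuous).sub continuous_const, fun K => ?_⟩
  obtain ⟨G, hG, c', hO⟩ := hf.exists_integral (K := min K (-1)) (by omega)
  have hle : ((min K (-1) : ℤ) : ℝ) ≤ K := by exact_mod_cast min_le_left _ _
  have hle' : ((min K (-1) : ℤ) : ℝ) ≤ -1 := by exact_mod_cast min_le_right _ _
  have hn' : (n : ℝ) ≤ -1 := by
    have : n ≤ -1 := by omega
    exact_mod_cast this
  have hexp : ∀ a : ℝ, a < 0 → Tendsto (fun t : ℝ => Real.exp (a * t)) atTop (𝓝 0) := fun a ha =>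
    Real.tendsto_exp_atBot.comp (tendsto_id.const_mul_atTop_of_neg ha)
  have h1 := hO.trans_tendsto (hexp _ (by linarith))
  have h2 := (isBigO_of_mem_expoSpan hG).trans_tendsto (hexp _ (by linarith))
  have h3 := (h1.add h2).add_const c'
  -- For n < 0 the exponential terms tend to zero, so the constant of every expansion is the limit
  -- of the integral, whatever K is.
  have h4 : c = c' := by
    refine tendsto_nhds_unique hc ?_
    refine (h3.congr fun t => ?_).trans (by simp)
    ring
  refine ⟨G, hG, ?_⟩
  rw [h4]
  refine (hO.trans (exp_isBigO_exp (by linarith))).congr_left fun t => ?_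
  ring

end HasExpansion

theorem hasExpansion_exp (ω : ℝ) (κ : ℤ) :
    HasExpansion ω κ fun t : ℝ => ((Real.exp (2 * κ * t) : ℝ) : ℂ) := by
  have h : (fun t : ℝ => ((Real.exp (2 * κ * t) : ℝ) : ℂ)) = expoPow ω κ 0 0 := by
    ext t; simp [expoPow]
  rw [h]
  exact HasExpansion.of_mem (expoPow_mem _ _ le_rfl)

theorem hasExpansion_id (ω : ℝ) : HasExpansion ω 0 fun t : ℝ => (t : ℂ) := by
  have h : (fun t : ℝ => (t : ℂ)) = expoPow ω 0 1 0 := by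
    ext t; simp [expoPow]
  rw [h]
  exact HasExpansion.of_mem (expoPow_mem _ _ le_rfl)

theorem hasExpansion_cos (ω Φ : ℝ) :
    HasExpansion ω 0 fun t : ℝ => ((Real.cos (ω * t + Φ) : ℝ) : ℂ) := by
  have h : (fun t : ℝ => ((Real.cos (ω * t + Φ) : ℝ) : ℂ))
      = (Complex.exp (Φ * Complex.I) / 2) • expoPow ω 0 0 1
        + (Complex.exp (-(Φ * Complex.I)) / 2) • expoPow ω 0 0 (-1) := by
    ext t
    simp only [expoPow, Pi.add_apply, Pi.smul_apply, smul_eq_mul, Complex.ofReal_cos, Complex.cos]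
    push_cast
    simp only [pow_zero, one_mul, mul_zero, zero_add]
    rw [div_mul_eq_mul_div, div_mul_eq_mul_div, ← Complex.exp_add, ← Complex.exp_add, ← add_div]
    congr 2
    · congr 1; ring_nf
    · congr 1; ring_nf
  rw [h]
  exact HasExpansion.of_mem (Submodule.add_mem _
    (Submodule.smul_mem _ _ (expoPow_mem _ _ le_rfl))
    (Submodule.smul_mem _ _ (expoPow_mem _ _ le_rfl)))

/-- This is the geometric series in e^{-2t}. The functions tanh, `sechSq` and `growing` are
polynomials in the logistic function, t and e^{±2t}, so their expansions follow algebraically. -/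
theorem hasExpansion_logistic (ω : ℝ) :
    HasExpansion ω 0 fun t : ℝ => ((1 / (1 + Real.exp (-2 * t)) : ℝ) : ℂ) := by
  have hne : ∀ t : ℝ, 1 + Real.exp (-2 * t) ≠ 0 := fun t => by positivity
  refine ⟨Complex.continuous_ofReal.comp (continuous_const.div (by fun_prop) hne), fun K => ?_⟩
  -- For t ≥ 0 the error e^{-2|K|t} is at most e^{2Kt} for either sign of K.
  refine ⟨∑ j ∈ range K.natAbs, ((-1 : ℂ) ^ j) • expoPow ω (-(j : ℤ)) 0 0,
    Submodule.sum_mem _ fun j _ => Submodule.smul_mem _ _ (expoPow_mem _ _ (by omega)), ?_⟩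
  refine IsBigO.of_bound 1 ?_
  filter_upwards [eventually_ge_atTop 0] with t ht
  set q := Real.exp (-2 * t) with hq
  have hq0 : 0 < q := Real.exp_pos _
  have h1 : ((1 / (1 + q) : ℝ) : ℂ)
      - (∑ j ∈ range K.natAbs, ((-1 : ℂ) ^ j) • expoPow ω (-(j : ℤ)) 0 0) t
      = (((-q) ^ K.natAbs / (1 + q) : ℝ) : ℂ) := by
    have h2 : (∑ j ∈ range K.natAbs, ((-1 : ℂ) ^ j) • expoPow ω (-(j : ℤ)) 0 0) t
        = ((∑ j ∈ range K.natAbs, (-q) ^ j : ℝ) : ℂ) := by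
      rw [Finset.sum_apply]
      rw [hq]
      push_cast
      refine sum_congr rfl fun j _ => ?_
      rw [neg_pow (Complex.exp _), Pi.smul_apply, smul_eq_mul, ← Complex.exp_nat_mul]
      simp only [expoPow]
      push_cast
      congr 1
      rw [pow_zero, one_mul]
      congr 1; ring
    rw [h2, ← Complex.ofReal_sub, geom_sum_eq (by linarith)]
    congr 1
    have : -q - 1 ≠ 0 := by linarith
    have : 1 + q ≠ 0 := by linarith
    field_simp
    ring
  rw [h1, Complex.norm_real, Real.norm_eq_abs, abs_div, abs_pow, abs_neg, abs_of_pos hq0,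
    abs_of_pos (by linarith), Real.norm_eq_abs, Real.abs_exp, one_mul]
  refine (div_le_self (by positivity) (by linarith)).trans ?_
  rw [hq, ← Real.exp_nat_mul]
  refine Real.exp_le_exp.2 ?_
  have : -(K.natAbs : ℝ) ≤ K := by
    have : -(K.natAbs : ℤ) ≤ K := by omega
    exact_mod_cast this
  nlinarith

theorem HasExpansion.congr {ω : ℝ} {n : ℤ} {f g : ℝ → ℂ} (hf : HasExpansion ω n f)
    (h : ∀ t, g t = f t) : HasExpansion ω n g := by
  rwa [show g = f from funext h]

theorem exp_mul_exp_neg_two (t : ℝ) : Real.exp (2 * t) * Real.exp (-2 * t) = 1 := by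
  rw [← Real.exp_add]; simp

theorem sechSq_eq_logistic (t : ℝ) :
    sechSq t = 4 * Real.exp (-2 * t) * (1 / (1 + Real.exp (-2 * t))) ^ 2 := by
  have h := exp_mul_exp_neg_two t
  have h1 : Real.exp t * Real.exp (-t) = 1 := by rw [← Real.exp_add]; simp
  have h2 : Real.exp (-2 * t) = Real.exp (-t) * Real.exp (-t) := by rw [← Real.exp_add]; ring_nf
  rw [sechSq, Real.cosh_eq, h2]
  have hp := Real.exp_pos t
  have hm := Real.exp_pos (-t)
  have hx : Real.exp t = 1 / Real.exp (-t) := by field_simp; exact h1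
  rw [hx]
  field_simp
  ring

theorem tanh_eq_logistic (t : ℝ) :
    Real.tanh t = 2 * (1 / (1 + Real.exp (-2 * t))) - 1 := by
  have h1 : Real.exp t * Real.exp (-t) = 1 := by rw [← Real.exp_add]; simp
  have h2 : Real.exp (-2 * t) = Real.exp (-t) * Real.exp (-t) := by rw [← Real.exp_add]; ring_nf
  have hp := Real.exp_pos t
  have hm := Real.exp_pos (-t)
  have hx : Real.exp t = 1 / Real.exp (-t) := by field_simp; exact h1
  rw [Real.tanh_eq_sinh_div_cosh, Real.cosh_eq, Real.sinh_eq, h2, hx]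
  field_simp
  ring

theorem hasExpansion_tanh (ω : ℝ) : HasExpansion ω 0 fun t : ℝ => ((Real.tanh t : ℝ) : ℂ) := by
  refine (((hasExpansion_logistic ω).const_mul 2).sub (HasExpansion.const 1)).congr fun t => ?_
  rw [tanh_eq_logistic]; push_cast; ring

theorem hasExpansion_sechSq (ω : ℝ) : HasExpansion ω (-1) fun t : ℝ => ((sechSq t : ℝ) : ℂ) := by
  have h := ((hasExpansion_exp ω (-1)).const_mul 4).mul
    ((hasExpansion_logistic ω).mul (hasExpansion_logistic ω))
  refine h.congr fun t => ?_
  rw [sechSq_eq_logistic]; push_cast; ring_nf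

/-- The leading coefficient 4 is needed explicitly: it makes `sechSq` the solution with A = 1. -/
theorem hasExpansion_sechSq_sub (ω : ℝ) :
    HasExpansion ω (-2) fun t : ℝ => ((sechSq t - 4 * Real.exp (-2 * t) : ℝ) : ℂ) := by
  have hR := hasExpansion_logistic ω
  have hq := hasExpansion_exp ω (-1)
  have h := (hq.mul hq).mul (((hR.mul hR).const_mul (-4)).mul
    ((HasExpansion.const 2).add (hq.mono (n' := 0) (by norm_num))))
  refine h.congr fun t => ?_
  have hc : (1 + Real.exp (-2 * t)) ≠ 0 := by positivity
  rw [sechSq_eq_logistic]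
  rw [← Complex.ofReal_mul, ← Complex.ofReal_mul]
  rw [show (2 : ℂ) = ((2 : ℝ) : ℂ) by norm_num, show (-4 : ℂ) = ((-4 : ℝ) : ℂ) by norm_num,
    ← Complex.ofReal_add, ← Complex.ofReal_mul, ← Complex.ofReal_mul, ← Complex.ofReal_mul]
  congr 1
  push_cast
  rw [show (2 * -1 * t) = -2 * t by ring]
  field_simp
  ring

theorem growing_eq_logistic (t : ℝ) :
    growing t = (1 / 16 * Real.exp (2 * t) + 1 / 2 + 3 / 2 * (t * Real.exp (-2 * t))
      - 1 / 2 * (Real.exp (-2 * t) * Real.exp (-2 * t))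
      - 1 / 16 * (Real.exp (-2 * t) * Real.exp (-2 * t) * Real.exp (-2 * t)))
      * (1 / (1 + Real.exp (-2 * t))) ^ 2 := by
  have h := exp_mul_exp_neg_two t
  have h4 : Real.exp (4 * t) = Real.exp (2 * t) * Real.exp (2 * t) := by
    rw [← Real.exp_add]; ring_nf
  have h4' : Real.exp (-(4 * t)) = Real.exp (-2 * t) * Real.exp (-2 * t) := by
    rw [← Real.exp_add]; ring_nf
  have h2' : Real.exp (-(2 * t)) = Real.exp (-2 * t) := by ring_nf
  have hg : growing t = (Real.sinh (4 * t) / 32 + Real.sinh (2 * t) / 4 + 3 * t / 8) * sechSq t := by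
    simp only [growing, sechSq]
  rw [hg, sechSq_eq_logistic, Real.sinh_eq, Real.sinh_eq, h4, h4', h2']
  set q := Real.exp (-2 * t)
  set p := Real.exp (2 * t)
  linear_combination ((1 / 16 * p + 1 / 2) * (1 / (1 + q)) ^ 2) * h

/-- What remains has order zero and cannot contribute to e^{2t}; the factor 1/16 makes `growing` the
solution with B = 1. -/
theorem hasExpansion_growing_sub (ω : ℝ) :
    HasExpansion ω 0 fun t : ℝ => ((growing t - Real.exp (2 * t) / 16 : ℝ) : ℂ) := by
  have hR := hasExpansion_logistic ω
  have hq := hasExpansion_exp ω (-1)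
  have hq0 := hq.mono (n' := 0) (by norm_num)
  have hR2 := hR.mul hR
  have ht := hasExpansion_id ω
  have h1 := hR2.mul (((((HasExpansion.const (ω := ω) (3 / 8)).add
    ((ht.mul hq0).const_mul (3 / 2))).sub ((hq0.mul hq0).const_mul (1 / 2))).sub
    (((hq0.mul hq0).mul hq0).const_mul (1 / 16))).sub (hq0.const_mul (1 / 16)))
  refine h1.congr fun t => ?_
  have hc : (1 + Real.exp (-2 * t)) ≠ 0 := by positivity
  have h := exp_mul_exp_neg_two t
  have e : growing t - Real.exp (2 * t) / 16 = (1 / (1 + Real.exp (-2 * t))) ^ 2 * (3 / 8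
      + 3 / 2 * (t * Real.exp (-2 * t)) - 1 / 2 * (Real.exp (-2 * t) * Real.exp (-2 * t))
      - 1 / 16 * (Real.exp (-2 * t) * Real.exp (-2 * t) * Real.exp (-2 * t))
      - 1 / 16 * Real.exp (-2 * t)) := by
    rw [growing_eq_logistic]
    set q := Real.exp (-2 * t)
    set p := Real.exp (2 * t)
    field_simp
    linear_combination (-(16 * (q + 2))) * h
  rw [e]
  push_cast
  ring_nf

theorem hasExpansion_growing (ω : ℝ) : HasExpansion ω 1 fun t : ℝ => ((growing t : ℝ) : ℂ) := by
  have h := ((hasExpansion_growing_sub ω).mono (n' := 1) (by norm_num)).add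
    ((hasExpansion_exp ω 1).const_mul (1 / 16))
  refine h.congr fun t => ?_
  push_cast; ring_nf

/-- The factors `sechSq` and `growing` inside and outside the integrals have orders -1 and 1, so the
order n is kept. For n ≥ 1 both integrands have nonnegative order, and constants of integration do
no harm. -/
theorem hasExpansion_linSol {ω : ℝ} {n : ℤ} {g : ℝ → ℝ} (hn : 1 ≤ n)
    (hg : HasExpansion ω n fun t => (g t : ℂ)) :
    HasExpansion ω n fun t => ((linSol g 0 0 t : ℝ) : ℂ) := by
  have h1 := ((hasExpansion_sechSq ω).mul hg).integral (by omega)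
  have h2 := ((hasExpansion_growing ω).mul hg).integral (by omega)
  have h3 := ((hasExpansion_growing ω).mul h1).sub
    (((hasExpansion_sechSq ω).mul h2).mono (n' := 1 + (-1 + n)) (by omega))
  rw [show 1 + (-1 + n) = n by ring] at h3
  refine h3.congr fun t => ?_
  simp only [← Complex.ofReal_mul, intervalIntegral.integral_ofReal, linSol]
  push_cast
  ring

/-- In the coefficient of `growing` only the tail of the convergent integral is left. It has order
-1 and cancels the growth of `growing`. -/
theorem hasExpansion_linSol_sub {ω : ℝ} {f : ℝ → ℝ} (hfc : Continuous f) (hf1 : ∀ t, |f t| ≤ 1)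
    (hf : HasExpansion ω 0 fun t => (f t : ℂ)) (a b : ℝ) :
    HasExpansion ω 0 fun t => ((linSol f a b t
      - (b + ∫ s in Set.Ioi 0, sechSq s * f s) * growing t : ℝ) : ℂ) := by
  have hlim : Tendsto (fun t : ℝ => ∫ s in (0 : ℝ)..t, (sechSq s : ℂ) * (f s : ℂ)) atTop
      (𝓝 ((∫ s in Set.Ioi 0, sechSq s * f s : ℝ) : ℂ)) := by
    have h := MeasureTheory.intervalIntegral_tendsto_integral_Ioi 0
      (integrableOn_sechSq_mul hfc hf1 0) tendsto_id
    have h' := (Complex.continuous_ofReal.tendsto _).comp h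
    refine h'.congr fun t => ?_
    simp only [← Complex.ofReal_mul, intervalIntegral.integral_ofReal, Function.comp, id]
  have h1 := ((hasExpansion_sechSq ω).mul hf).integral_sub (by norm_num) hlim
  have h2 := ((hasExpansion_growing ω).mul hf).integral (by norm_num)
  have h3 := ((hasExpansion_growing ω).mul h1).add
    ((hasExpansion_sechSq ω).mul ((HasExpansion.const (a : ℂ)).mono (by norm_num) |>.sub h2))
  refine HasExpansion.congr (h3.mono (by norm_num)) fun t => ?_
  simp only [← Complex.ofReal_mul, intervalIntegral.integral_ofReal, linSol]
  push_cast
  ring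

/-! ### Reading off the parameters A and B -/

/-- The finite sums in `HasParamsAtTop`. -/
noncomputable def trigSum (ω : ℝ) (n L : ℕ) (c d : ℤ → ℕ → ℕ → ℝ) (t : ℝ) : ℝ :=
  ∑ κ ∈ Icc (-1 : ℤ) n, Real.exp (2 * κ * t) *
    ∑ l ∈ range (L + 1), t ^ l * ∑ m ∈ range (L + 1),
      (c κ l m * Real.cos (m * ω * t) + d κ l m * Real.sin (m * ω * t))

theorem trigSum_add (ω : ℝ) (n L : ℕ) (c d c' d' : ℤ → ℕ → ℕ → ℝ) (t : ℝ) :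
    trigSum ω n L (c + c') (d + d') t = trigSum ω n L c d t + trigSum ω n L c' d' t := by
  simp only [trigSum, ← sum_add_distrib, ← mul_add]
  refine sum_congr rfl fun κ _ => ?_
  congr 1
  refine sum_congr rfl fun l _ => ?_
  congr 1
  refine sum_congr rfl fun m _ => ?_
  simp only [Pi.add_apply]; ring

theorem trigSum_smul (ω : ℝ) (n L : ℕ) (c d : ℤ → ℕ → ℕ → ℝ) (r t : ℝ) :
    trigSum ω n L (r • c) (r • d) t = r * trigSum ω n L c d t := by
  simp only [trigSum, mul_sum]
  refine sum_congr rfl fun κ _ => sum_congr rfl fun l _ => sum_congr rfl fun m _ => ?_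
  simp only [Pi.smul_apply, smul_eq_mul]; ring

/-- The coefficients with both indices at most `L`, the others being replaced by zero. -/
noncomputable def truncCoeff (L : ℕ) (c : ℤ → ℕ → ℕ → ℝ) (κ : ℤ) (l m : ℕ) : ℝ :=
  if l ≤ L ∧ m ≤ L then c κ l m else 0

/-- Expansions with different ranges of indices can thereby be added over a common range. -/
theorem trigSum_truncCoeff (ω : ℝ) (n : ℕ) {L L' : ℕ} (h : L ≤ L') (c d : ℤ → ℕ → ℕ → ℝ) (t : ℝ) :
    trigSum ω n L' (truncCoeff L c) (truncCoeff L d) t = trigSum ω n L c d t := by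
  simp only [trigSum]
  refine sum_congr rfl fun κ _ => ?_
  congr 1
  have hsub : range (L + 1) ⊆ range (L' + 1) := range_subset_range.2 (by omega)
  symm
  refine sum_subset_zero_on_sdiff hsub (fun l hl => ?_) fun l hl => ?_
  · have hl' : ¬ l ≤ L := by simp at hl; omega
    simp [truncCoeff, hl']
  · have hl' : l ≤ L := by simp at hl; omega
    congr 1
    refine sum_subset_zero_on_sdiff hsub (fun m hm => ?_) fun m hm => ?_
    · have hm' : ¬ m ≤ L := by simp at hm; omega
      simp [truncCoeff, hm']
    · have hm' : m ≤ L := by simp at hm; omega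
      simp [truncCoeff, hm', hl']

theorem trigSum_single (ω : ℝ) {n L : ℕ} {κ : ℤ} {l m : ℕ} (hκ : κ ∈ Icc (-1 : ℤ) n) (hl : l ≤ L)
    (hm : m ≤ L) (x y t : ℝ) :
    trigSum ω n L (Pi.single κ (Pi.single l (Pi.single m x)))
      (Pi.single κ (Pi.single l (Pi.single m y))) t
      = Real.exp (2 * κ * t) * (t ^ l * (x * Real.cos (m * ω * t) + y * Real.sin (m * ω * t))) := by
  rw [trigSum, sum_eq_single_of_mem κ hκ, sum_eq_single_of_mem l (mem_range.2 (by omega)),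
    sum_eq_single_of_mem m (mem_range.2 (by omega))]
  · simp
  · intro m' _ h
    simp [Pi.single_eq_of_ne h]
  · intro l' _ h
    simp [Pi.single_eq_of_ne h]
  · intro κ' _ h
    simp [Pi.single_eq_of_ne h]

namespace HasParamsAtTop

variable {ω : ℝ} {n : ℕ} {V W : ℝ → ℝ} {A B A' B' : ℝ}

theorem add (hV : HasParamsAtTop ω n V A B) (hW : HasParamsAtTop ω n W A' B') :
    HasParamsAtTop ω n (fun t => V t + W t) (A + A') (B + B') := by
  obtain ⟨L, c, d, hA, hB, h⟩ := hV
  obtain ⟨L', c', d', hA', hB', h'⟩ := hW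
  refine ⟨max L L', truncCoeff L c + truncCoeff L' c', truncCoeff L d + truncCoeff L' d', ?_, ?_, ?_⟩
  · simp [truncCoeff, hA, hA']; ring
  · simp [truncCoeff, hB, hB']; ring
  · refine (h.add h').congr_left fun t => ?_
    change V t - trigSum ω n L c d t + (W t - trigSum ω n L' c' d' t) = V t + W t - trigSum ω n _ _ _ t
    rw [trigSum_add, trigSum_truncCoeff ω n (le_max_left _ _),
      trigSum_truncCoeff ω n (le_max_right _ _)]
    ring

theorem const_mul (hV : HasParamsAtTop ω n V A B) (r : ℝ) :
    HasParamsAtTop ω n (fun t => r * V t) (r * A) (r * B) := by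
  obtain ⟨L, c, d, hA, hB, h⟩ := hV
  refine ⟨L, r • c, r • d, ?_, ?_, ?_⟩
  · simp [hA]; ring
  · simp [hB]; ring
  · refine (h.const_mul_left r).congr_left fun t => ?_
    change r * (V t - trigSum ω n L c d t) = r * V t - trigSum ω n _ _ _ t
    rw [trigSum_smul]; ring

theorem congr (hV : HasParamsAtTop ω n V A B) (h : ∀ t, W t = V t) : HasParamsAtTop ω n W A B := by
  rwa [show W = V from funext h]

theorem of_isLittleO (h : V =o[atTop] fun t : ℝ => Real.exp (-2 * t)) :
    HasParamsAtTop ω n V 0 0 := by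
  refine ⟨0, 0, 0, by simp, by simp, ?_⟩
  simpa using h

theorem single {κ : ℤ} (hκ : κ ∈ Icc (-1 : ℤ) n) (l m : ℕ) (x y : ℝ) :
    HasParamsAtTop ω n (fun t => Real.exp (2 * κ * t) *
      (t ^ l * (x * Real.cos (m * ω * t) + y * Real.sin (m * ω * t))))
      ((Pi.single κ (Pi.single l (Pi.single m x)) : ℤ → ℕ → ℕ → ℝ) (-1) 0 0 / 4)
      (16 * (Pi.single κ (Pi.single l (Pi.single m x)) : ℤ → ℕ → ℕ → ℝ) 1 0 0) := by
  refine ⟨max l m, Pi.single κ (Pi.single l (Pi.single m x)),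
    Pi.single κ (Pi.single l (Pi.single m y)), ?_, ?_, ?_⟩
  · ring
  · ring
  · refine (isLittleO_zero _ _).congr_left fun t => ?_
    change (0 : ℝ) = _ - trigSum ω n _ _ _ t
    rw [trigSum_single ω hκ (le_max_left _ _) (le_max_right _ _), sub_self]

end HasParamsAtTop

/-- Adding a multiple of `sechSq` shifts A and leaves B unchanged; every normalization A = 0 is
obtained in this way. -/
theorem hasParamsAtTop_sechSq (ω : ℝ) (n : ℕ) : HasParamsAtTop ω n sechSq 1 0 := by
  have h1 := HasParamsAtTop.single (ω := ω) (n := n) (κ := -1) (by simp) 0 0 4 0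
  have h2 : HasParamsAtTop ω n (fun t => sechSq t - 4 * Real.exp (-2 * t)) 0 0 := by
    refine HasParamsAtTop.of_isLittleO ?_
    have h := (hasExpansion_sechSq_sub ω).isBigO
    have h3 := (Complex.isBigO_ofReal_left.1 h).trans_isLittleO
      (g := fun t : ℝ => Real.exp ((2 * (-2 : ℤ) + 1) * t))
      (k := fun t : ℝ => Real.exp (-2 * t)) ?_
    · exact h3
    · refine Real.isLittleO_exp_comp_exp_comp.2 ?_
      refine tendsto_id.congr fun t => ?_
      simp only [id]; push_cast; ring
  have h := h1.add h2
  norm_num [Pi.single_apply] at h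
  refine h.congr fun t => ?_
  ring

/-- Terms with κ < -1 disappear in the error, and negative frequencies are folded onto |m| by the
parity of cosine and sine. The clause on B records that only e^{2t} contributes to it. -/
theorem exists_hasParamsAtTop_expoPow (ω : ℝ) {n : ℕ} {κ : ℤ} (hκ : κ ≤ n) (l : ℕ) (m : ℤ) :
    (∃ A B, HasParamsAtTop ω n (fun t => (expoPow ω κ l m t).re) A B ∧ (κ ≤ 0 → B = 0)) ∧
    ∃ A B, HasParamsAtTop ω n (fun t => (expoPow ω κ l m t).im) A B ∧ (κ ≤ 0 → B = 0) := by
  have hexp : ∀ t : ℝ, expoPow ω κ l m t = ((t ^ l * Real.exp (2 * κ * t) : ℝ) : ℂ)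
      * (Complex.exp (((m * ω * t : ℝ) : ℂ) * Complex.I)) := by
    intro t
    simp only [expoPow]
    push_cast
    rw [mul_assoc ((t : ℂ) ^ l), ← Complex.exp_add]
    congr 2; ring
  have hre : ∀ t : ℝ, (expoPow ω κ l m t).re = t ^ l * Real.exp (2 * κ * t) * Real.cos (m * ω * t) := by
    intro t
    rw [hexp, Complex.re_ofReal_mul, Complex.exp_ofReal_mul_I_re]
  have him : ∀ t : ℝ, (expoPow ω κ l m t).im = t ^ l * Real.exp (2 * κ * t) * Real.sin (m * ω * t) := by
    intro t
    rw [hexp, Complex.im_ofReal_mul, Complex.exp_ofReal_mul_I_im]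
  by_cases h : -1 ≤ κ
  · have hmem : κ ∈ Icc (-1 : ℤ) n := Finset.mem_Icc.2 ⟨h, hκ⟩
    obtain ⟨s, hs, hsm⟩ : ∃ s : ℝ, (s = 1 ∨ s = -1) ∧ (m : ℝ) = s * (m.natAbs : ℝ) := by
      rcases Int.natAbs_eq m with hm | hm
      · refine ⟨1, Or.inl rfl, ?_⟩
        rw [one_mul, ← Int.cast_natCast, ← hm]
      · refine ⟨-1, Or.inr rfl, ?_⟩
        rw [neg_one_mul, ← Int.cast_natCast, ← Int.cast_neg, ← hm]
    refine ⟨⟨_, _, (HasParamsAtTop.single hmem l m.natAbs 1 0).congr fun t => ?_, ?_⟩,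
      ⟨_, _, (HasParamsAtTop.single hmem l m.natAbs 0 s).congr fun t => ?_, ?_⟩⟩
    · rw [hre, hsm]
      rcases hs with rfl | rfl
      · simp; ring
      · rw [show -1 * (m.natAbs : ℝ) * ω * t = -(m.natAbs * ω * t) by ring, Real.cos_neg]; ring
    · intro h0; rw [Pi.single_eq_of_ne (by omega : (1 : ℤ) ≠ κ)]; simp
    · rw [him, hsm]
      rcases hs with rfl | rfl
      · simp; ring
      · rw [show -1 * (m.natAbs : ℝ) * ω * t = -(m.natAbs * ω * t) by ring, Real.sin_neg]; ring
    · intro h0; rw [Pi.single_eq_of_ne (by omega : (1 : ℤ) ≠ κ)]; simp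
  · have hlit : (fun t : ℝ => t ^ l * Real.exp (2 * κ * t)) =o[atTop]
        fun t : ℝ => Real.exp (-2 * t) := by
      have h1 : (fun t : ℝ => t ^ l) =o[atTop] fun t => Real.exp (1 * t) :=
        isLittleO_pow_exp_pos_mul_atTop l one_pos
      have hκ' : (κ : ℝ) ≤ -2 := by
        have : κ ≤ -2 := by omega
        exact_mod_cast this
      have h2 := h1.mul_isBigO (isBigO_refl (fun t : ℝ => Real.exp (2 * κ * t)) atTop)
      simp only [← Real.exp_add, ← add_mul] at h2
      exact h2.trans_isBigO (exp_isBigO_exp (by linarith))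
    refine ⟨⟨0, 0, HasParamsAtTop.of_isLittleO ?_, fun _ => rfl⟩,
      ⟨0, 0, HasParamsAtTop.of_isLittleO ?_, fun _ => rfl⟩⟩
    · refine IsBigO.trans_isLittleO (IsBigO.of_bound 1 (Eventually.of_forall fun t => ?_)) hlit
      rw [hre, norm_mul, one_mul]
      exact mul_le_of_le_one_right (norm_nonneg _) (Real.abs_cos_le_one _)
    · refine IsBigO.trans_isLittleO (IsBigO.of_bound 1 (Eventually.of_forall fun t => ?_)) hlit
      rw [him, norm_mul, one_mul]
      exact mul_le_of_le_one_right (norm_nonneg _) (Real.abs_sin_le_one _)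

theorem exists_hasParamsAtTop_of_mem {ω : ℝ} {n : ℕ} {k : ℤ} (hk : k ≤ n) {g : ℝ → ℂ}
    (hg : g ∈ expoSpan ω k) :
    (∃ A B, HasParamsAtTop ω n (fun t => (g t).re) A B ∧ (k ≤ 0 → B = 0)) ∧
    ∃ A B, HasParamsAtTop ω n (fun t => (g t).im) A B ∧ (k ≤ 0 → B = 0) := by
  induction hg using Submodule.span_induction with
  | mem f hf =>
    obtain ⟨κ, l, m, hκ, rfl⟩ := hf
    obtain ⟨⟨A, B, h, hB⟩, A', B', h', hB'⟩ := exists_hasParamsAtTop_expoPow ω (hκ.trans hk) l m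
    exact ⟨⟨A, B, h, fun h0 => hB (hκ.trans h0)⟩, A', B', h', fun h0 => hB' (hκ.trans h0)⟩
  | zero =>
    exact ⟨⟨0, 0, HasParamsAtTop.of_isLittleO (by simp), fun _ => rfl⟩,
      0, 0, HasParamsAtTop.of_isLittleO (by simp), fun _ => rfl⟩
  | add f g _ _ hf hg =>
    obtain ⟨⟨A, B, h, hB⟩, A', B', h', hB'⟩ := hf
    obtain ⟨⟨A₂, B₂, h₂, hB₂⟩, A₂', B₂', h₂', hB₂'⟩ := hg
    exact ⟨⟨_, _, h.add h₂, fun h0 => by rw [hB h0, hB₂ h0, add_zero]⟩,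
      _, _, h'.add h₂', fun h0 => by rw [hB' h0, hB₂' h0, add_zero]⟩
  | smul c f _ hf =>
    obtain ⟨⟨A, B, h, hB⟩, A', B', h', hB'⟩ := hf
    refine ⟨⟨_, _, ((h.const_mul c.re).add (h'.const_mul (-c.im))).congr fun t => ?_, fun h0 => ?_⟩,
      _, _, ((h'.const_mul c.re).add (h.const_mul c.im)).congr fun t => ?_, fun h0 => ?_⟩
    · simp [Complex.mul_re]; ring
    · rw [hB h0, hB' h0]; ring
    · simp [Complex.mul_im]
    · rw [hB h0, hB' h0]; ring

theorem HasExpansion.exists_hasParamsAtTop {ω : ℝ} {n : ℕ} {k : ℤ} (hk : k ≤ n) {f : ℝ → ℝ}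
    (hf : HasExpansion ω k fun t => (f t : ℂ)) :
    ∃ A B, HasParamsAtTop ω n f A B ∧ (k ≤ 0 → B = 0) := by
  -- An error O(e^{-4t}) is o(e^{-2t}), as the definition of the parameters demands.
  obtain ⟨g, hg, hO⟩ := hf.expansion (-2)
  obtain ⟨⟨A, B, h, hB⟩, -⟩ := exists_hasParamsAtTop_of_mem hk hg
  have h2 : HasParamsAtTop ω n (fun t => f t - (g t).re) 0 0 := by
    refine HasParamsAtTop.of_isLittleO ?_
    have h1 : (fun t => f t - (g t).re) =O[atTop] fun t : ℝ => Real.exp (2 * (-2 : ℤ) * t) := by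
      refine IsBigO.trans (IsBigO.of_bound 1 (Eventually.of_forall fun t => ?_)) hO
      rw [one_mul, Real.norm_eq_abs]
      have := Complex.abs_re_le_norm ((f t : ℂ) - g t)
      simpa using this
    refine h1.trans_isLittleO (Real.isLittleO_exp_comp_exp_comp.2 ?_)
    refine (tendsto_id.const_mul_atTop two_pos).congr fun t => ?_
    simp only [id]; push_cast; ring
  refine ⟨A + 0, B + 0, (h.add h2).congr fun t => ?_, fun h0 => by rw [hB h0, add_zero]⟩
  ring

/-- A solution of the first linearized equation has the growing coefficient `b + ∫₀^∞ f/cosh²`. -/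
theorem exists_hasParamsAtTop_linSol {ω : ℝ} {f : ℝ → ℝ} (hfc : Continuous f)
    (hf1 : ∀ t, |f t| ≤ 1) (hf : HasExpansion ω 0 fun t => (f t : ℂ)) (a b : ℝ) :
    ∃ A, HasParamsAtTop ω 1 (linSol f a b) A (b + ∫ s in Set.Ioi 0, sechSq s * f s) := by
  obtain ⟨A, B, h, hB⟩ := (hasExpansion_linSol_sub hfc hf1 hf a b).exists_hasParamsAtTop
    (n := 1) (by norm_num)
  obtain ⟨A', B', h', hB'⟩ := (hasExpansion_growing_sub ω).exists_hasParamsAtTop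
    (n := 1) (by norm_num)
  have h1 := HasParamsAtTop.single (ω := ω) (n := 1) (κ := 1) (by simp) 0 0 (1 / 16) 0
  rw [hB le_rfl] at h
  rw [hB' le_rfl] at h'
  have h2 := h.add ((h'.add h1).const_mul (b + ∫ s in Set.Ioi 0, sechSq s * f s))
  norm_num [Pi.single_apply] at h2
  refine ⟨_, h2.congr fun t => ?_⟩
  ring

/-! ### Expansions at the bottom and normalization of the decaying parameter -/

/-- An expansion to all orders as `t → -∞`. -/
def HasBotExpansion (ω : ℝ) (n : ℤ) (f : ℝ → ℝ) : Prop :=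
  HasExpansion ω n fun t => ((f (-t) : ℝ) : ℂ)

namespace HasBotExpansion

variable {ω : ℝ} {n n' : ℤ} {f g : ℝ → ℝ}

theorem continuous (hf : HasBotExpansion ω n f) : Continuous f := by
  have h := Complex.continuous_re.comp (HasExpansion.continuous hf |>.comp continuous_neg)
  refine h.congr fun t => ?_
  simp

theorem zero : HasBotExpansion ω n 0 :=
  (HasExpansion.of_mem (Submodule.zero_mem _)).congr fun t => by simp

theorem add (hf : HasBotExpansion ω n f) (hg : HasBotExpansion ω n g) :
    HasBotExpansion ω n (f + g) :=
  (HasExpansion.add hf hg).congr fun t => by simp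

theorem mul (hf : HasBotExpansion ω n f) (hg : HasBotExpansion ω n' g) :
    HasBotExpansion ω (n + n') (f * g) :=
  (HasExpansion.mul hf hg).congr fun t => by simp

theorem sum {ι : Type*} {s : Finset ι} {f : ι → ℝ → ℝ} (h : ∀ i ∈ s, HasBotExpansion ω n (f i)) :
    HasBotExpansion ω n (∑ i ∈ s, f i) := by
  classical
  induction s using Finset.induction_on with
  | empty => simpa using zero
  | insert i s hi ih =>
    rw [sum_insert hi]
    exact (h i (mem_insert_self _ _)).add (ih fun j hj => h j (mem_insert_of_mem hj))

theorem mono (hf : HasBotExpansion ω n f) (h : n ≤ n') : HasBotExpansion ω n' f :=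
  HasExpansion.mono hf h

theorem tanh (s : ℝ) : HasBotExpansion ω 0 fun t => s * Real.tanh t :=
  ((hasExpansion_tanh ω).const_mul (-s)).congr fun t => by
    simp only [Real.tanh_neg]; push_cast; ring

theorem cos (Φ : ℝ) : HasBotExpansion ω 0 fun t => Real.cos (ω * t + Φ) :=
  (hasExpansion_cos ω (-Φ)).congr fun t => by
    simp only [show ω * -t + Φ = -(ω * t + -Φ) by ring, Real.cos_neg]

theorem linSol (hn : 1 ≤ n) (hf : HasBotExpansion ω n f) (a b : ℝ) :
    HasBotExpansion ω n (linSol f a b) := by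
  have h1 := hasExpansion_linSol (g := fun t => f (-t)) hn hf
  have h2 := (h1.add (((hasExpansion_sechSq ω).const_mul a).mono (by omega))).sub
    (((hasExpansion_growing ω).const_mul b).mono hn)
  refine h2.congr fun t => ?_
  rw [linSol_eq, linSol_reflect, growing_neg, sechSq_neg]
  push_cast; ring

end HasBotExpansion

theorem HasParamsAtTop.sum_zero {ω : ℝ} {n : ℕ} {ι : Type*} (s : Finset ι) {V : ι → ℝ → ℝ}
    (h : ∀ i ∈ s, ∃ B, HasParamsAtTop ω n (V i) 0 B) :
    ∃ B, HasParamsAtTop ω n (fun t => ∑ i ∈ s, V i t) 0 B := by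
  classical
  induction s using Finset.induction_on with
  | empty => exact ⟨0, by simpa using HasParamsAtTop.of_isLittleO (isLittleO_zero _ _)⟩
  | insert i s hi ih =>
    obtain ⟨B, hB⟩ := h i (mem_insert_self _ _)
    obtain ⟨B', hB'⟩ := ih fun j hj => h j (mem_insert_of_mem hj)
    exact ⟨B + B', by simpa [sum_insert hi] using hB.add hB'⟩

/-- The value at `0` that makes the decaying parameter at the bottom of `linSol g a 0` vanish. -/
noncomputable def botNormalizer (ω : ℝ) (n : ℕ) (g : ℝ → ℝ) : ℝ :=
  open Classical in
  -- An admissible A is chosen, without regard to how it depends on g; the default value is not used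
  -- when g has an expansion at the bottom.
  if h : ∃ A B, HasParamsAtTop ω n (fun t => linSol g 0 0 (-t)) A B then -h.choose else 0

theorem exists_hasParamsAtTop_botNormalizer {ω : ℝ} {n : ℕ} (hn : 1 ≤ n) {g : ℝ → ℝ}
    (hg : HasBotExpansion ω n g) :
    ∃ B, HasParamsAtTop ω n (fun t => linSol g (botNormalizer ω n g) 0 (-t)) 0 B := by
  obtain ⟨A, B, h, -⟩ := (HasBotExpansion.linSol (by exact_mod_cast hn) hg 0 0).exists_hasParamsAtTop
    (n := n) (f := fun t => linSol g 0 0 (-t)) le_rfl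
  have hex : ∃ A B, HasParamsAtTop ω n (fun t => linSol g 0 0 (-t)) A B := ⟨A, B, h⟩
  obtain ⟨B', h'⟩ := hex.choose_spec
  have h2 := h'.add ((hasParamsAtTop_sechSq ω n).const_mul (-hex.choose))
  rw [mul_one, add_neg_cancel] at h2
  refine ⟨_, h2.congr fun t => ?_⟩
  rw [linSol_eq, sechSq_neg, botNormalizer, dif_pos hex]; ring

/-- This is the homogeneous solution with unit derivative at 0 and vanishing decaying parameter; it
multiplies U₁'(0) in the first correction. -/
theorem exists_hasParamsAtTop_growing_normalized (ω : ℝ) :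
    ∃ a B, HasParamsAtTop ω 1 (fun t => linSol 0 a 1 (-t)) 0 B := by
  obtain ⟨A, B, h, -⟩ := (hasExpansion_growing ω).exists_hasParamsAtTop (n := 1) (by norm_num)
  have h2 := (h.const_mul (-1)).add ((hasParamsAtTop_sechSq ω 1).const_mul A)
  have e : -1 * A + A * 1 = 0 := by ring
  rw [e] at h2
  refine ⟨A, _, h2.congr fun t => ?_⟩
  simp [linSol, sechSq_neg, growing_neg]; ring

/-! ### Formal series as polynomials in a parameter -/

section SeriesPoly

open Polynomial

variable (ω Φ s α₀ : ℝ) (α : ℕ → (ℝ → ℝ) → ℝ)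

/-- The coefficients of the formal separatrix series with `Uₙ'(0) = 0` for `n ≥ 2`, as
polynomials in `U₁'(0)`. Their values at `t = 0` are prescribed by `α` and `α₀`. -/
noncomputable def seriesPoly (n : ℕ) : Polynomial (ℝ → ℝ) :=
  if n = 0 then Polynomial.C fun t => s * Real.tanh t else
    -- The guard j < n makes the recursion well-founded; `cubeRest` does not depend on the entries
    -- it suppresses up to index n.
    let g : Polynomial (ℝ → ℝ) := 2 * cubeRest (fun j => if _ : j < n then seriesPoly j else 0) n
      + if n = 1 then Polynomial.C fun t => Real.cos (ω * t + Φ) else 0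
    -- Each power of the parameter has its own linear equation and its own normalizing value at 0.
    -- The series thus depends polynomially, hence continuously, on the parameter, although α need
    -- be neither linear nor continuous.
    ∑ j ∈ range (g.natDegree + 1), monomial j (linSol (g.coeff j) (α n (g.coeff j)) 0)
      + if n = 1 then monomial 1 (linSol 0 α₀ 1) else 0
termination_by n

/-- The inhomogeneity of the `n`-th linearized equation as a polynomial in `U₁'(0)`. -/
noncomputable def seriesForcing (n : ℕ) : Polynomial (ℝ → ℝ) :=
  2 * cubeRest (seriesPoly ω Φ s α₀ α) n
    + if n = 1 then Polynomial.C fun t => Real.cos (ω * t + Φ) else 0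

theorem seriesPoly_zero : seriesPoly ω Φ s α₀ α 0 = Polynomial.C fun t => s * Real.tanh t := by
  rw [seriesPoly, if_pos rfl]

theorem seriesPoly_of_ne {n : ℕ} (hn : n ≠ 0) : seriesPoly ω Φ s α₀ α n =
    ∑ j ∈ range ((seriesForcing ω Φ s α₀ α n).natDegree + 1),
      monomial j (linSol ((seriesForcing ω Φ s α₀ α n).coeff j)
        (α n ((seriesForcing ω Φ s α₀ α n).coeff j)) 0)
      + if n = 1 then monomial 1 (linSol 0 α₀ 1) else 0 := by
  have h : cubeRest (fun j => if _ : j < n then seriesPoly ω Φ s α₀ α j else 0) n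
      = cubeRest (seriesPoly ω Φ s α₀ α) n := cubeRest_congr fun j hj => by simp [hj]
  rw [seriesPoly, if_neg hn]
  simp only [h]
  rfl

theorem hasBotExpansion_coeff_mul {a b : ℤ} {p q : Polynomial (ℝ → ℝ)}
    (hp : ∀ j, HasBotExpansion ω a (p.coeff j)) (hq : ∀ j, HasBotExpansion ω b (q.coeff j)) (j : ℕ) :
    HasBotExpansion ω (a + b) ((p * q).coeff j) := by
  rw [coeff_mul]
  exact HasBotExpansion.sum fun i _ => (hp _).mul (hq _)

/-- Orders add in products just as the indices of the coefficients do, so the hierarchy preserves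
the bound κ ≤ n. -/
theorem hasBotExpansion_cubeRest {a : ℕ → Polynomial (ℝ → ℝ)} {n : ℕ}
    (h : ∀ i < n, ∀ j, HasBotExpansion ω i ((a i).coeff j)) (j : ℕ) :
    HasBotExpansion ω n ((cubeRest a n).coeff j) := by
  have h' : ∀ i ≤ n, ∀ j, HasBotExpansion ω i ((Function.update a n 0 i).coeff j) := by
    intro i hi j
    rcases hi.eq_or_lt with rfl | hi
    · simpa using HasBotExpansion.zero
    · rw [Function.update_of_ne hi.ne]; exact h i hi j
  rw [cubeRest, cubeCoeff, finsetSum_coeff]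
  refine HasBotExpansion.sum fun p hp => ?_
  rw [finsetSum_coeff]
  refine HasBotExpansion.sum fun q hq => ?_
  rw [HasAntidiagonal.mem_antidiagonal] at hp hq
  have e : (n : ℤ) = (p.1 : ℤ) + q.1 + q.2 := by omega
  rw [e]
  exact hasBotExpansion_coeff_mul ω (hasBotExpansion_coeff_mul ω (h' _ (by omega))
    (h' _ (by omega))) (h' _ (by omega)) j

theorem hasBotExpansion_seriesForcing_aux {n : ℕ}
    (h : ∀ i < n, ∀ j, HasBotExpansion ω i ((seriesPoly ω Φ s α₀ α i).coeff j)) (j : ℕ) :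
    HasBotExpansion ω n ((seriesForcing ω Φ s α₀ α n).coeff j) := by
  have h1 := hasBotExpansion_cubeRest ω h j
  rw [seriesForcing, two_mul, coeff_add, coeff_add]
  refine (h1.add h1).add ?_
  split_ifs with h1
  · rw [coeff_C]
    split_ifs
    · exact (HasBotExpansion.cos Φ).mono (by omega)
    · exact HasBotExpansion.zero
  · simpa using HasBotExpansion.zero

theorem hasBotExpansion_seriesPoly (n j : ℕ) :
    HasBotExpansion ω n ((seriesPoly ω Φ s α₀ α n).coeff j) := by
  induction n using Nat.strong_induction_on generalizing j with
  | _ n ih =>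
    rcases eq_or_ne n 0 with rfl | hn
    · rw [seriesPoly_zero, coeff_C]
      split_ifs
      · exact HasBotExpansion.tanh s
      · exact HasBotExpansion.zero
    · have hf := hasBotExpansion_seriesForcing_aux ω Φ s α₀ α ih
      rw [seriesPoly_of_ne ω Φ s α₀ α hn, coeff_add, finsetSum_coeff]
      refine (HasBotExpansion.sum fun i _ => ?_).add ?_
      · rw [coeff_monomial]
        split_ifs
        · exact (hf i).linSol (by omega) _ _
        · exact HasBotExpansion.zero
      · split_ifs with h1
        · rw [coeff_monomial]
          split_ifs
          · exact HasBotExpansion.zero.linSol (by omega) _ _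
          · exact HasBotExpansion.zero
        · simpa using HasBotExpansion.zero

theorem hasBotExpansion_seriesForcing (n j : ℕ) :
    HasBotExpansion ω n ((seriesForcing ω Φ s α₀ α n).coeff j) :=
  hasBotExpansion_seriesForcing_aux ω Φ s α₀ α
    (fun i _ => hasBotExpansion_seriesPoly ω Φ s α₀ α i) j

/-- Evaluation of a polynomial with function coefficients at a parameter and a point. -/
noncomputable def evalAt (β t : ℝ) : Polynomial (ℝ → ℝ) →+* ℝ :=
  (Pi.evalRingHom (fun _ => ℝ) t).comp (evalRingHom fun _ => β)

theorem evalAt_monomial (β t : ℝ) (j : ℕ) (f : ℝ → ℝ) : evalAt β t (monomial j f) = f t * β ^ j := by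
  simp [evalAt]

theorem evalAt_C (β t : ℝ) (f : ℝ → ℝ) : evalAt β t (Polynomial.C f) = f t := by
  simp [evalAt]

theorem evalAt_eq_sum (β t : ℝ) (p : Polynomial (ℝ → ℝ)) :
    evalAt β t p = ∑ j ∈ range (p.natDegree + 1), p.coeff j t * β ^ j := by
  conv_lhs => rw [p.as_sum_range]
  rw [map_sum]
  exact sum_congr rfl fun j _ => evalAt_monomial β t j _

theorem evalAt_seriesForcing (β t : ℝ) (n : ℕ) : evalAt β t (seriesForcing ω Φ s α₀ α n)
    = 2 * cubeRest (fun j => evalAt β t (seriesPoly ω Φ s α₀ α j)) n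
      + if n = 1 then Real.cos (ω * t + Φ) else 0 := by
  rw [seriesForcing, map_add, map_mul, map_cubeRest, map_ofNat]
  split_ifs <;> simp [evalAt_C]

/-- The formal separatrix series with `U₁'(0) = β`. -/
noncomputable def seriesFun (β : ℝ) (n : ℕ) (t : ℝ) : ℝ := evalAt β t (seriesPoly ω Φ s α₀ α n)

theorem seriesFun_of_ne (β : ℝ) {n : ℕ} (hn : n ≠ 0) (t : ℝ) : seriesFun ω Φ s α₀ α β n t
    = ∑ j ∈ range ((seriesForcing ω Φ s α₀ α n).natDegree + 1),
      linSol ((seriesForcing ω Φ s α₀ α n).coeff j)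
        (α n ((seriesForcing ω Φ s α₀ α n).coeff j)) 0 t * β ^ j
      + if n = 1 then linSol 0 α₀ 1 t * β else 0 := by
  rw [seriesFun, seriesPoly_of_ne ω Φ s α₀ α hn, map_add, map_sum]
  simp only [evalAt_monomial]
  split_ifs
  · rw [evalAt_monomial, pow_one]
  · simp

theorem seriesForcing_one : seriesForcing ω Φ s α₀ α 1
    = Polynomial.C fun t => Real.cos (ω * t + Φ) := by
  rw [seriesForcing, cubeRest_one, if_pos rfl, mul_zero, zero_add]

theorem seriesFun_one (β t : ℝ) : seriesFun ω Φ s α₀ α β 1 t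
    = linSol (fun t => Real.cos (ω * t + Φ))
        (α 1 (fun t => Real.cos (ω * t + Φ)) + α₀ * β) β t := by
  rw [seriesFun_of_ne ω Φ s α₀ α β one_ne_zero, seriesForcing_one, natDegree_C]
  simp only [zero_add, sum_range_one, coeff_C_zero, pow_zero, mul_one, if_true]
  rw [linSol_eq, linSol_eq 0, linSol_eq _ (_ + _)]
  simp [linSol]; ring

/-- The derivative of `seriesFun`. -/
noncomputable def seriesFunDeriv (β : ℝ) (n : ℕ) (t : ℝ) : ℝ :=
  if n = 0 then s * sechSq t else
    ∑ j ∈ range ((seriesForcing ω Φ s α₀ α n).natDegree + 1),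
      linSolDeriv ((seriesForcing ω Φ s α₀ α n).coeff j)
        (α n ((seriesForcing ω Φ s α₀ α n).coeff j)) 0 t * β ^ j
      + if n = 1 then linSolDeriv 0 α₀ 1 t * β else 0

theorem seriesFun_zero (β t : ℝ) : seriesFun ω Φ s α₀ α β 0 t = s * Real.tanh t := by
  rw [seriesFun, seriesPoly_zero, evalAt_C]

theorem hasDerivAt_seriesFun (β : ℝ) (n : ℕ) (t : ℝ) :
    HasDerivAt (seriesFun ω Φ s α₀ α β n) (seriesFunDeriv ω Φ s α₀ α β n t) t := by
  rcases eq_or_ne n 0 with rfl | hn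
  · rw [show seriesFun ω Φ s α₀ α β 0 = fun t => s * Real.tanh t from
      funext (seriesFun_zero ω Φ s α₀ α β), seriesFunDeriv, if_pos rfl]
    exact (hasDerivAt_tanh t).const_mul s
  · rw [show seriesFun ω Φ s α₀ α β n = _ from funext (seriesFun_of_ne ω Φ s α₀ α β hn),
      seriesFunDeriv, if_neg hn]
    refine (HasDerivAt.fun_sum fun j _ => (hasDerivAt_linSol
      (hasBotExpansion_seriesForcing ω Φ s α₀ α n j).continuous _ _ t).mul_const _).add ?_
    split_ifs
    · exact (hasDerivAt_linSol continuous_const _ _ t).mul_const _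
    · exact hasDerivAt_const t 0

theorem hasDerivAt_seriesFunDeriv (β : ℝ) {n : ℕ} (hn : n ≠ 0) (t : ℝ) :
    HasDerivAt (seriesFunDeriv ω Φ s α₀ α β n)
      ((6 * Real.tanh t ^ 2 - 2) * seriesFun ω Φ s α₀ α β n t
        + evalAt β t (seriesForcing ω Φ s α₀ α n)) t := by
  have e : seriesFunDeriv ω Φ s α₀ α β n = fun t =>
      ∑ j ∈ range ((seriesForcing ω Φ s α₀ α n).natDegree + 1),
      linSolDeriv ((seriesForcing ω Φ s α₀ α n).coeff j)
        (α n ((seriesForcing ω Φ s α₀ α n).coeff j)) 0 t * β ^ j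
      + if n = 1 then linSolDeriv 0 α₀ 1 t * β else 0 := by
    ext t; rw [seriesFunDeriv, if_neg hn]
  have h1 : HasDerivAt (fun t : ℝ => if n = 1 then linSolDeriv 0 α₀ 1 t * β else 0)
      (if n = 1 then ((6 * Real.tanh t ^ 2 - 2) * linSol 0 α₀ 1 t + 0) * β else 0) t := by
    split_ifs
    · exact (hasDerivAt_linSolDeriv (g := 0) continuous_const _ _ t).mul_const _
    · exact hasDerivAt_const t 0
  rw [e]
  refine ((HasDerivAt.fun_sum fun j _ => (hasDerivAt_linSolDeriv
      (hasBotExpansion_seriesForcing ω Φ s α₀ α n j).continuous _ _ t).mul_const _).add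
      h1).congr_deriv ?_
  rw [seriesFun_of_ne ω Φ s α₀ α β hn, evalAt_eq_sum, mul_add, mul_sum]
  simp only [add_mul, sum_add_distrib, mul_assoc]
  split_ifs <;> ring

theorem isSeparatrixSeries_seriesFun (hs : s ^ 2 = 1) (β : ℝ) :
    IsSeparatrixSeries ω Φ s (seriesFun ω Φ s α₀ α β) where
  leading t := seriesFun_zero ω Φ s α₀ α β t
  contDiff n := by
    rcases eq_or_ne n 0 with rfl | hn
    · rw [show seriesFun ω Φ s α₀ α β 0 = fun t => s * Real.tanh t from
        funext (seriesFun_zero ω Φ s α₀ α β)]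
      exact contDiff_const.mul contDiff_tanh'
    · refine contDiff_two_of_hasDerivAt (hasDerivAt_seriesFun ω Φ s α₀ α β n)
        (hasDerivAt_seriesFunDeriv ω Φ s α₀ α β hn) ?_
      have h1 : Continuous (seriesFun ω Φ s α₀ α β n) := continuous_iff_continuousAt.2
        fun t => (hasDerivAt_seriesFun ω Φ s α₀ α β n t).continuousAt
      refine (((continuous_tanh'.pow 2).const_mul 6 |>.sub continuous_const).mul h1).add ?_
      rw [show (fun t => evalAt β t (seriesForcing ω Φ s α₀ α n)) = _ from
        funext fun t => evalAt_eq_sum β t _]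
      exact continuous_finsetSum _ fun j _ =>
        (hasBotExpansion_seriesForcing ω Φ s α₀ α n j).continuous.mul continuous_const
  equation n t := by
    rcases eq_or_ne n 0 with rfl | hn
    · rw [show seriesFun ω Φ s α₀ α β 0 = fun t => s * Real.tanh t from
        funext (seriesFun_zero ω Φ s α₀ α β)]
      rw [deriv_deriv_of_hasDerivAt (fun t => (hasDerivAt_tanh t).const_mul s)
        (fun t => (hasDerivAt_sechSq t).const_mul s)]
      simp only [Finset.Nat.antidiagonal_zero, sum_singleton, seriesFun_zero, sechSq_eq]
      rw [if_neg (by norm_num)]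
      linear_combination (-2 * s * Real.tanh t ^ 3) * hs
    · rw [deriv_deriv_of_hasDerivAt (hasDerivAt_seriesFun ω Φ s α₀ α β n)
        (hasDerivAt_seriesFunDeriv ω Φ s α₀ α β hn), evalAt_seriesForcing]
      have h := cubeCoeff_split (fun j => seriesFun ω Φ s α₀ α β j t) hn
      simp only [seriesFun_zero] at h
      change _ - 2 * cubeCoeff (fun j => seriesFun ω Φ s α₀ α β j t) n = _
      rw [h]
      simp only [seriesFun]
      linear_combination (-6 * Real.tanh t ^ 2 * evalAt β t (seriesPoly ω Φ s α₀ α n)) * hs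

theorem deriv_seriesFun_zero (β : ℝ) {n : ℕ} (hn : n ≠ 0) :
    deriv (seriesFun ω Φ s α₀ α β n) 0 = if n = 1 then β else 0 := by
  rw [(hasDerivAt_seriesFun ω Φ s α₀ α β n 0).deriv, seriesFunDeriv, if_neg hn]
  simp [linSolDeriv_zero]

theorem continuous_seriesFun_param (n : ℕ) (t : ℝ) :
    Continuous fun β => seriesFun ω Φ s α₀ α β n t := by
  simp only [seriesFun, evalAt_eq_sum]
  fun_prop

end SeriesPoly

/-- The formal series with vanishing corrections at `t = 0`, except for the prescribed
derivative of the first one. -/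
theorem exists_separatrixSeries_zero_init (ω Φ : ℝ) {s : ℝ} (hs : s ^ 2 = 1) (β : ℝ) :
    ∃ U : ℕ → ℝ → ℝ, IsSeparatrixSeries ω Φ s U ∧ (∀ n, U n 0 = 0) ∧
      (∀ n, n ≠ 0 → deriv (U n) 0 = if n = 1 then β else 0) ∧
      U 1 = linSol (fun t => Real.cos (ω * t + Φ)) 0 β := by
  refine ⟨seriesFun ω Φ s 0 (fun _ _ => 0) β, isSeparatrixSeries_seriesFun ω Φ s 0 _ hs β,
    fun n => ?_, fun n hn => deriv_seriesFun_zero ω Φ s 0 _ β hn, ?_⟩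
  · rcases eq_or_ne n 0 with rfl | hn
    · simp [seriesFun_zero]
    · simp [seriesFun_of_ne ω Φ s 0 (fun _ _ => 0) β hn, linSol_zero]
  · ext t
    rw [seriesFun_one]; simp

/-- The formal series normalized so that the decaying parameters at the bottom vanish. -/
theorem exists_separatrixSeries_normalized (ω Φ : ℝ) :
    ∃ U : ℝ → ℕ → ℝ → ℝ, (∀ β, IsSeparatrixSeries ω Φ 1 (U β)) ∧
      (∀ β n, 1 ≤ n → ∃ B, HasParamsAtBot ω n (U β n) 0 B) ∧
      (∀ β n, n ≠ 0 → deriv (U β n) 0 = if n = 1 then β else 0) ∧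
      (∀ β, ∃ a, U β 1 = linSol (fun t => Real.cos (ω * t + Φ)) a β) ∧
      ∀ n, Continuous fun β => U β n 0 := by
  obtain ⟨a, B₀, ha⟩ := exists_hasParamsAtTop_growing_normalized ω
  refine ⟨seriesFun ω Φ 1 a (botNormalizer ω),
    fun β => isSeparatrixSeries_seriesFun ω Φ 1 a _ (one_pow 2) β, fun β n hn => ?_,
    fun β n hn => deriv_seriesFun_zero ω Φ 1 a _ β hn,
    fun β => ⟨_, funext (seriesFun_one ω Φ 1 a _ β)⟩,
    fun n => continuous_seriesFun_param ω Φ 1 a _ n 0⟩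
  have hn0 : n ≠ 0 := by omega
  -- Every coefficient of the polynomial is normalized separately, and A = 0 is stable under linear
  -- combinations.
  have h1 := HasParamsAtTop.sum_zero (ω := ω) (n := n)
    (range ((seriesForcing ω Φ 1 a (botNormalizer ω) n).natDegree + 1))
    (V := fun j t => linSol ((seriesForcing ω Φ 1 a (botNormalizer ω) n).coeff j)
      (botNormalizer ω n ((seriesForcing ω Φ 1 a (botNormalizer ω) n).coeff j)) 0 (-t) * β ^ j)
    (fun j _ => by
      obtain ⟨B, hB⟩ := exists_hasParamsAtTop_botNormalizer hn
        (hasBotExpansion_seriesForcing ω Φ 1 a (botNormalizer ω) n j)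
      have := hB.const_mul (β ^ j)
      rw [mul_zero] at this
      exact ⟨_, this.congr fun t => mul_comm _ _⟩)
  obtain ⟨B, hB⟩ := h1
  have h2 : ∃ B', HasParamsAtTop ω n (fun t => if n = 1 then linSol 0 a 1 (-t) * β else 0) 0 B' := by
    split_ifs with h
    · subst h
      have := ha.const_mul β
      rw [mul_zero] at this
      exact ⟨_, this.congr fun t => mul_comm _ _⟩
    · exact ⟨0, HasParamsAtTop.of_isLittleO (isLittleO_zero _ _)⟩
  obtain ⟨B', hB'⟩ := h2
  refine ⟨-(B + B'), ?_⟩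
  have h3 := hB.add hB'
  rw [add_zero] at h3
  rw [HasParamsAtBot, neg_neg]
  exact h3.congr fun t => seriesFun_of_ne ω Φ 1 a _ β hn0 (-t)

/-! ### Summation of a formal power series -/

/-- A Borel type summation: the j-th term is kept only for ε small compared with its size, so that
every partial sum is asymptotic to the given order. Only finitely many terms are used for each ε,
which preserves continuity in b. -/
theorem exists_sum_of_formal {a : ℕ → ℝ → ℝ} (ha : ∀ n, Continuous (a n)) (M : ℝ) :
    ∃ S : ℝ → ℝ → ℝ, (∀ ε, Continuous (S ε)) ∧ ∀ n : ℕ, ∃ C, 0 ≤ C ∧ ∃ δ > 0, ∀ ε, 0 < ε → ε ≤ δ →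
      ∀ b, |b| ≤ M → |S ε b - ∑ j ∈ range (n + 1), ε ^ j * a j b| ≤ C * ε ^ (n + 1) := by
  have hbd : ∀ n, ∃ m, 1 ≤ m ∧ ∀ b, |b| ≤ M → |a n b| ≤ m := by
    intro n
    obtain ⟨C, hC⟩ := (isCompact_Icc (a := -M) (b := M)).exists_bound_of_continuousOn
      (ha n).continuousOn
    refine ⟨max C 1, le_max_right _ _, fun b hb => (hC b ?_).trans (le_max_left _ _)⟩
    exact abs_le.1 hb
  choose m hm1 hm using hbd
  -- The cutoff ε m_j ≤ 1/2 switches each term on for small ε, and the number ⌈1/ε⌉ of terms exceeds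
  -- every given order eventually.
  refine ⟨fun ε b => ∑ j ∈ range ⌈1 / ε⌉₊, if ε * m j ≤ 1 / 2 then ε ^ j * a j b else 0,
    fun ε => continuous_finsetSum _ fun j _ => ?_, fun n => ?_⟩
  · split_ifs
    · exact continuous_const.mul (ha j)
    · exact continuous_const
  have hsum : ∀ j ∈ range (n + 2), m j ≤ ∑ i ∈ range (n + 2), m i := fun j hj =>
    single_le_sum (f := m) (fun i _ => (zero_le_one.trans (hm1 i))) hj
  set mtot := ∑ i ∈ range (n + 2), m i with hmtot
  have hmtot1 : 1 ≤ mtot := (hm1 0).trans (hsum 0 (by simp))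
  refine ⟨m (n + 1) + 2, by linarith [hm1 (n + 1)], min (1 / (2 * mtot)) (1 / (n + 2)),
    by positivity, fun ε hε hεδ b hb => ?_⟩
  have h1 : ε ≤ 1 / (2 * mtot) := hεδ.trans (min_le_left _ _)
  have h2 : ε ≤ 1 / (n + 2) := hεδ.trans (min_le_right _ _)
  have hεh : ε ≤ 1 / 2 := h1.trans (by
    apply one_div_le_one_div_of_le <;> linarith)
  have hN : n + 2 ≤ ⌈1 / ε⌉₊ := by
    have : ((n + 2 : ℕ) : ℝ) ≤ 1 / ε := by
      rw [le_div_iff₀ hε]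
      rw [le_div_iff₀ (by positivity)] at h2
      push_cast; linarith
    exact_mod_cast this.trans (Nat.le_ceil _)
  obtain ⟨k, hk⟩ := Nat.exists_eq_add_of_le hN
  have hin : ∀ j ∈ range (n + 2), ε * m j ≤ 1 / 2 := by
    intro j hj
    have : ε * m j ≤ 1 / (2 * mtot) * mtot := mul_le_mul h1 (hsum j hj)
      (zero_le_one.trans (hm1 j)) (by positivity)
    refine this.trans (le_of_eq ?_)
    field_simp
  beta_reduce
  rw [hk, sum_range_add, sum_congr rfl fun j hj => if_pos (hin j hj), sum_range_succ,
    add_assoc, add_sub_cancel_left]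
  -- Of the powers of ε, n + 1 are kept, one is spent on the bound m by the cutoff, and the
  -- remaining i give a geometric series because ε ≤ 1/2.
  have hterm : ∀ i ∈ range k, |if ε * m (n + 2 + i) ≤ 1 / 2 then
      ε ^ (n + 2 + i) * a (n + 2 + i) b else 0| ≤ ε ^ (n + 1) * (1 / 2) ^ i := by
    intro i _
    split_ifs with h
    · rw [abs_mul, abs_pow, abs_of_pos hε, show n + 2 + i = n + 1 + 1 + i by ring, pow_add, pow_add,
        pow_one]
      rw [show n + 1 + 1 + i = n + 2 + i by ring]
      have h3 : ε * |a (n + 2 + i) b| ≤ 1 :=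
        (mul_le_mul_of_nonneg_left (hm _ b hb) hε.le).trans (h.trans (by norm_num))
      have h4 : ε ^ i ≤ (1 / 2) ^ i := pow_le_pow_left₀ hε.le hεh i
      calc ε ^ (n + 1) * ε * ε ^ i * |a (n + 2 + i) b|
          = ε ^ (n + 1) * (ε ^ i * (ε * |a (n + 2 + i) b|)) := by ring
        _ ≤ ε ^ (n + 1) * ((1 / 2) ^ i * 1) := by gcongr
        _ = _ := by rw [mul_one]
    · rw [abs_zero]; positivity
  refine (abs_add_le _ _).trans ?_
  have h5 : |ε ^ (n + 1) * a (n + 1) b| ≤ m (n + 1) * ε ^ (n + 1) := by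
    rw [abs_mul, abs_of_pos (by positivity), mul_comm]
    gcongr
    exact hm _ b hb
  have h6 := (abs_sum_le_sum_abs _ _).trans (sum_le_sum hterm)
  rw [← mul_sum] at h6
  have h7 : ε ^ (n + 1) * ∑ i ∈ range k, (1 / 2 : ℝ) ^ i ≤ ε ^ (n + 1) * 2 := by
    gcongr
    exact sum_geometric_two_le k
  linarith

/-! ### Shooting -/

/-- The points where the cosine is ±1 are half a period π/|ω| apart, so one of them lies within that
distance after p; the next one has the opposite sign. -/
theorem exists_cos_window {ω : ℝ} (hω : ω ≠ 0) (Φ p : ℝ) :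
    ∃ t σ : ℝ, p ≤ t ∧ t ≤ p + Real.pi / |ω| ∧ (σ = 1 ∨ σ = -1) ∧ Real.cos (ω * t + Φ) = σ ∧
      Real.cos (ω * (t + Real.pi / |ω|) + Φ) = -σ := by
  wlog h : 0 < ω generalizing ω Φ
  · have hneg : 0 < -ω := by
      rcases hω.lt_or_gt with h' | h'
      · linarith
      · exact absurd h' h
    obtain ⟨t, σ, h1, h2, h3, h4, h5⟩ := this (ω := -ω) hneg.ne' (-Φ) hneg
    rw [abs_neg] at h2 h5
    refine ⟨t, σ, h1, h2, h3, ?_, ?_⟩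
    · rw [← h4, ← Real.cos_neg]; ring_nf
    · rw [← h5, ← Real.cos_neg]; ring_nf
  rw [abs_of_pos h]
  have hpi := Real.pi_pos
  set m : ℤ := ⌈(ω * p + Φ) / Real.pi⌉ with hm
  have hm1 := Int.le_ceil ((ω * p + Φ) / Real.pi)
  have hm2 := Int.ceil_lt_add_one ((ω * p + Φ) / Real.pi)
  rw [← hm] at hm1 hm2
  rw [div_le_iff₀ hpi] at hm1
  rw [← sub_lt_iff_lt_add, lt_div_iff₀ hpi] at hm2
  refine ⟨(m * Real.pi - Φ) / ω, (-1) ^ m, ?_, ?_, ?_, ?_, ?_⟩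
  · rw [le_div_iff₀ h]; linarith
  · rw [div_le_iff₀ h, add_mul, div_mul_cancel₀ _ hω]; linarith
  · rcases Int.even_or_odd m with he | ho
    · exact Or.inl he.neg_one_zpow
    · exact Or.inr ho.neg_one_zpow
  · rw [mul_div_cancel₀ _ hω, sub_add_cancel, Real.cos_int_mul_pi]
  · rw [mul_add, mul_div_cancel₀ _ hω, mul_div_cancel₀ _ hω,
      show (m : ℝ) * Real.pi - Φ + Real.pi + Φ = m * Real.pi + Real.pi by ring, Real.cos_add_pi,
      Real.cos_int_mul_pi]

/-- The left end is the last point with F ≤ p, the right end the first later point with F ≥ q. -/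
theorem exists_subinterval_of_le {F : ℝ → ℝ} {l r p q : ℝ} (hlr : l ≤ r) (hpq : p < q)
    (hF : ContinuousOn F (Set.Icc l r)) (hl : F l ≤ p) (hr : q ≤ F r) :
    ∃ l' r', l ≤ l' ∧ l' ≤ r' ∧ r' ≤ r ∧ (∀ x ∈ Set.Icc l' r', F x ∈ Set.Icc p q) ∧
      F l' = p ∧ F r' = q := by
  have hcl : IsClosed {x ∈ Set.Icc l r | F x ≤ p} := hF.preimage_isClosed_of_isClosed isClosed_Icc
    isClosed_Iic
  have hbdd : BddAbove {x ∈ Set.Icc l r | F x ≤ p} := ⟨r, fun x hx => hx.1.2⟩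
  have h1 := hcl.csSup_mem ⟨l, ⟨le_rfl, hlr⟩, hl⟩ hbdd
  set l' := sSup {x ∈ Set.Icc l r | F x ≤ p} with hl'
  have hgt : ∀ x ∈ Set.Icc l r, l' < x → p < F x := fun x hx hlx => by
    by_contra hcon
    exact absurd (le_csSup hbdd ⟨hx, not_lt.1 hcon⟩) (not_le.2 hlx)
  have hF' : ContinuousOn F (Set.Icc l' r) := hF.mono (Set.Icc_subset_Icc_left h1.1.1)
  have hFl' : F l' = p := by
    refine le_antisymm h1.2 ?_
    by_contra hcon
    obtain ⟨x, hx, hxF⟩ := intermediate_value_Ioo h1.1.2 hF'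
      (show p ∈ Set.Ioo (F l') (F r) from ⟨not_le.1 hcon, hpq.trans_le hr⟩)
    exact (hgt x ⟨h1.1.1.trans hx.1.le, hx.2.le⟩ hx.1).ne' hxF
  have hcl2 : IsClosed {x ∈ Set.Icc l' r | q ≤ F x} := hF'.preimage_isClosed_of_isClosed isClosed_Icc
    isClosed_Ici
  have hbdd2 : BddBelow {x ∈ Set.Icc l' r | q ≤ F x} := ⟨l', fun x hx => hx.1.1⟩
  have h2 := hcl2.csInf_mem ⟨r, ⟨h1.1.2, le_rfl⟩, hr⟩ hbdd2
  set r' := sInf {x ∈ Set.Icc l' r | q ≤ F x} with hr'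
  have hlt : ∀ x ∈ Set.Icc l' r, x < r' → F x < q := fun x hx hxr => by
    by_contra hcon
    exact absurd (csInf_le hbdd2 ⟨hx, not_lt.1 hcon⟩) (not_le.2 hxr)
  have hFr' : F r' = q := by
    refine le_antisymm ?_ h2.2
    by_contra hcon
    obtain ⟨x, hx, hxF⟩ := intermediate_value_Ioo h2.1.1
      (hF'.mono (Set.Icc_subset_Icc_right h2.1.2))
      (show q ∈ Set.Ioo (F l') (F r') from ⟨hFl' ▸ hpq, not_le.1 hcon⟩)
    exact (hlt x ⟨hx.1.le, hx.2.le.trans h2.1.2⟩ hx.2).ne hxF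
  refine ⟨l', r', h1.1.1, h2.1.1, h2.1.2, fun x hx => ⟨?_, ?_⟩, hFl', hFr'⟩
  · rcases hx.1.eq_or_lt with rfl | h
    · exact hFl'.ge
    · exact (hgt x ⟨h1.1.1.trans hx.1, hx.2.trans h2.1.2⟩ h).le
  · rcases hx.2.eq_or_lt with rfl | h
    · exact hFr'.le
    · exact (hlt x ⟨hx.1, hx.2.trans h2.1.2⟩ h).le

theorem exists_subinterval {F : ℝ → ℝ} {l r p q : ℝ} (hlr : l ≤ r) (hpq : p < q)
    (hF : ContinuousOn F (Set.Icc l r)) (h : (F l ≤ p ∧ q ≤ F r) ∨ (q ≤ F l ∧ F r ≤ p)) :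
    ∃ l' r', l ≤ l' ∧ l' ≤ r' ∧ r' ≤ r ∧ (∀ x ∈ Set.Icc l' r', F x ∈ Set.Icc p q) ∧
      ((F l' = p ∧ F r' = q) ∨ (F l' = q ∧ F r' = p)) := by
  rcases h with h | h
  · obtain ⟨l', r', h1, h2, h3, h4, h5⟩ := exists_subinterval_of_le hlr hpq hF h.1 h.2
    exact ⟨l', r', h1, h2, h3, h4, Or.inl h5⟩
  · obtain ⟨l', r', h1, h2, h3, h4, h5, h6⟩ := exists_subinterval_of_le (F := fun x => -F x)
      (p := -q) (q := -p) hlr (by linarith) hF.neg (by linarith) (by linarith)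
    refine ⟨l', r', h1, h2, h3, fun x hx => ?_, Or.inr ⟨by linarith, by linarith⟩⟩
    have := h4 x hx
    exact ⟨by linarith [this.2], by linarith [this.1]⟩

theorem exists_seq_of_step {X : Type*} {P : ℕ → X → Prop} {R : ℕ → X → X → Prop} {x₀ : X}
    (h0 : P 0 x₀) (hstep : ∀ k x, P k x → ∃ y, P (k + 1) y ∧ R k x y) :
    ∃ x : ℕ → X, x 0 = x₀ ∧ ∀ k, P k (x k) ∧ R k (x k) (x (k + 1)) := by
  choose! g hg using hstep
  let x : ℕ → X := fun k => Nat.rec x₀ g k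
  have hP : ∀ k, P k (x k) := fun k => by
    induction k with
    | zero => exact h0
    | succ k ih => exact (hg k _ ih).1
  exact ⟨x, rfl, fun k => ⟨hP k, (hg k _ (hP k)).2⟩⟩

/-- A parameter for which a quantity `H`, changed at each passage by an amount that takes both
signs as the time of passage varies, stays in a given interval forever. -/
theorem exists_shooting {H : ℝ → ℝ → ℝ} {Adm : ℕ → ℝ → ℝ → Prop} {Next : ℕ → ℝ → ℝ → ℝ → Prop}
    {ω Φ M σ ε cl ch b₀ b₁ : ℝ} (hω : ω ≠ 0) (hb : b₀ ≤ b₁) (hε : 0 < ε) (hcl : 0 < cl)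
    (hlt : cl < ch) (hM : ch + σ ≤ M + cl)
    (hw : 18 + 6 * (Real.pi / |ω|) ≤ Real.log (ch / cl))
    (hH : Continuous (Function.uncurry H))
    (hinit : ∀ b ∈ Set.Icc b₀ b₁, Adm 0 b 0) (hH0 : ch ≤ H b₀ 0) (hH1 : H b₁ 0 ≤ cl)
    (hnext : ∀ k, ∀ b ∈ Set.Icc b₀ b₁, ∀ T, Adm k b T → H b T ∈ Set.Icc cl ch →
      ∃ T', Next k b T T')
    (hspec : ∀ k, ∀ b ∈ Set.Icc b₀ b₁, ∀ T T', Adm k b T → H b T ∈ Set.Icc cl ch →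
      Next k b T T' → Adm (k + 1) b T' ∧
      |2 * (T' - T) - Real.log (1 / (ε * H b T))| ≤ 9 ∧
      |H b T' - (H b T - (-1) ^ (k + 1) * (M * Real.cos (ω * T' + Φ)))| ≤ σ)
    (hcont : ∀ k l r, ∀ T T' : ℝ → ℝ, b₀ ≤ l → r ≤ b₁ → ContinuousOn T (Set.Icc l r) →
      (∀ b ∈ Set.Icc l r, Adm k b (T b) ∧ H b (T b) ∈ Set.Icc cl ch ∧ Next k b (T b) (T' b)) →
      ContinuousOn T' (Set.Icc l r)) :
    ∃ b ∈ Set.Icc b₀ b₁, ∃ T : ℕ → ℝ, T 0 = 0 ∧ ∀ k, Adm k b (T k) ∧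
      H b (T k) ∈ Set.Icc cl ch ∧ Next k b (T k) (T (k + 1)) := by
  set w := Real.pi / |ω| with hwdef
  have hw0 : 0 < w := div_pos Real.pi_pos (abs_pos.2 hω)
  -- The state is a parameter interval with the time of the current zero as a continuous function on
  -- it. It is required that this time varies by at most half a period w and that H takes the values
  -- cl and ch at the two ends.
  let P : ℕ → (ℝ × ℝ × (ℝ → ℝ)) → Prop := fun k x => b₀ ≤ x.1 ∧ x.1 ≤ x.2.1 ∧ x.2.1 ≤ b₁ ∧
    ContinuousOn x.2.2 (Set.Icc x.1 x.2.1) ∧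
    (∀ b ∈ Set.Icc x.1 x.2.1, Adm k b (x.2.2 b) ∧ H b (x.2.2 b) ∈ Set.Icc cl ch) ∧
    (∀ b ∈ Set.Icc x.1 x.2.1, ∀ b' ∈ Set.Icc x.1 x.2.1, x.2.2 b - x.2.2 b' ≤ w) ∧
    ((H x.1 (x.2.2 x.1) = cl ∧ H x.2.1 (x.2.2 x.2.1) = ch) ∨
      (H x.1 (x.2.2 x.1) = ch ∧ H x.2.1 (x.2.2 x.2.1) = cl))
  let R : ℕ → (ℝ × ℝ × (ℝ → ℝ)) → (ℝ × ℝ × (ℝ → ℝ)) → Prop := fun k x y =>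
    x.1 ≤ y.1 ∧ y.2.1 ≤ x.2.1 ∧ ∀ b ∈ Set.Icc y.1 y.2.1, Next k b (x.2.2 b) (y.2.2 b)
  have hHT : ∀ T : ℝ → ℝ, ∀ l r, ContinuousOn T (Set.Icc l r) →
      ContinuousOn (fun b => H b (T b)) (Set.Icc l r) := fun T l r hT =>
    hH.comp_continuousOn (continuousOn_id.prodMk hT)
  obtain ⟨l, r, hl, hlr, hr, hmem, hend⟩ := exists_subinterval (F := fun b => H b 0) hb hlt
    (hHT _ _ _ continuousOn_const) (Or.inr ⟨hH0, hH1⟩)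
  have hP0 : P 0 (l, r, fun _ => 0) := ⟨hl, hlr, hr, continuousOn_const,
    fun b hb => ⟨hinit b ⟨hl.trans hb.1, hb.2.trans hr⟩, hmem b hb⟩,
    fun b _ b' _ => by simpa using hw0.le, hend⟩
  have hstep : ∀ k x, P k x → ∃ y, P (k + 1) y ∧ R k x y := by
    rintro k ⟨l, r, T⟩ ⟨hl, hlr, hr, hTc, hadm, hwin, hend⟩
    simp only at hl hlr hr hTc hadm hwin hend
    have hin : ∀ b ∈ Set.Icc l r, b ∈ Set.Icc b₀ b₁ := fun b hb => ⟨hl.trans hb.1, hb.2.trans hr⟩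
    have hex : ∀ b, b ∈ Set.Icc l r → ∃ T', Next k b (T b) T' := fun b hb =>
      hnext k b (hin b hb) _ (hadm b hb).1 (hadm b hb).2
    choose! T' hT' using hex
    have hT'c : ContinuousOn T' (Set.Icc l r) :=
      hcont k l r T T' hl hr hTc fun b hb => ⟨(hadm b hb).1, (hadm b hb).2, hT' b hb⟩
    have hsp := fun b hb => hspec k b (hin b hb) _ _ (hadm b hb).1 (hadm b hb).2 (hT' b hb)
    -- the times of the next passage cover a whole window
    have hlog : ∀ c, 0 < c → Real.log (1 / (ε * c)) = -Real.log ε - Real.log c := fun c hc => by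
      rw [one_div, Real.log_inv, Real.log_mul hε.ne' hc.ne']; ring
    have hspread : ∀ x ∈ Set.Icc l r, ∀ y ∈ Set.Icc l r, H x (T x) = cl → H y (T y) = ch →
        T' y + 2 * w ≤ T' x := by
      intro x hx y hy hxc hyc
      -- Twice the difference of the new times is at least log(ch/cl), less 18 for the two errors
      -- and 2w for the spread of the old times. By the choice of ch/cl this leaves 4w.
      have h1 := (abs_le.1 (hsp x hx).2.1).1
      have h2 := (abs_le.1 (hsp y hy).2.1).2
      rw [hxc, hlog cl hcl] at h1
      rw [hyc, hlog ch (hcl.trans hlt)] at h2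
      rw [Real.log_div (hcl.trans hlt).ne' hcl.ne'] at hw
      have h3 := hwin y hy x hx
      linarith
    have hlm : l ∈ Set.Icc l r := ⟨le_rfl, hlr⟩
    have hrm : r ∈ Set.Icc l r := ⟨hlr, le_rfl⟩
    obtain ⟨t, σ', ht1, ht2, hσ', hc1, hc2⟩ := exists_cos_window hω Φ (min (T' l) (T' r))
    rw [← hwdef] at ht2 hc2
    have hends : (T' l ≤ t ∧ t + w ≤ T' r) ∨ (t + w ≤ T' l ∧ T' r ≤ t) := by
      rcases hend with h | h
      · have := hspread l hlm r hrm h.1 h.2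
        rw [min_eq_right (by linarith)] at ht1 ht2
        exact Or.inr ⟨by linarith, by linarith⟩
      · have := hspread r hrm l hlm h.2 h.1
        rw [min_eq_left (by linarith)] at ht1 ht2
        exact Or.inl ⟨by linarith, by linarith⟩
    obtain ⟨l₁, r₁, hl₁, hlr₁, hr₁, hmem₁, hend₁⟩ :=
      exists_subinterval hlr (show t < t + w by linarith) hT'c hends
    have hsub₁ : Set.Icc l₁ r₁ ⊆ Set.Icc l r := Set.Icc_subset_Icc hl₁ hr₁
    have hT'c₁ := hT'c.mono hsub₁
    -- Where the cosine is ±1 the full Melnikov amplitude M acts; as M ≥ ch - cl + σ, it pushes H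
    -- out of the interval on the corresponding side, wherever H was before.
    have hval : ∀ x ∈ Set.Icc l₁ r₁, ∀ c, Real.cos (ω * T' x + Φ) = c →
        ((-1 : ℝ) ^ (k + 1) * c = 1 → H x (T' x) ≤ cl) ∧
        ((-1 : ℝ) ^ (k + 1) * c = -1 → ch ≤ H x (T' x)) := by
      intro x hx c hc
      have h1 := abs_le.1 (hsp x (hsub₁ hx)).2.2
      have h2 := (hadm x (hsub₁ hx)).2
      rw [hc, mul_left_comm] at h1
      constructor
      · intro h; rw [h] at h1; linarith [h1.2, h2.2]
      · intro h; rw [h] at h1; linarith [h1.1, h2.1]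
    have hl₁m : l₁ ∈ Set.Icc l₁ r₁ := ⟨le_rfl, hlr₁⟩
    have hr₁m : r₁ ∈ Set.Icc l₁ r₁ := ⟨hlr₁, le_rfl⟩
    have hendH : (H l₁ (T' l₁) ≤ cl ∧ ch ≤ H r₁ (T' r₁)) ∨ (ch ≤ H l₁ (T' l₁) ∧ H r₁ (T' r₁) ≤ cl) := by
      have hsg : ((-1 : ℝ) ^ (k + 1) * σ' = 1 ∧ (-1 : ℝ) ^ (k + 1) * -σ' = -1) ∨
          ((-1 : ℝ) ^ (k + 1) * σ' = -1 ∧ (-1 : ℝ) ^ (k + 1) * -σ' = 1) := by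
        rcases neg_one_pow_eq_or ℝ (k + 1) with h | h <;> rcases hσ' with h' | h' <;>
          rw [h, h'] <;> norm_num
      rcases hend₁ with h | h
      · have e1 := hval l₁ hl₁m σ' (by rw [h.1, hc1])
        have e2 := hval r₁ hr₁m (-σ') (by rw [h.2, hc2])
        rcases hsg with hs | hs
        · exact Or.inl ⟨e1.1 hs.1, e2.2 hs.2⟩
        · exact Or.inr ⟨e1.2 hs.1, e2.1 hs.2⟩
      · have e1 := hval l₁ hl₁m (-σ') (by rw [h.1, hc2])
        have e2 := hval r₁ hr₁m σ' (by rw [h.2, hc1])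
        rcases hsg with hs | hs
        · exact Or.inr ⟨e1.2 hs.2, e2.1 hs.1⟩
        · exact Or.inl ⟨e1.1 hs.2, e2.2 hs.1⟩
    obtain ⟨l₂, r₂, hl₂, hlr₂, hr₂, hmem₂, hend₂⟩ :=
      exists_subinterval (F := fun b => H b (T' b)) hlr₁ hlt (hHT _ _ _ hT'c₁) hendH
    have hsub₂ : Set.Icc l₂ r₂ ⊆ Set.Icc l₁ r₁ := Set.Icc_subset_Icc hl₂ hr₂
    refine ⟨(l₂, r₂, T'), ⟨hl.trans (hl₁.trans hl₂), hlr₂, hr₂.trans (hr₁.trans hr),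
      hT'c₁.mono hsub₂, fun b hb => ⟨(hsp b (hsub₁ (hsub₂ hb))).1, hmem₂ b hb⟩, ?_, hend₂⟩,
      hl₁.trans hl₂, hr₂.trans hr₁, fun b hb => hT' b (hsub₁ (hsub₂ hb))⟩
    intro b hb b' hb'
    have h1 := hmem₁ b (hsub₂ hb)
    have h2 := hmem₁ b' (hsub₂ hb')
    simp only
    linarith [h1.2, h2.1]
  obtain ⟨x, hx0, hx⟩ := exists_seq_of_step hP0 hstep
  have hmono : Monotone fun k => (x k).1 := monotone_nat_of_le_succ fun k => (hx k).2.1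
  have hanti : Antitone fun k => (x k).2.1 := antitone_nat_of_succ_le fun k => (hx k).2.2.1
  -- The nested compact intervals have a common parameter, and it is admissible at every passage.
  have hmem := Monotone.ciSup_mem_iInter_Icc_of_antitone hmono hanti fun k => (hx k).1.2.1
  rw [Set.mem_iInter] at hmem
  set b := ⨆ k, (x k).1
  refine ⟨b, ⟨(hx 0).1.1.trans (hmem 0).1, (hmem 0).2.trans (hx 0).1.2.2.1⟩,
    fun k => (x k).2.2 b, by simp [hx0], fun k => ?_⟩
  have h1 := (hx k).1.2.2.2.2.1 b (hmem k)
  exact ⟨h1.1, h1.2, (hx k).2.2.2 b (hmem (k + 1))⟩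

/-! ### Passages along both separatrices and the oscillating solution -/

theorem deficit_sign_mul {s : ℝ} (hs : s = 1 ∨ s = -1) (u v : ℝ) :
    deficit (s * u) (s * v) = deficit u v := by
  rcases hs with rfl | rfl <;> simp [deficit]

/-- The solution passes along the separatrix of sign `s` from the zero `T` to the next zero
`T'`. -/
structure IsPassage (ε τ : ℝ) (u v : ℝ → ℝ) (s T T' : ℝ) : Prop where
  lt : T + τ < T'
  zero : u T' = 0
  pos : ∀ t ∈ Set.Ico (T + 1) T', 0 < s * u t
  velocity_neg : s * v T' < 0
  velocity : |s * v T' + 1| ≤ 8 * ε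
  time : |2 * (T' - T) - Real.log (1 / (ε * (deficit (u (T + τ)) (v (T + τ)) / ε)))| ≤ 9
  deficit_change : |deficit (u (T' - τ)) (v (T' - τ)) / ε - deficit (u (T + τ)) (v (T + τ)) / ε|
    ≤ 15 * Real.exp (-2 * (τ - 1))
  bounded : ∀ t ∈ Set.Icc T T', |u t| ≤ 2 ∧ |v t| ≤ 2

theorem exists_isPassage (A c τ : ℝ) (hA : 0 ≤ A) (hc : 0 < c) (hτ : 1 ≤ τ)
    (hτc : 800 * Real.exp (-2 * (τ - 1)) ≤ c) : ∃ ε₀ > 0, ∀ (ε : ℝ) (f u v : ℝ → ℝ), 0 < ε →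
    ε ≤ ε₀ → (∀ t, |f t| ≤ 1) → IsClippedSol ε f u v → ∀ s T : ℝ, (s = 1 ∨ s = -1) →
    |u T| ≤ A * ε → |s * v T - 1| ≤ A * ε →
    deficit (u (T + τ)) (v (T + τ)) / ε ∈ Set.Icc c 1 → ∃ T', IsPassage ε τ u v s T T' := by
  obtain ⟨ε₀, hε₀, h⟩ := exists_passage A c τ hA hc hτ hτc
  refine ⟨ε₀, hε₀, fun ε f u v hε hεle hf hsol s T hs hu0 hv0 hH => ?_⟩
  have hs1 : |s| = 1 := by rcases hs with rfl | rfl <;> simp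
  have hss : s * s = 1 := by rcases hs with rfl | rfl <;> norm_num
  obtain ⟨R, h1, h2, h3, h4, h5, h6, h7, h8⟩ := h ε _ _ _ hε hεle (fun t => by
    rw [abs_mul, hs1, one_mul]; exact hf _) ((hsol.comp_add T).sign_mul hs)
    (by rw [abs_mul, hs1, one_mul, zero_add]; exact hu0) (by rw [zero_add]; exact hv0)
    (deficit (u (T + τ)) (v (T + τ)) / ε)
    (by rw [deficit_sign_mul hs, add_comm τ, mul_div_cancel₀ _ hε.ne']) hH.1 hH.2
  refine ⟨T + R, by linarith, ?_, fun t ht => ?_, ?_, ?_, ?_, ?_, fun t ht => ?_⟩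
  · have : s * (s * u (R + T)) = 0 := by rw [h2, mul_zero]
    rw [← mul_assoc, hss, one_mul, add_comm] at this
    exact this
  · have := h3 (t - T) ⟨by linarith [ht.1], by linarith [ht.2]⟩
    rwa [sub_add_cancel] at this
  · rwa [add_comm]
  · rwa [add_comm T]
  · rwa [add_sub_cancel_left]
  · rw [deficit_sign_mul hs] at h7
    rw [show T + R - τ = R - τ + T by ring, div_sub_div_same, abs_div, abs_of_pos hε,
      div_le_iff₀ hε, mul_comm _ ε]
    rwa [mul_div_cancel₀ _ hε.ne'] at h7
  · have := h8 (t - T) ⟨by linarith [ht.1], by linarith [ht.2]⟩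
    rwa [sub_add_cancel, abs_mul, abs_mul, hs1, one_mul, one_mul] at this

theorem exists_deficit_change_at (A τ : ℝ) (hA : 0 ≤ A) (hτ : 0 ≤ τ) : ∃ ε₀ > 0, ∃ C > 0,
    ∀ (ε : ℝ) (f u v : ℝ → ℝ), 0 < ε → ε ≤ ε₀ → Continuous f → (∀ t, |f t| ≤ 1) →
    IsClippedSol ε f u v → ∀ s T : ℝ, (s = 1 ∨ s = -1) →
    |u T| ≤ A * ε → |s * v T - 1| ≤ A * ε →
    ∀ a ∈ Set.Icc (-τ) τ, |deficit (u (T + a)) (v (T + a)) / ε + (s * v T - 1) / ε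
      + s * ∫ r in (0 : ℝ)..a, sechSq r * f (r + T)| ≤ C * ε := by
  obtain ⟨ε₀, hε₀, C, hC, h⟩ := exists_deficit_change A τ hA hτ
  refine ⟨ε₀, hε₀, C, hC, fun ε f u v hε hεle hfc hf hsol s T hs hu0 hv0 a ha => ?_⟩
  have hs1 : |s| = 1 := by rcases hs with rfl | rfl <;> simp
  have key := h ε (fun t => s * f (t + T)) _ _ hε hεle (by fun_prop) (fun t => by
    rw [abs_mul, hs1, one_mul]; exact hf _) ((hsol.comp_add T).sign_mul hs)
    (by rw [abs_mul, hs1, one_mul, zero_add]; exact hu0) (by rw [zero_add]; exact hv0) a ha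
  rw [deficit_sign_mul hs, zero_add, add_comm a T] at key
  simp only [mul_left_comm _ s, intervalIntegral.integral_const_mul] at key
  rw [show deficit (u (T + a)) (v (T + a)) / ε + (s * v T - 1) / ε
      + s * ∫ r in (0 : ℝ)..a, sechSq r * f (r + T)
      = (deficit (u (T + a)) (v (T + a)) + (s * v T - 1)
      + s * (ε * ∫ r in (0 : ℝ)..a, sechSq r * f (r + T))) / ε by field_simp, abs_div,
    abs_of_pos hε, div_le_iff₀ hε]
  exact key.trans (le_of_eq (by ring))

/-- The time of the next zero depends continuously on the parameter. -/
theorem continuousOn_nextZero {ε : ℝ} {f : ℝ → ℝ} {u v : ℝ → ℝ → ℝ} {T T' : ℝ → ℝ} {S : Set ℝ}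
    {s τ : ℝ} (hτ : 1 ≤ τ)
    (hc : Continuous fun p : ℝ × ℝ => u p.1 p.2) (hsol : ∀ b, IsClippedSol ε f (u b) (v b))
    (hT : ContinuousOn T S) (hP : ∀ b ∈ S, IsPassage ε τ (u b) (v b) s (T b) (T' b)) :
    ContinuousOn T' S := by
  intro b hb
  have hPb := hP b hb
  have hlt := hPb.lt
  have hcb : Continuous (u b) := hc.comp (by fun_prop : Continuous fun t : ℝ => (b, t))
  have hct : ∀ t, Continuous fun b => u b t := fun t =>
    hc.comp (by fun_prop : Continuous fun b : ℝ => (b, t))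
  rw [ContinuousWithinAt, tendsto_order]
  constructor
  · intro p hp
    -- `s u` stays positive up to the time `p`
    have hT1 : 0 < s * u b (T b + 1) := hPb.pos _ ⟨le_rfl, by linarith⟩
    have hev : ∀ᶠ t in 𝓝 (T b + 1), 0 < s * u b t :=
      (continuous_const.mul hcb).continuousAt.eventually (lt_mem_nhds hT1)
    obtain ⟨η, hη, hball⟩ := Metric.eventually_nhds_iff.1 hev
    have hpos : ∀ t ∈ Set.Icc (T b + 1 - η / 2) p, 0 < s * u b t := by
      intro t ht
      by_cases h : T b + 1 ≤ t
      · exact hPb.pos t ⟨h, ht.2.trans_lt hp⟩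
      · refine hball ?_
        rw [Real.dist_eq, abs_lt]
        constructor <;> linarith [ht.1]
    -- Compactness of the time interval carries positivity over to nearby parameters, whose next
    -- zero is therefore later than p.
    have hev2 : ∀ᶠ b' in 𝓝 b, ∀ t ∈ Set.Icc (T b + 1 - η / 2) p, 0 < s * u b' t := by
      refine isCompact_Icc.eventually_forall_of_forall_eventually fun t ht => ?_
      have := (continuous_const.mul hc : Continuous fun p : ℝ × ℝ => s * u p.1 p.2).continuousAt
        (x := (b, t))
      exact this.eventually (lt_mem_nhds (hpos t ht))
    have hevT := (hT b hb).eventually (lt_mem_nhds (show T b - η / 2 < T b by linarith))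
    filter_upwards [hev2.filter_mono nhdsWithin_le_nhds, hevT, self_mem_nhdsWithin] with b' h1 h2 h3
    by_contra hcon
    have hP' := hP b' h3
    have := h1 (T' b') ⟨by linarith [hP'.lt], not_lt.1 hcon⟩
    rw [hP'.zero, mul_zero] at this
    exact lt_irrefl _ this
  · intro p hp
    have hv3 : |v b (T' b)| ≤ 3 := ((hPb.bounded (T' b) ⟨by linarith, le_rfl⟩).2).trans (by norm_num)
    have hd : HasDerivAt (fun t => s * u b t) (s * v b (T' b)) (T' b) :=
      ((hsol b).hasDerivAt_left hv3).const_mul s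
    -- The zero is crossed with nonzero speed, so s u is negative at some t shortly after it. This
    -- persists for nearby parameters, and their next zero comes before t.
    have hsign := eventually_nhdsWithin_sign_eq_of_deriv_neg
      (by rw [hd.deriv]; exact hPb.velocity_neg) (by rw [hPb.zero, mul_zero])
    obtain ⟨t, ht, htp⟩ := ((hsign.filter_mono nhdsWithin_le_nhds).and
      (Ioo_mem_nhdsGT hp)).exists
    have hneg : s * u b t < 0 := by
      rw [← sign_eq_neg_one_iff, ht, sign_eq_neg_one_iff]
      linarith [htp.1]
    have hev : ∀ᶠ b' in 𝓝 b, s * u b' t < 0 :=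
      (continuous_const.mul (hct t)).continuousAt.eventually (gt_mem_nhds hneg)
    have hevT := (hT b hb).eventually (gt_mem_nhds (show T b < t - 1 by linarith [htp.1]))
    filter_upwards [hev.filter_mono nhdsWithin_le_nhds, hevT, self_mem_nhdsWithin] with b' h1 h2 h3
    by_contra hcon
    have := (hP b' h3).pos t ⟨by linarith, htp.2.trans_le (not_lt.1 hcon)⟩
    linarith

theorem continuous_deficit_comp {u v : ℝ → ℝ → ℝ} (τ ε : ℝ)
    (hc : Continuous fun p : ℝ × ℝ => (u p.1 p.2, v p.1 p.2)) :
    Continuous (Function.uncurry fun b T => deficit (u b (T + τ)) (v b (T + τ)) / ε) := by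
  have h := hc.comp (by fun_prop : Continuous fun p : ℝ × ℝ => (p.1, p.2 + τ))
  have h1 : Continuous fun p : ℝ × ℝ => u p.1 (p.2 + τ) := continuous_fst.comp h
  have h2 : Continuous fun p : ℝ × ℝ => v p.1 (p.2 + τ) := continuous_snd.comp h
  simp only [Function.uncurry_def, deficit]
  exact ((((continuous_const.sub (h1.pow 2)).pow 2).sub (h2.pow 2)).div_const 2).div_const ε

theorem one_sub_tanh_le_exp {τ : ℝ} (hτ : 1 ≤ τ) :
    1 - Real.tanh τ ≤ 4 * Real.exp (-2 * (τ - 1)) := by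
  refine (one_sub_tanh_le (by linarith)).trans ?_
  exact mul_le_mul_of_nonneg_left (Real.exp_le_exp.2 (by linarith)) (by norm_num)

theorem integral_zero_neg (g : ℝ → ℝ) (τ : ℝ) :
    ∫ r in (0 : ℝ)..(-τ), sechSq r * g r = -∫ r in (0 : ℝ)..τ, sechSq r * g (-r) := by
  have := intervalIntegral.integral_comp_neg (a := 0) (b := τ) (fun r => sechSq r * g r)
  simp only [sechSq_neg, neg_zero] at this
  rw [this, intervalIntegral.integral_symm]

theorem abs_integral_sechSq_mul_le {g : ℝ → ℝ} (hg : ∀ t, |g t| ≤ 1) {τ : ℝ}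
    (hτ : 0 ≤ τ) : |∫ r in (0 : ℝ)..τ, sechSq r * g r| ≤ 1 := by
  have h1 : ∫ r in (0 : ℝ)..τ, sechSq r = Real.tanh τ := by
    rw [intervalIntegral.integral_eq_sub_of_hasDerivAt (fun t _ => hasDerivAt_tanh t)
      (continuous_sechSq.intervalIntegrable _ _), Real.tanh_zero, sub_zero]
  rw [← Real.norm_eq_abs]
  refine (intervalIntegral.norm_integral_le_of_norm_le hτ (Eventually.of_forall fun t _ => ?_)
    (continuous_sechSq.intervalIntegrable _ _)).trans
    (h1.le.trans (le_of_abs_le (abs_tanh_le_one τ)))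
  rw [Real.norm_eq_abs, abs_mul, abs_of_pos (sechSq_pos t)]
  exact mul_le_of_le_one_right (sechSq_pos t).le (hg t)

/-- For all small `ε` there is a solution that passes along the two separatrices alternately
forever; the Melnikov parameters at the ends of the passages have the required signs. -/
theorem exists_oscillating_solution {ω : ℝ} (hω : ω ≠ 0) (Φ : ℝ) {S : ℝ → ℝ → ℝ} {A₀ δ₀ : ℝ}
    (hδ₀ : 0 < δ₀) (hSc : ∀ ε, Continuous (S ε))
    (hS : ∀ ε, 0 < ε → ε ≤ δ₀ → ∀ b, |b| ≤ 3 → |S ε b| ≤ A₀ * ε) :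
    ∃ A τ cl : ℝ, 0 ≤ A ∧ 1 ≤ τ ∧ 0 < cl ∧ ∃ ε₀ > 0, ∀ ε, 0 < ε → ε ≤ ε₀ →
    ∃ (b : ℝ) (u v : ℝ → ℝ) (T : ℕ → ℝ), |b| ≤ 3 ∧
      IsClippedSol ε (fun t => Real.cos (ω * t + Φ)) u v ∧ u 0 = S ε b ∧ v 0 = 1 + ε * b ∧
      T 0 = 0 ∧ ∀ k, |u (T k)| ≤ A * ε ∧ |(-1) ^ k * v (T k) - 1| ≤ A * ε ∧
        deficit (u (T k + τ)) (v (T k + τ)) / ε ∈ Set.Icc cl 1 ∧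
        IsPassage ε τ u v ((-1) ^ k) (T k) (T (k + 1)) ∧
        (-1) ^ k * ((v (T k) - (-1) ^ k) / ε
          + ∫ r in Set.Ioi 0, sechSq r * Real.cos (ω * r + (Φ + ω * T k))) < 0 ∧
        (-1) ^ (k + 1) * ((v (T (k + 1)) - (-1) ^ (k + 1)) / ε
          - ∫ r in Set.Ioi 0, sechSq r * Real.cos (ω * -r + (Φ + ω * T (k + 1)))) < 0 := by
  set M := melnikov ω with hMdef
  have hM : 0 < M := melnikov_pos ω
  -- The bound M/4 lets one Melnikov kick exceed the length of [cl, ch] plus all errors; the bound 1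
  -- is the range of H admitted by the passage lemma.
  set ch := min (M / 4) 1 with hch
  have hch0 : 0 < ch := by positivity
  have hchM : ch ≤ M / 4 := min_le_left _ _
  have hch1 : ch ≤ 1 := min_le_right _ _
  set w := Real.pi / |ω| with hwdef
  have hw0 : 0 < w := div_pos Real.pi_pos (abs_pos.2 hω)
  -- The ratio is what the shooting argument needs for the sweep of the next time.
  set cl := ch * Real.exp (-(18 + 6 * w)) with hcl
  have hcl0 : 0 < cl := by positivity
  have hlt : cl < ch := by
    refine mul_lt_of_lt_one_right hch0 ?_
    rw [Real.exp_lt_one_iff]; linarith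
  have hwlog : 18 + 6 * w ≤ Real.log (ch / cl) := by
    have : ch / cl = Real.exp (18 + 6 * w) := by
      rw [hcl, Real.exp_neg]; field_simp
    rw [this, Real.log_exp]
  -- The time τ is fixed after cl and before ε: the tails beyond τ must be small compared with cl.
  obtain ⟨τ, hτ1, hτc⟩ : ∃ τ : ℝ, 1 ≤ τ ∧ 800 * Real.exp (-2 * (τ - 1)) ≤ cl := by
    have h1 : Tendsto (fun τ : ℝ => 800 * Real.exp (-2 * (τ - 1))) atTop (𝓝 (800 * 0)) := by
      refine Tendsto.const_mul _ (Real.tendsto_exp_atBot.comp ?_)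
      exact (tendsto_id.atTop_add tendsto_const_nhds).const_mul_atTop_of_neg (by norm_num)
    rw [mul_zero] at h1
    obtain ⟨τ, h2, h3⟩ := ((h1.eventually (ge_mem_nhds hcl0)).and (eventually_ge_atTop 1)).exists
    exact ⟨τ, h3, h2⟩
  set e := Real.exp (-2 * (τ - 1)) with he
  have he0 : 0 < e := Real.exp_pos _
  -- The value 8 bounds the velocity error at every later zero, while A₀ and 3 bound the initial
  -- value and the parameter b.
  set A := max (max 8 A₀) 3 with hA
  have hA8 : 8 ≤ A := (le_max_left _ _).trans (le_max_left _ _)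
  have hAA : A₀ ≤ A := (le_max_right _ _).trans (le_max_left _ _)
  have hA0 : 0 ≤ A := by linarith
  obtain ⟨ε₁, hε₁, hpass⟩ := exists_isPassage A cl τ hA0 hcl0 hτ1 hτc
  obtain ⟨ε₂, hε₂, C, hC, hdef⟩ := exists_deficit_change_at A τ hA0 (by linarith)
  refine ⟨A, τ, cl, hA0, hτ1, hcl0, min (min ε₁ ε₂) (min δ₀ (min (cl / (8 * C)) (1 / C))),
    by positivity, fun ε hε hεle => ?_⟩
  have hεε₁ : ε ≤ ε₁ := hεle.trans ((min_le_left _ _).trans (min_le_left _ _))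
  have hεε₂ : ε ≤ ε₂ := hεle.trans ((min_le_left _ _).trans (min_le_right _ _))
  have hεδ : ε ≤ δ₀ := hεle.trans ((min_le_right _ _).trans (min_le_left _ _))
  have hCε : C * ε ≤ cl / 8 := by
    have : ε ≤ cl / (8 * C) :=
      hεle.trans ((min_le_right _ _).trans ((min_le_right _ _).trans (min_le_left _ _)))
    rw [le_div_iff₀ (by positivity)] at this
    linarith
  have hCε1 : C * ε ≤ 1 := by
    have : ε ≤ 1 / C :=
      hεle.trans ((min_le_right _ _).trans ((min_le_right _ _).trans (min_le_right _ _)))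
    rw [le_div_iff₀ hC] at this
    linarith
  set f : ℝ → ℝ := fun t => Real.cos (ω * t + Φ) with hf
  have hfc : Continuous f := by rw [hf]; fun_prop
  have hf1 : ∀ t, |f t| ≤ 1 := fun t => Real.abs_cos_le_one _
  have hfT : ∀ r T, f (r + T) = Real.cos (ω * r + (Φ + ω * T)) := fun r T => by
    simp only [hf]; congr 1; ring
  have htanh := one_sub_tanh_le_exp hτ1
  rw [← he] at htanh
  choose u v hsol hu0 hv0 using fun b => exists_isClippedSol ε hfc hf1 (S ε b) (1 + ε * b)
  have hcuv := continuous_of_isClippedSol hf1 hsol (by simpa only [hu0] using hSc ε)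
    (by simp only [hv0]; fun_prop)
  have hcu : Continuous fun p : ℝ × ℝ => u p.1 p.2 := continuous_fst.comp hcuv
  have hsgn : ∀ k : ℕ, (-1 : ℝ) ^ k = 1 ∨ (-1 : ℝ) ^ k = -1 := neg_one_pow_eq_or ℝ
  have hadm0 : ∀ b ∈ Set.Icc (-3 : ℝ) 3, |u b 0| ≤ A * ε ∧ |(-1) ^ 0 * v b 0 - 1| ≤ A * ε := by
    intro b hb
    have hb3 : |b| ≤ 3 := abs_le.2 hb
    rw [hu0, hv0]
    refine ⟨(hS ε hε hεδ b hb3).trans (by gcongr), ?_⟩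
    rw [pow_zero, one_mul, add_sub_cancel_left, abs_mul, abs_of_pos hε, mul_comm]
    gcongr
    linarith
  -- During the first half passage h/ε is -b up to 1 + Cε, so b = ∓3 gives values of H above ch and
  -- below cl.
  have hinit : ∀ b ∈ Set.Icc (-3 : ℝ) 3,
      |deficit (u b (0 + τ)) (v b (0 + τ)) / ε + b| ≤ 1 + C * ε := by
    intro b hb
    have h1 := hdef ε f (u b) (v b) hε hεε₂ hfc hf1 (hsol b) ((-1) ^ 0) 0 (hsgn 0) (hadm0 b hb).1
      (hadm0 b hb).2 τ ⟨by linarith, le_rfl⟩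
    simp only [pow_zero, one_mul, add_zero, hv0, add_sub_cancel_left] at h1
    rw [mul_div_cancel_left₀ _ hε.ne'] at h1
    have h2 := abs_integral_sechSq_mul_le hf1 (show 0 ≤ τ by linarith)
    rw [abs_le] at h1 h2 ⊢
    constructor <;> linarith [h1.1, h1.2, h2.1, h2.2]
  have hspec : ∀ k b T T', |u b T| ≤ A * ε ∧ |(-1) ^ k * v b T - 1| ≤ A * ε →
      IsPassage ε τ (u b) (v b) ((-1) ^ k) T T' →
      (|u b T'| ≤ A * ε ∧ |(-1) ^ (k + 1) * v b T' - 1| ≤ A * ε) := by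
    intro k b T T' _ hp
    refine ⟨by rw [hp.zero, abs_zero]; positivity, ?_⟩
    rw [pow_succ, show (-1 : ℝ) ^ k * -1 * v b T' - 1 = -((-1) ^ k * v b T' + 1) by ring, abs_neg]
    exact hp.velocity.trans (by gcongr)
  -- The first order formulas at T + τ and T - τ are subtracted. The velocity at T cancels and the
  -- Melnikov integral over [-τ, τ] remains.
  have hchange : ∀ k b T, |u b T| ≤ A * ε → |(-1) ^ k * v b T - 1| ≤ A * ε →
      |deficit (u b (T + τ)) (v b (T + τ)) / ε - (deficit (u b (T - τ)) (v b (T - τ)) / ε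
        - (-1) ^ k * (M * Real.cos (ω * T + Φ)))| ≤ 2 * (C * ε) + 8 * e := by
    intro k b T h1 h2
    have hp := hdef ε f (u b) (v b) hε hεε₂ hfc hf1 (hsol b) _ T (hsgn k) h1 h2 τ
      ⟨by linarith, le_rfl⟩
    have hm := hdef ε f (u b) (v b) hε hεε₂ hfc hf1 (hsol b) _ T (hsgn k) h1 h2 (-τ)
      ⟨le_rfl, by linarith⟩
    have hi := abs_integral_sechSq_mul_cos_sub_le ω (Φ + ω * T) τ
    have hint : ∀ a b : ℝ, IntervalIntegrable (fun r => sechSq r * f (r + T))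
        MeasureTheory.volume a b := fun a b =>
      (continuous_sechSq.mul (hfc.comp (by fun_prop))).intervalIntegrable a b
    have hadd := intervalIntegral.integral_add_adjacent_intervals (hint (-τ) 0) (hint 0 τ)
    rw [intervalIntegral.integral_symm 0 (-τ)] at hadd
    simp only [hfT] at hadd hp hm
    rw [← hadd, ← hMdef, show Φ + ω * T = ω * T + Φ by ring] at hi
    rw [show Φ + ω * T = ω * T + Φ by ring] at hp hm
    rw [← sub_eq_add_neg] at hm
    generalize (∫ x in (0 : ℝ)..τ, sechSq x * Real.cos (ω * x + (ω * T + Φ))) = I₁ at *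
    generalize (∫ x in (0 : ℝ)..-τ, sechSq x * Real.cos (ω * x + (ω * T + Φ))) = I₂ at *
    generalize deficit (u b (T + τ)) (v b (T + τ)) / ε = D₁ at *
    generalize deficit (u b (T - τ)) (v b (T - τ)) / ε = D₂ at *
    generalize M * Real.cos (ω * T + Φ) = m at *
    generalize ((-1) ^ k * v b T - 1) / ε = B at *
    rw [abs_le] at hp hm hi ⊢
    rcases hsgn k with hs | hs <;> rw [hs] at hp hm ⊢ <;> constructor <;>
      linarith only [hp.1, hp.2, hm.1, hm.2, hi.1, hi.2, htanh]
  obtain ⟨b, hb, T, hT0, hT⟩ := exists_shooting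
    (H := fun b T => deficit (u b (T + τ)) (v b (T + τ)) / ε)
    (Adm := fun k b T => |u b T| ≤ A * ε ∧ |(-1) ^ k * v b T - 1| ≤ A * ε)
    (Next := fun k b T T' => IsPassage ε τ (u b) (v b) ((-1) ^ k) T T')
    (ω := ω) (Φ := Φ) (M := M) (σ := cl / 2) (ε := ε) (cl := cl) (ch := ch) (b₀ := -3) (b₁ := 3)
    hω (by norm_num) hε hcl0 hlt (by linarith) hwlog (continuous_deficit_comp τ ε hcuv) hadm0
    (by have := (abs_le.1 (hinit (-3) (by norm_num))).1; linarith)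
    (by have := (abs_le.1 (hinit 3 (by norm_num))).2; linarith)
    (fun k b _ T h1 h2 => hpass ε f (u b) (v b) hε hεε₁ hf1 (hsol b) _ T (hsgn k) h1.1 h1.2
      ⟨h2.1, h2.2.trans hch1⟩)
    (fun k b _ T T' h1 _ h3 => by
      have h4 := hspec k b T T' h1 h3
      refine ⟨h4, h3.time, ?_⟩
      -- The errors 2Cε ≤ cl/4, 8e and 15e, with 800e ≤ cl, add up to less than σ = cl/2.
      have h5 := hchange (k + 1) b T' h4.1 h4.2
      have h6 := h3.deficit_change
      rw [← he] at h6
      rw [abs_le] at h5 h6 ⊢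
      constructor <;> linarith [h5.1, h5.2, h6.1, h6.2])
    (fun k l r T T' _ _ hTc h => continuousOn_nextZero hτ1 hcu hsol hTc
      fun b hb => (h b hb).2.2)
  refine ⟨b, u b, v b, T, abs_le.2 hb, hsol b, hu0 b, hv0 b, hT0, fun k => ?_⟩
  obtain ⟨⟨hk1, hk2⟩, hkH, hkN⟩ := hT k
  refine ⟨hk1, hk2, ⟨hkH.1, hkH.2.trans hch1⟩, hkN, ?_, ?_⟩
  -- To first order h/ε at T + τ is -s times the growing coefficient at the top. Its lower bound cl
  -- exceeds the errors, hence the sign.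
  · have hp := hdef ε f (u b) (v b) hε hεε₂ hfc hf1 (hsol b) _ (T k) (hsgn k) hk1 hk2 τ
      ⟨by linarith, le_rfl⟩
    simp only [hfT] at hp
    have hi := abs_integral_sechSq_mul_sub_le (f := fun r => Real.cos (ω * r + (Φ + ω * T k)))
      (by fun_prop) (fun t => Real.abs_cos_le_one _) τ
    have hH : cl ≤ deficit (u b (T k + τ)) (v b (T k + τ)) / ε := hkH.1
    generalize (∫ x in (0 : ℝ)..τ, sechSq x * Real.cos (ω * x + (Φ + ω * T k))) = I₁ at *
    generalize (∫ x in Set.Ioi 0, sechSq x * Real.cos (ω * x + (Φ + ω * T k))) = I₂ at *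
    generalize deficit (u b (T k + τ)) (v b (T k + τ)) / ε = D₁ at *
    have e1 : ((-1) ^ k * v b (T k) - 1) / ε = (-1) ^ k * ((v b (T k) - (-1) ^ k) / ε) := by
      rcases hsgn k with hs | hs <;> rw [hs] <;> ring
    rw [e1] at hp
    generalize (v b (T k) - (-1) ^ k) / ε = B at *
    rw [abs_le] at hp hi
    rcases hsgn k with hs | hs <;> rw [hs] at hp ⊢ <;>
      linarith only [hp.1, hp.2, hi.1, hi.2, htanh, hH, hτc, hCε, he0, hcl0]
  · obtain ⟨hk1', hk2'⟩ := (hT (k + 1)).1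
    have hp := hdef ε f (u b) (v b) hε hεε₂ hfc hf1 (hsol b) _ (T (k + 1)) (hsgn (k + 1)) hk1' hk2'
      (-τ) ⟨le_rfl, by linarith⟩
    -- Between the passages h/ε changes by at most 15e, so it is still positive at the time τ before
    -- the next zero, where it determines the coefficient at the bottom.
    have hD := hkN.deficit_change
    rw [← he] at hD
    rw [integral_zero_neg fun r => f (r + T (k + 1))] at hp
    simp only [hfT] at hp
    rw [← sub_eq_add_neg (T (k + 1))] at hp
    have hi := abs_integral_sechSq_mul_sub_le
      (f := fun r => Real.cos (ω * -r + (Φ + ω * T (k + 1))))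
      (by fun_prop) (fun t => Real.abs_cos_le_one _) τ
    have hH : cl ≤ deficit (u b (T k + τ)) (v b (T k + τ)) / ε := hkH.1
    generalize (∫ x in (0 : ℝ)..τ, sechSq x * Real.cos (ω * -x + (Φ + ω * T (k + 1)))) = I₁ at *
    generalize (∫ x in Set.Ioi 0, sechSq x * Real.cos (ω * -x + (Φ + ω * T (k + 1)))) = I₂ at *
    generalize deficit (u b (T k + τ)) (v b (T k + τ)) / ε = D₁ at *
    generalize deficit (u b (T (k + 1) - τ)) (v b (T (k + 1) - τ)) / ε = D₂ at *
    have e1 : ((-1) ^ (k + 1) * v b (T (k + 1)) - 1) / ε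
        = (-1) ^ (k + 1) * ((v b (T (k + 1)) - (-1) ^ (k + 1)) / ε) := by
      rcases hsgn (k + 1) with hs | hs <;> rw [hs] <;> ring
    rw [e1] at hp
    generalize (v b (T (k + 1)) - (-1) ^ (k + 1)) / ε = B at *
    rw [abs_le] at hp hi hD
    rcases hsgn (k + 1) with hs | hs <;> rw [hs] at hp ⊢ <;>
      linarith only [hp.1, hp.2, hi.1, hi.2, hD.1, hD.2, htanh, hH, hτc, hCε, he0, hcl0]

/-! ### From the oscillating solution to its expansions -/

theorem exists_index_of_step {T : ℕ → ℝ} (h0 : T 0 = 0) (hT : ∀ k, T k + 1 ≤ T (k + 1)) {t : ℝ}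
    (ht : 0 ≤ t) : ∃ k, T k ≤ t ∧ t ≤ T (k + 1) := by
  have hge : ∀ k : ℕ, (k : ℝ) ≤ T k := fun k => by
    induction k with
    | zero => simp [h0]
    | succ k ih => push_cast; linarith [hT k]
  have hex : ∃ k, t < T k := ⟨⌊t⌋₊ + 1, (Nat.lt_floor_add_one t).trans_le (by
    exact_mod_cast hge (⌊t⌋₊ + 1))⟩
  classical
  have hne : Nat.find hex ≠ 0 := fun h => by
    have := Nat.find_spec hex
    rw [h, h0] at this
    linarith
  obtain ⟨k, hk⟩ := Nat.exists_eq_succ_of_ne_zero hne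
  refine ⟨k, not_lt.1 (Nat.find_min hex (by omega)), ?_⟩
  have := Nat.find_spec hex
  rw [hk] at this
  exact this.le

/-- Where |u| and |v| are at most 2 the truncation is inactive in a whole neighbourhood, so the
original equation holds there and can be differentiated. -/
theorem IsClippedSol.contDiffAt_and_residual {ω Φ ε : ℝ} {u v : ℝ → ℝ}
    (h : IsClippedSol ε (fun t => Real.cos (ω * t + Φ)) u v) {t : ℝ} (hu : |u t| ≤ 2)
    (hv : |v t| ≤ 2) : ContDiffAt ℝ 2 u t ∧ duffingResidual ω Φ ε u t = 0 := by
  have huc := h.continuous_left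
  have hvc := h.continuous_right
  set O : Set ℝ := {s | |u s| < 3 ∧ |v s| < 3} with hO
  have hOo : IsOpen O := (isOpen_lt huc.abs continuous_const).inter
    (isOpen_lt hvc.abs continuous_const)
  have htO : t ∈ O := ⟨by linarith, by linarith⟩
  have h1 : ∀ s ∈ O, HasDerivAt u (v s) s := fun s hs => h.hasDerivAt_left hs.2.le
  have h2 : ∀ s ∈ O, HasDerivAt v (2 * u s ^ 3 - 2 * u s + ε * Real.cos (ω * s + Φ)) s :=
    fun s hs => h.hasDerivAt_right hs.1.le
  have hd1 : ∀ s ∈ O, deriv u s = v s := fun s hs => (h1 s hs).deriv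
  have hd2 : ∀ s ∈ O, deriv v s = 2 * u s ^ 3 - 2 * u s + ε * Real.cos (ω * s + Φ) :=
    fun s hs => (h2 s hs).deriv
  constructor
  · refine ContDiffOn.contDiffAt (s := O) ?_ (hOo.mem_nhds htO)
    rw [show (2 : WithTop ℕ∞) = 1 + 1 by norm_num, contDiffOn_succ_iff_deriv_of_isOpen hOo]
    refine ⟨fun s hs => (h1 s hs).differentiableAt.differentiableWithinAt, by simp, ?_⟩
    refine ContDiffOn.congr ?_ hd1
    rw [show (1 : WithTop ℕ∞) = 0 + 1 by norm_num, contDiffOn_succ_iff_deriv_of_isOpen hOo]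
    refine ⟨fun s hs => (h2 s hs).differentiableAt.differentiableWithinAt, by simp, ?_⟩
    refine ContDiffOn.congr ?_ hd2
    rw [contDiffOn_zero]
    fun_prop
  · have he : deriv u =ᶠ[𝓝 t] v := by
      filter_upwards [hOo.mem_nhds htO] with s hs using hd1 s hs
    rw [duffingResidual, he.deriv_eq, hd2 t htO]
    ring

theorem exists_near_separatrix_at (A : ℝ) (hA : 0 ≤ A) : ∃ C > 0, ∃ δ > 0, δ ≤ 1 ∧
    ∀ (ε : ℝ) (f u v : ℝ → ℝ), 0 < ε → (∀ t, |f t| ≤ 1) → IsClippedSol ε f u v →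
    ∀ s T : ℝ, (s = 1 ∨ s = -1) → |u T| ≤ A * ε → |s * v T - 1| ≤ A * ε →
    ∀ t, ε * Real.exp (2 * |t - T|) ≤ δ →
      |u t - s * Real.tanh (t - T)| ≤ C * (ε * Real.exp (2 * |t - T|)) ∧
      |v t - s * sechSq (t - T)| ≤ C * (ε * Real.exp (2 * |t - T|)) ∧ |u t| ≤ 2 ∧ |v t| ≤ 2 := by
  obtain ⟨C, hC, δ, hδ, hCδ, hδ1, h⟩ := exists_near_separatrix A hA
  refine ⟨C, hC, δ, hδ, hδ1, fun ε f u v hε hf hsol s T hs hu hv t ht => ?_⟩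
  have hs1 : |s| = 1 := by rcases hs with rfl | rfl <;> simp
  have hss : s * s = 1 := by rcases hs with rfl | rfl <;> norm_num
  have key := h ε _ _ _ hε (fun t => by
    rw [abs_mul, hs1, one_mul]; exact hf _) ((hsol.comp_add T).sign_mul hs)
    (by rw [abs_mul, hs1, one_mul, zero_add]; exact hu) (by rw [zero_add]; exact hv) (t - T) ht
  rw [sub_add_cancel] at key
  have e1 : |u t - s * Real.tanh (t - T)| = |s * u t - Real.tanh (t - T)| := by
    rw [← one_mul |u t - _|, ← hs1, ← abs_mul, mul_sub, ← mul_assoc, hss, one_mul]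
  have e2 : |v t - s * sechSq (t - T)| = |s * v t - sechSq (t - T)| := by
    rw [← one_mul |v t - _|, ← hs1, ← abs_mul, mul_sub, ← mul_assoc, hss, one_mul]
  have hle : C * (ε * Real.exp (2 * |t - T|)) ≤ 1 :=
    (mul_le_mul_of_nonneg_left ht hC.le).trans hCδ
  refine ⟨e1 ▸ key.1, e2 ▸ key.2, ?_, ?_⟩
  · rw [← one_mul |u t|, ← hs1, ← abs_mul]
    have h1 := abs_le.1 (key.1.trans hle)
    have h2 := abs_le.1 (abs_tanh_le_one (t - T))
    rw [abs_le]; constructor <;> linarith [h1.1, h1.2, h2.1, h2.2]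
  · rw [← one_mul |v t|, ← hs1, ← abs_mul]
    have h1 := abs_le.1 (key.2.trans hle)
    have h2 := sechSq_pos (t - T)
    have h3 := sechSq_le_one (t - T)
    rw [abs_le]; constructor <;> linarith [h1.1, h1.2]

/-- A solution that passes near a separatrix is approximated by the formal series with the
initial data of the solution. -/
theorem exists_expansion_bound (A D : ℝ) (hA : 0 ≤ A) (n : ℕ) : ∃ C : ℝ, ∃ δ > 0,
    ∀ (ω Φ ε s T : ℝ) (u v : ℝ → ℝ) (U : ℕ → ℝ → ℝ), 0 < ε →
    IsClippedSol ε (fun t => Real.cos (ω * t + Φ)) u v → (s = 1 ∨ s = -1) →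
    |u T| ≤ A * ε → |s * v T - 1| ≤ A * ε → IsSeparatrixSeries ω (Φ + ω * T) s U →
    (∀ j, 1 ≤ j → j ≤ n → |U j 0| ≤ D ∧ |deriv (U j) 0| ≤ 2 * D) →
    (∀ m, 1 ≤ m → m ≤ n → |u T - ∑ j ∈ range (m + 1), ε ^ j * U j 0| ≤ D * ε ^ (m + 1) ∧
      |v T - ∑ j ∈ range (m + 1), ε ^ j * deriv (U j) 0| ≤ 2 * (D * ε ^ (m + 1))) →
    ∀ t, ε * Real.exp (2 * |t - T|) ≤ δ → |u t - ∑ j ∈ range (n + 1), ε ^ j * U j (t - T)|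
      ≤ C * (ε * Real.exp (2 * |t - T|)) ^ (n + 1) := by
  obtain ⟨C₀, hC₀, δ, hδ, hδ1, hnear⟩ := exists_near_separatrix_at A hA
  obtain ⟨C, hC, hrem⟩ := exists_remainder_bound D C₀ n
  refine ⟨C, δ, hδ, fun ω Φ ε s T u v U hε hsol hs hu hv hU hinit hdata t ht => ?_⟩
  have hs2 : s ^ 2 = 1 := by rcases hs with rfl | rfl <;> norm_num
  have hn : ∀ r, |r| ≤ |t - T| → ε * Real.exp (2 * |r + T - T|) ≤ δ := fun r hr => by
    rw [add_sub_cancel_right]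
    refine le_trans ?_ ht
    gcongr
  have hloc := fun r (hr : |r| ≤ |t - T|) =>
    hnear ε _ u v hε (fun _ => Real.abs_cos_le_one _) hsol s T hs hu hv (r + T) (hn r hr)
  have key := hrem ω (Φ + ω * T) s U ε |t - T| (fun r => u (r + T)) (fun r => v (r + T)) hU hs2 hε
    hinit (by simpa only [zero_add] using hdata) (fun r hr => ?_) (ht.trans hδ1) (fun r hr => ?_)
    (t - T) le_rfl
  · simpa only [sub_add_cancel] using key
  · obtain ⟨-, -, h3, h4⟩ := hloc r hr
    refine ⟨(hsol.hasDerivAt_left (by linarith)).comp_add_const r T,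
      ((hsol.hasDerivAt_right (by linarith)).comp_add_const r T).congr_deriv ?_⟩
    rw [show ω * (r + T) + Φ = ω * r + (Φ + ω * T) by ring]
  · have := (hloc r hr).1
    rwa [add_sub_cancel_right] at this

/-- Reflection changes the initial data (a, b) into (a, -b); with the sign in the definition of the
parameters at the bottom the integral enters with a minus. -/
theorem exists_hasParamsAtBot_linSol (ω Φ a b : ℝ) :
    ∃ A, HasParamsAtBot ω 1 (linSol (fun t => Real.cos (ω * t + Φ)) a b) A
      (b - ∫ s in Set.Ioi 0, sechSq s * Real.cos (ω * -s + Φ)) := by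
  obtain ⟨A, h⟩ := exists_hasParamsAtTop_linSol (ω := ω) (f := fun t => Real.cos (ω * -t + Φ))
    (by fun_prop) (fun _ => Real.abs_cos_le_one _) (HasBotExpansion.cos Φ) a (-b)
  refine ⟨A, ?_⟩
  rw [HasParamsAtBot, neg_sub, sub_eq_neg_add]
  refine h.congr fun t => ?_
  rw [linSol_eq, linSol_reflect, linSol_eq (fun t => Real.cos (ω * -t + Φ)) a (-b), sechSq_neg,
    growing_neg]
  ring

theorem abs_sub_add_log_le {ε H x cl : ℝ} (hε : 0 < ε) (hcl : 0 < cl) (hH : H ∈ Set.Icc cl 1)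
    (h : |2 * x - Real.log (1 / (ε * H))| ≤ 9) :
    |x + Real.log ε / 2| ≤ 9 / 2 + |Real.log cl| / 2 := by
  have hH0 : 0 < H := hcl.trans_le hH.1
  have h1 : Real.log (1 / (ε * H)) = -Real.log ε - Real.log H := by
    rw [one_div, Real.log_inv, Real.log_mul hε.ne' hH0.ne']; ring
  have h2 : Real.log cl ≤ Real.log H := Real.log_le_log hcl hH.1
  have h3 : Real.log H ≤ 0 := Real.log_nonpos hH0.le hH.2
  have h4 := neg_abs_le (Real.log cl)
  rw [h1] at h
  rw [abs_le] at h ⊢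
  constructor <;> linarith [h.1, h.2]

theorem theorem5 (ω Φ₀ : ℝ) (hω : ω ≠ 0) :
    ∃ ε₀ > 0, ∃ (Bminus : ℝ → ℕ → ℝ) (u : ℝ → ℝ → ℝ) (T : ℝ → ℕ → ℝ)
      (U : ℝ → ℕ → ℕ → ℝ → ℝ),
      (∀ ε ∈ Set.Ioo 0 ε₀,
        T ε 0 = 0 ∧
        (∀ k, IsSeparatrixSeries ω (Φ₀ + ω * T ε k) ((-1) ^ k) (U ε k)) ∧
        (∀ n, 1 ≤ n → HasParamsAtBot ω n (U ε 0 n) 0 (Bminus ε n)) ∧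
        (∀ k, ∃ Aplus₁ Bplus₁, HasParamsAtTop ω 1 (U ε (2 * k) 1) Aplus₁ Bplus₁ ∧ Bplus₁ < 0) ∧
        (∀ k, ∃ aplus₁ bplus₁,
          HasParamsAtBot ω 1 (U ε (2 * k + 1) 1) aplus₁ bplus₁ ∧ 0 < bplus₁) ∧
        (∀ k, ∃ aminus₁ bminus₁,
          HasParamsAtTop ω 1 (U ε (2 * k + 1) 1) aminus₁ bminus₁ ∧ 0 < bminus₁)) ∧
      IsAsymptoticSolution ω Φ₀ u ∧
      HasSeparatrixExpansions ε₀ u T U ∧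
      OscillatesNearSeparatrices ε₀ u T := by
  -- the formal series of the first passage and its summation at `t = 0`
  obtain ⟨W, hW, hWbot, hWderiv, hWone, hWcont⟩ := exists_separatrixSeries_normalized ω Φ₀
  choose! Bm hBm using hWbot
  obtain ⟨S, hSc, hS⟩ := exists_sum_of_formal hWcont 3
  have hW00 : ∀ β, W β 0 0 = 0 := fun β => by rw [(hW β).leading, Real.tanh_zero, mul_zero]
  obtain ⟨A₀, -, δ₀, hδ₀, hA₀⟩ := hS 0
  obtain ⟨A, τ, cl, hA, hτ, hcl, ε₀, hε₀, hosc⟩ := exists_oscillating_solution hω Φ₀ hδ₀ hSc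
    (fun ε h0 h1 b hb => by
      have := hA₀ ε h0 h1 b hb
      simpa [hW00] using this)
  choose! b u v T hb hsol hu0 hv0 hT0 hpass using hosc
  -- For k ≥ 1 the passage is centred at an exact zero of u, and the whole deviation of the velocity
  -- is put into U₁'(0), which thus depends on ε. The series then reproduces the data without error.
  choose Z hZ hZ0 hZderiv hZone using fun (ε : ℝ) (k : ℕ) => exists_separatrixSeries_zero_init ω
    (Φ₀ + ω * T ε k) (s := (-1) ^ k) (by rw [← pow_mul, mul_comm, pow_mul]; norm_num)
    ((v ε (T ε k) - (-1) ^ k) / ε)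
  set U : ℝ → ℕ → ℕ → ℝ → ℝ := fun ε k => if k = 0 then W (b ε) else Z ε k with hU
  have hsgn : ∀ k : ℕ, (-1 : ℝ) ^ k = 1 ∨ (-1 : ℝ) ^ k = -1 := neg_one_pow_eq_or ℝ
  have hsq : ∀ k : ℕ, ((-1 : ℝ) ^ k) ^ 2 = 1 := fun k => by
    rw [← pow_mul, mul_comm, pow_mul]; norm_num
  have hcos : ∀ t, |Real.cos (ω * t + Φ₀)| ≤ 1 := fun t => Real.abs_cos_le_one _
  have hβ0 : ∀ ε ∈ Set.Ioo 0 ε₀, (v ε (T ε 0) - (-1) ^ 0) / ε = b ε := fun ε hε => by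
    have := hε.1.ne'
    rw [hT0 ε hε.1 hε.2.le, hv0 ε hε.1 hε.2.le]; field_simp; ring
  have hUsep : ∀ ε ∈ Set.Ioo 0 ε₀, ∀ k,
      IsSeparatrixSeries ω (Φ₀ + ω * T ε k) ((-1) ^ k) (U ε k) := by
    intro ε hε k
    rcases eq_or_ne k 0 with rfl | hk
    · simpa [hU, hT0 ε hε.1 hε.2.le] using hW (b ε)
    · simpa [hU, hk] using hZ ε k
  have hUderiv : ∀ ε ∈ Set.Ioo 0 ε₀, ∀ k n, n ≠ 0 → deriv (U ε k n) 0
      = if n = 1 then (v ε (T ε k) - (-1) ^ k) / ε else 0 := by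
    intro ε hε k n hn
    rcases eq_or_ne k 0 with rfl | hk
    · rw [hβ0 ε hε]; simpa [hU] using hWderiv (b ε) n hn
    · simpa [hU, hk] using hZderiv ε k n hn
  have hUone : ∀ ε ∈ Set.Ioo 0 ε₀, ∀ k, ∃ a, U ε k 1 =
      linSol (fun t => Real.cos (ω * t + (Φ₀ + ω * T ε k))) a ((v ε (T ε k) - (-1) ^ k) / ε) := by
    intro ε hε k
    rcases eq_or_ne k 0 with rfl | hk
    · rw [hβ0 ε hε, hT0 ε hε.1 hε.2.le]
      simpa [hU] using hWone (b ε)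
    · exact ⟨0, by simpa [hU, hk] using hZone ε k⟩
  have htop : ∀ ε ∈ Set.Ioo 0 ε₀, ∀ k, ∃ A' B', HasParamsAtTop ω 1 (U ε k 1) A' B' ∧
      (-1) ^ k * B' < 0 := by
    intro ε hε k
    obtain ⟨a, ha⟩ := hUone ε hε k
    obtain ⟨A', h⟩ := exists_hasParamsAtTop_linSol (ω := ω)
      (f := fun t => Real.cos (ω * t + (Φ₀ + ω * T ε k))) (by fun_prop)
      (fun _ => Real.abs_cos_le_one _) (hasExpansion_cos ω _) a ((v ε (T ε k) - (-1) ^ k) / ε)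
    exact ⟨A', _, ha ▸ h, (hpass ε hε.1 hε.2.le k).2.2.2.2.1⟩
  have hbot : ∀ ε ∈ Set.Ioo 0 ε₀, ∀ k, ∃ A' B', HasParamsAtBot ω 1 (U ε (k + 1) 1) A' B' ∧
      (-1) ^ (k + 1) * B' < 0 := by
    intro ε hε k
    obtain ⟨a, ha⟩ := hUone ε hε (k + 1)
    obtain ⟨A', h⟩ := exists_hasParamsAtBot_linSol ω (Φ₀ + ω * T ε (k + 1)) a
      ((v ε (T ε (k + 1)) - (-1) ^ (k + 1)) / ε)
    exact ⟨A', _, ha ▸ h, (hpass ε hε.1 hε.2.le k).2.2.2.2.2⟩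
  have hβA : ∀ ε ∈ Set.Ioo 0 ε₀, ∀ k, |(v ε (T ε k) - (-1) ^ k) / ε| ≤ A := by
    intro ε hε k
    have h := (hpass ε hε.1 hε.2.le k).2.1
    rw [abs_div, abs_of_pos hε.1, div_le_iff₀ hε.1]
    rcases hsgn k with hs | hs <;> rw [hs] at h ⊢
    · rwa [one_mul] at h
    · rw [← abs_neg, show -(v ε (T ε k) - -1) = -1 * v ε (T ε k) - 1 by ring]
      exact h
  -- bounds of the initial data of the series
  have hWbd : ∀ n, ∃ D, ∀ j ≤ n, ∀ β, |β| ≤ 3 → |W β j 0| ≤ D := by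
    intro n
    have h1 : ∀ j, ∃ D, ∀ β, |β| ≤ 3 → |W β j 0| ≤ D := fun j => by
      obtain ⟨C, hC⟩ := (isCompact_Icc (a := (-3 : ℝ)) (b := 3)).exists_bound_of_continuousOn
        (hWcont j).continuousOn
      exact ⟨C, fun β hβ => hC β (abs_le.1 hβ)⟩
    choose D hD using h1
    refine ⟨∑ j ∈ range (n + 1), |D j|, fun j hj β hβ => (hD j β hβ).trans ((le_abs_self _).trans ?_)⟩
    exact single_le_sum (f := fun j => |D j|) (fun _ _ => abs_nonneg _) (mem_range.2 (by omega))
  have hinit : ∀ n, ∃ D, A ≤ D ∧ ∀ ε ∈ Set.Ioo 0 ε₀, ∀ k, ∀ j, 1 ≤ j → j ≤ n →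
      |U ε k j 0| ≤ D ∧ |deriv (U ε k j) 0| ≤ 2 * D := by
    intro n
    obtain ⟨D, hD⟩ := hWbd n
    refine ⟨max A D, le_max_left _ _, fun ε hε k j hj hjn => ⟨?_, ?_⟩⟩
    · rcases eq_or_ne k 0 with rfl | hk
      · have := hD j hjn (b ε) (hb ε hε.1 hε.2.le)
        simpa [hU] using Or.inr this
      · simp [hU, hk, hZ0, hA]
    · rw [hUderiv ε hε k j (by omega)]
      have h1 := le_max_left A D
      split_ifs
      · linarith [hβA ε hε k]
      · rw [abs_zero]; linarith
  -- No asymptotics is needed for the velocities: the terms of index 0 and 1 already give the exact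
  -- value, and the others vanish.
  have hvdata : ∀ ε ∈ Set.Ioo 0 ε₀, ∀ k m, 1 ≤ m →
      v ε (T ε k) - ∑ j ∈ range (m + 1), ε ^ j * deriv (U ε k j) 0 = 0 := by
    intro ε hε k m hm
    have h0 : deriv (U ε k 0) 0 = (-1) ^ k := by
      rw [show U ε k 0 = fun t => (-1) ^ k * Real.tanh t from funext (hUsep ε hε k).leading,
        ((hasDerivAt_tanh 0).const_mul _).deriv, sechSq_zero, mul_one]
    rw [sum_range_succ', h0, sum_congr rfl fun j _ => by
      rw [hUderiv ε hε k (j + 1) (by omega)], sum_eq_single_of_mem 0 (mem_range.2 (by omega))]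
    · have := hε.1.ne'
      simp only [zero_add, if_true, pow_one, pow_zero, one_mul]
      field_simp; ring
    · intro j _ hj
      rw [if_neg (by omega), mul_zero]
  refine ⟨ε₀, hε₀, fun ε => Bm (b ε), u, T, U, fun ε hε => ⟨hT0 ε hε.1 hε.2.le, hUsep ε hε,
    fun n hn => by simpa [hU] using hBm (b ε) n hn, fun k => ?_, fun k => ?_, fun k => ?_⟩, ?_, ?_, ?_⟩
  · obtain ⟨A', B', h1, h2⟩ := htop ε hε (2 * k)
    refine ⟨A', B', h1, ?_⟩
    rwa [pow_mul, neg_one_sq, one_pow, one_mul] at h2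
  · obtain ⟨A', B', h1, h2⟩ := hbot ε hε (2 * k)
    refine ⟨A', B', h1, ?_⟩
    rw [pow_succ, pow_mul, neg_one_sq, one_pow] at h2
    linarith
  · obtain ⟨A', B', h1, h2⟩ := htop ε hε (2 * k + 1)
    refine ⟨A', B', h1, ?_⟩
    rw [pow_succ, pow_mul, neg_one_sq, one_pow] at h2
    linarith
  · -- the residual vanishes identically
    obtain ⟨C, hC, δ, hδ, hδ1, hnear⟩ := exists_near_separatrix_at A hA
    refine ⟨δ, hδ, fun n => ⟨ε₀, hε₀, fun ε hε t ht => ?_⟩⟩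
    have hb2 : |u ε t| ≤ 2 ∧ |v ε t| ≤ 2 := by
      have hp := hpass ε hε.1 hε.2.le
      have hT := hT0 ε hε.1 hε.2.le
      rcases le_total 0 t with h0 | h0
      · obtain ⟨k, hk⟩ := exists_index_of_step hT
          (fun k => by linarith [(hp k).2.2.2.1.lt]) h0
        exact (hp k).2.2.2.1.bounded t hk
      · have := hnear ε _ (u ε) (v ε) hε.1 hcos (hsol ε hε.1 hε.2.le) _ (T ε 0) (hsgn 0) (hp 0).1
          (hp 0).2.1 t (by
            rw [hT, sub_zero, abs_of_nonpos h0, show 2 * -t = -2 * t by ring]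
            exact ht)
        exact this.2.2
    obtain ⟨h1, h2⟩ := (hsol ε hε.1 hε.2.le).contDiffAt_and_residual hb2.1 hb2.2
    refine ⟨h1, ?_⟩
    rw [h2, abs_zero]
    exact pow_nonneg hε.1.le n
  · refine ⟨fun n => ?_, fun n => ?_⟩
    · obtain ⟨D, -, hD⟩ := hinit n
      obtain ⟨C, -, hC⟩ := exists_coeff_bound D n
      refine ⟨C, fun ε hε k t => ?_⟩
      have := hC _ _ _ _ (hUsep ε hε k) (hsq k) (hD ε hε k) t n le_rfl
      rwa [← Real.exp_nat_mul, show (n : ℝ) * (2 * |t|) = 2 * n * |t| by ring] at this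
    · obtain ⟨D, hAD, hD⟩ := hinit n
      choose Cs hCs δs hδs hSm using hS
      set D' := max D (∑ m ∈ range (n + 1), Cs m) with hD'
      have hD'0 : 0 ≤ D' := hA.trans (hAD.trans (le_max_left _ _))
      have hCsD : ∀ m ≤ n, Cs m ≤ D' := fun m hm =>
        (single_le_sum (f := Cs) (fun i _ => hCs i) (mem_range.2 (by omega))).trans (le_max_right _ _)
      obtain ⟨δ', hδ', hδ'm⟩ : ∃ δ' > 0, ∀ m ≤ n, δ' ≤ δs m := by
        refine ⟨(range (n + 1)).inf' nonempty_range_add_one δs, ?_, fun m hm =>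
          inf'_le _ (mem_range.2 (by omega))⟩
        rw [gt_iff_lt, lt_inf'_iff]
        exact fun m _ => hδs m
      obtain ⟨C, δ, hδ, hexp⟩ := exists_expansion_bound A D' hA n
      refine ⟨C, min δ δ', lt_min hδ hδ', fun ε hε k t ht => ?_⟩
      have hp := hpass ε hε.1 hε.2.le k
      have hεδ' : ε ≤ δ' := by
        have h1 : (1 : ℝ) ≤ Real.exp (2 * |t - T ε k|) := Real.one_le_exp (by positivity)
        have h2 := le_mul_of_one_le_right hε.1.le h1
        exact h2.trans (ht.trans (min_le_right _ _))
      refine hexp ω Φ₀ ε ((-1) ^ k) (T ε k) (u ε) (v ε) (U ε k) hε.1 (hsol ε hε.1 hε.2.le) (hsgn k)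
        hp.1 hp.2.1 (hUsep ε hε k) (fun j h1 h2 => ?_) (fun m h1 h2 => ⟨?_, ?_⟩) t
        (ht.trans (min_le_left _ _))
      · have := hD ε hε k j h1 h2
        have h3 := le_max_left D (∑ m ∈ range (n + 1), Cs m)
        exact ⟨this.1.trans h3, this.2.trans (by linarith)⟩
      -- For the first passage the initial value is asymptotic to the series by the construction of
      -- S; for the later ones both sides vanish.
      · rcases k with _ | k
        · rw [hT0 ε hε.1 hε.2.le, hu0 ε hε.1 hε.2.le]
          have h3 := hSm m ε hε.1 (hεδ'.trans (hδ'm m h2)) (b ε) (hb ε hε.1 hε.2.le)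
          have h4 := mul_le_mul_of_nonneg_right (hCsD m h2) (pow_nonneg hε.1.le (m + 1))
          simpa [hU] using h3.trans h4
        · have hz := (hpass ε hε.1 hε.2.le k).2.2.2.1.zero
          have h3 : ∑ j ∈ range (m + 1), ε ^ j * U ε (k + 1) j 0 = 0 :=
            sum_eq_zero fun j _ => by simp [hU, hZ0]
          rw [hz, h3, sub_zero, abs_zero]
          exact mul_nonneg hD'0 (pow_nonneg hε.1.le _)
      · rw [hvdata ε hε k m h1, abs_zero]
        exact mul_nonneg zero_le_two (mul_nonneg hD'0 (pow_nonneg hε.1.le _))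
  · obtain ⟨C, hC, δ, hδ, hδ1, hnear⟩ := exists_near_separatrix_at A hA
    set K := 9 / 2 + |Real.log cl| / 2 with hK
    have hK0 : 0 ≤ K := by positivity
    have hgap : ∀ ε ∈ Set.Ioo 0 ε₀, ∀ k, |T ε (k + 1) - T ε k + Real.log ε / 2| ≤ K := by
      intro ε hε k
      have hp := hpass ε hε.1 hε.2.le k
      exact abs_sub_add_log_le hε.1 hcl hp.2.2.1 hp.2.2.2.1.time
    refine ⟨K, hgap, fun η hη => ?_⟩
    set κ := min δ (η / C) with hκ
    have hκ0 : 0 < κ := by positivity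
    -- At every time the nearest centre is within half a gap, so ε e^{2|t - T_j|} ≤ ε^{1/2} e^K. The
    -- bound on ε makes this at most κ.
    refine ⟨min ε₀ (Real.exp (2 * (Real.log κ - K))), by positivity, fun ε hε N t ht => ?_⟩
    have hεε₀ : ε ∈ Set.Ioo 0 ε₀ := ⟨hε.1, hε.2.trans_le (min_le_left _ _)⟩
    have hlog : Real.log ε / 2 + K ≤ Real.log κ := by
      have h1 : ε ≤ Real.exp (2 * (Real.log κ - K)) := (hε.2.trans_le (min_le_right _ _)).le
      have h2 := Real.log_le_log hε.1 h1
      rw [Real.log_exp] at h2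
      linarith
    have hp := hpass ε hεε₀.1 hεε₀.2.le
    obtain ⟨k, hk1, hk2⟩ := exists_index_of_step (hT0 ε hεε₀.1 hεε₀.2.le)
      (fun k => by linarith [(hp k).2.2.2.1.lt]) ht.1
    have hg := (abs_le.1 (hgap ε hεε₀ k)).2
    obtain ⟨j, hj⟩ : ∃ j, 2 * |t - T ε j| ≤ -Real.log ε / 2 + K := by
      rcases le_total (t - T ε k) (T ε (k + 1) - t) with h | h
      · refine ⟨k, ?_⟩
        rw [abs_of_nonneg (by linarith)]; linarith
      · refine ⟨k + 1, ?_⟩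
        rw [abs_of_nonpos (by linarith)]; linarith
    have hle : ε * Real.exp (2 * |t - T ε j|) ≤ κ := by
      rw [← Real.exp_log hε.1, ← Real.exp_add, Real.exp_log hε.1, ← Real.exp_log hκ0]
      exact Real.exp_le_exp.2 (by linarith)
    have hn := hnear ε _ (u ε) (v ε) hε.1 hcos (hsol ε hεε₀.1 hεε₀.2.le) _ (T ε j) (hsgn j) (hp j).1
      (hp j).2.1 t (hle.trans (min_le_left _ _))
    have hCη : C * (ε * Real.exp (2 * |t - T ε j|)) ≤ η := by
      have h1 := mul_le_mul_of_nonneg_left (hle.trans (min_le_right _ _)) hC.le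
      rwa [mul_div_cancel₀ _ hC.ne'] at h1
    refine ⟨j, by linarith, hn.1.trans hCη, ?_⟩
    rw [((hsol ε hεε₀.1 hεε₀.2.le).hasDerivAt_left (hn.2.2.2.trans (by norm_num))).deriv]
    exact hn.2.1.trans hCη
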